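/- Fix a finite alphabet $\Sigma$ containing two distinct letters $0,1$. A *$k$-round rational interactive protocol* ($k\ge 0$) consists of polynomial-time computable functions $V$ (values in $\Sigma^*$), $R$ (values in $[0,1]$, written as finite binary fractions) and $\varphi$ (values in $\Sigma^*$), defined on tuples of words over $\Sigma$, and of polynomials $p,l$. On input $x\in\Sigma^*$, Arthur's private random strings $r_1,\dots,r_k$ are independent and uniform on $\{0,1\}^{l(|x|)}$. In round $i+1$ ($0\le i<k$) Merlin sends a word $m_{i+1}\in\Sigma^*$ of length at most $p(|x|)$, and Arthur answers $a_{i+1}=V(x;m_1,a_1,\dots,a_i,m_{i+1};r_1,\dots,r_{i+1})$. The reward is $R(x;m_1,r_1,\dots,m_k,r_k)$ and the computed value is $\varphi(x;m_1,a_1,\dots,m_k)$. Merlin is *rational* if for every $i=0,\dots,k-1$, given the messages $m_1,a_1,\dots,m_i,a_i$ exchanged so far, $$m_{i+1}\in\operatorname{Argmax}_{m}\ \mathbb E_{a_{i+1}}\max_{m_{i+2}}\mathbb E_{a_{i+2}}\cdots\max_{m_k}\mathbb E_{a_k}\,R,$$ where the maxima are over messages of length at most $p(|x|)$ and the expectations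 are conditional on the messages exchanged so far (Merlin does not see the $r_j$). A function $f:\Sigma^*\to\Sigma^*$ is *computed* in the protocol if for every $x$ and every rational behaviour of Merlin the computed value equals $f(x)$ in every interaction that occurs with positive probability. $\mathrm{FRMA}[k]$ is the set of functions computed in some $k$-round protocol, and $\mathrm{DRMA}[k]$ is the class of languages $S\subseteq\Sigma^*$ whose characteristic function (with values the one-letter words $0,1$) is in $\mathrm{FRMA}[k]$. For a class $\mathcal C$ of languages, $\mathrm P^{\mathcal C}$ is the class of languages that are decided by a polynomial-time deterministic oracle Turing machine with an oracle $A\in\mathcal C$, i.e. of languages that are polynomial-time Turing reducible to some $A\in\mathcal C$. **Corollary.** For every integer $k\ge 0$, $$\mathrm P^{\mathrm{DRMA}[k]}=\mathrm{DRMA}[k],$$ that is, each level of the $\mathrm{DRMA}$ hierarchy is closed under polynomial-time Turing reductions. -/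

import Mathlib

open scoped BigOperators

namespace RationalProofs

/-! ### Polynomial-time computation

Throughout, `A` is the working alphabet and `bit : Bool ↪ A` singles out its two letters `0` and
`1`. Turing machines are the machines `Turing.FinTM2`: a finite control with finitely many stacks,
which counts one step per executed (loop-free) statement block. -/

/-- A tuple of words, written as one word over `A ∪ {#}`: every component is followed by the
separator `# = none`. -/
def encodeTuple {A : Type} (z : List (List A)) : List (Option A) :=
  z.flatMap fun w => w.map some ++ [none]

/-- The function `f` from tuples of words over `A` to words over `B` is computable by a Turing
machine in time polynomial in the total length of the tuple. -/
def PolyTimeOnTuples {A B : Type} (f : List (List A) → List B) : Prop :=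
  Nonempty (Turing.TM2ComputableInPolyTime (encodeTuple (A := A)) (id : List B → List B) f)

/-- The characteristic function of a language `S`, with values the one-letter words `1`, `0`. -/
noncomputable def charFun {A : Type} (bit : Bool ↪ A) (S : Language A) (x : List A) : List A :=
  open Classical in [bit (decide (x ∈ S))]

/-- An oracle Turing machine over the alphabet `A`: a Turing machine with a designated query stack
and three designated labels. -/
structure OracleTM (A : Type) extends Turing.TM2ComputableAux A A where
  /-- the stack from which oracle queries are read -/
  queryStack : tm.K
  /-- its alphabet is `A` -/
  queryAlphabet : tm.Γ queryStack ≃ A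
  /-- on arriving at this label the machine queries the oracle -/
  queryLabel : tm.Λ
  /-- the label at which it continues if the answer is positive -/
  yesLabel : tm.Λ
  /-- the label at which it continues if the answer is negative -/
  noLabel : tm.Λ

/-- One step of an oracle machine with oracle `O`. At the query label the membership in `O` of the
word on the query stack decides the next label, and nothing else changes; everywhere else the
machine makes an ordinary step. A query costs one step. -/
noncomputable def OracleTM.step {A : Type} (M : OracleTM A) (O : Language A) (c : M.tm.Cfg) :
    Option M.tm.Cfg :=
  open Classical in
  if c.l = some M.queryLabel then
    some { c with
      l := some (if (c.stk M.queryStack).map M.queryAlphabet ∈ O then M.yesLabel else M.noLabel) }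
  else M.tm.step c

/-- Starting on the word `x`, the machine `M` with oracle `O` halts with output `y` after at most
`n` steps. -/
def OracleTM.OutputsInTime {A : Type} (M : OracleTM A) (O : Language A) (x y : List A) (n : ℕ) :
    Prop :=
  Nonempty (StateTransition.EvalsToInTime (M.step O)
    (Turing.initList M.tm (x.map M.inputAlphabet.symm))
    (some (Turing.haltList M.tm (y.map M.outputAlphabet.symm))) n)

/-- `S` is polynomial-time Turing reducible to `O`, that is, `S ∈ P^O`. -/
def PolyTimeTuringReducible {A : Type} (bit : Bool ↪ A) (S O : Language A) : Prop :=
  ∃ (M : OracleTM A) (p : Polynomial ℕ),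
    ∀ x : List A, M.OutputsInTime O x (charFun bit S x) (p.eval x.length)

/-- The class `P^C` for a class of languages `C`: the union of the classes `P^O` for `O ∈ C`. -/
def PRel {A : Type} (bit : Bool ↪ A) (C : Set (Language A)) : Set (Language A) :=
  {S | ∃ O ∈ C, PolyTimeTuringReducible bit S O}

/-! ### Rational interactive protocols -/

/-- The value of the finite binary fraction `b₀.b₁b₂…bₙ`. -/
noncomputable def binaryValue : List Bool → ℝ
  | [] => 0
  | b :: w => (if b then 1 else 0) + binaryValue w / 2

/-- A `k`-round rational interactive protocol. The functions act on tuples of words: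
Arthur's `(i+1)`-st message is `V(x, m₁, a₁, …, mᵢ, aᵢ, mᵢ₊₁, r₁, …, rᵢ₊₁)`, the reward is
`R(x, m₁, r₁, …, mₖ, rₖ)` and the computed value is `φ(x, m₁, a₁, …, mₖ)`. -/
structure Protocol (A : Type) (k : ℕ) where
  /-- computes Arthur's messages -/
  V : List (List A) → List A
  /-- the reward function, whose values are given as finite binary fractions -/
  R : List (List A) → List Bool
  /-- the value function -/
  φ : List (List A) → List A
  V_polyTime : PolyTimeOnTuples V
  R_polyTime : PolyTimeOnTuples R
  φ_polyTime : PolyTimeOnTuples φ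
  /-- rewards lie in `[0, 1]` -/
  R_le_one : ∀ z, binaryValue (R z) ≤ 1
  /-- Merlin's messages on input `x` have length at most `msgLen(|x|)` -/
  msgLen : Polynomial ℕ
  /-- Arthur's random string in each round on input `x` is uniform on `{0,1}^{randLen(|x|)}` -/
  randLen : Polynomial ℕ

/-- A transcript of `i` rounds: the list `(m₁, a₁), …, (mᵢ, aᵢ)`. -/
abbrev Transcript (A : Type) : Type := List (List A × List A)

namespace Protocol

variable {A : Type} {k : ℕ}

/-- The outcomes of all of Arthur's coin tosses on input `x`: one string for each round. -/
abbrev Coins (P : Protocol A k) (x : List A) : Type :=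
  Fin k → Fin (P.randLen.eval x.length) → Bool

/-- The messages that Merlin may send on input `x`. -/
abbrev Message (P : Protocol A k) (x : List A) : Type :=
  {m : List A // m.length ≤ P.msgLen.eval x.length}

/-- Arthur's random strings `r₁, …, rₖ` as words over `A`. -/
def coinWords (P : Protocol A k) (bit : Bool ↪ A) (x : List A) (r : P.Coins x) : List (List A) :=
  List.ofFn fun i => (List.ofFn (r i)).map bit

/-- The words `m₁, a₁, …, mᵢ, aᵢ` of a transcript. -/
def words (t : Transcript A) : List (List A) :=
  t.flatMap fun p => [p.1, p.2]

/-- Arthur's answer to Merlin's message `m` after the transcript `t`, when his coins are `r`. He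
uses only the coins of the rounds up to the present one. -/
def answer (P : Protocol A k) (bit : Bool ↪ A) (x : List A) (t : Transcript A) (m : List A)
    (r : P.Coins x) : List A :=
  P.V (x :: (words t ++ [m] ++ (P.coinWords bit x r).take (t.length + 1)))

/-- The coins under which Arthur would have sent exactly the answers recorded in `t`. -/
noncomputable def consistent (P : Protocol A k) (bit : Bool ↪ A) (x : List A)
    (t : Transcript A) : Finset (P.Coins x) :=
  open Classical in
  Finset.univ.filter fun r =>
    ∀ (i : ℕ) (h : i < t.length), t[i].2 = P.answer bit x (t.take i) t[i].1 r

/-- The reward `R(x, m₁, r₁, …, mₖ, rₖ)` at the end of the interaction. -/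
noncomputable def reward (P : Protocol A k) (bit : Bool ↪ A) (x : List A) (t : Transcript A)
    (r : P.Coins x) : ℝ :=
  binaryValue (P.R (x :: (List.zipWith (fun p s => [p.1, s]) t (P.coinWords bit x r)).flatten))

/-- The conditional expectation, given the transcript `t` and Merlin's next message `m`, of the
quantity `F` of the transcript prolonged by `m` and Arthur's answer. Arthur's coins are private:
Merlin knows about them only that they are consistent with `t`. -/
noncomputable def expectNext (P : Protocol A k) (bit : Bool ↪ A) (x : List A)
    (F : Transcript A → ℝ) (t : Transcript A) (m : List A) : ℝ :=
  𝔼 r ∈ P.consistent bit x t, F (t ++ [(m, P.answer bit x t m r)])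

/-- The maximal conditional expectation of the reward given the transcript `t`, when `n` rounds
remain to be played. -/
noncomputable def optValue (P : Protocol A k) (bit : Bool ↪ A) (x : List A) :
    ℕ → Transcript A → ℝ
  | 0, t => 𝔼 r ∈ P.consistent bit x t, P.reward bit x t r
  | n + 1, t => ⨆ m : P.Message x, P.expectNext bit x (P.optValue bit x n) t m.1

/-- Merlin was rational throughout the transcript `t`: every message `mᵢ₊₁` of his is admissible
and maximizes, over all admissible messages, the expected reward given the first `i` rounds. -/
def IsRational (P : Protocol A k) (bit : Bool ↪ A) (x : List A) (t : Transcript A) : Prop :=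
  ∀ (i : ℕ) (h : i < t.length),
    t[i].1.length ≤ P.msgLen.eval x.length ∧
    ∀ m : P.Message x,
      P.expectNext bit x (P.optValue bit x (k - (i + 1))) (t.take i) m.1 ≤
        P.expectNext bit x (P.optValue bit x (k - (i + 1))) (t.take i) t[i].1

/-- The function `f` is computed in the protocol: on every input, in every complete transcript that
occurs with positive probability and in which Merlin is rational, the value is correct. The value
function does not see Arthur's last message. -/
def Computes (P : Protocol A k) (bit : Bool ↪ A) (f : List A → List A) : Prop :=
  ∀ (x : List A) (t : Transcript A), t.length = k → (P.consistent bit x t).Nonempty →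
    P.IsRational bit x t → P.φ (x :: (words t).dropLast) = f x

end Protocol

/-- The class `FRMA[k]` of functions computed in some `k`-round rational interactive protocol. -/
def FRMA {A : Type} (bit : Bool ↪ A) (k : ℕ) : Set (List A → List A) :=
  {f | ∃ P : Protocol A k, P.Computes bit f}

/-- The class `DRMA[k]` of languages whose characteristic function is in `FRMA[k]`. -/
def DRMA {A : Type} (bit : Bool ↪ A) (k : ℕ) : Set (Language A) :=
  {S | charFun bit S ∈ FRMA bit k}

end RationalProofs

/-! One inclusion holds because every language is reducible to itself. For the other, let an oracle
machine decide `S` in polynomial time with an oracle `O` that is decided by a `k`-round protocol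
`P`.

If `k = 0`, Merlin is silent and the value function of `P` decides `O` in polynomial time, so the
oracle machine can be simulated outright (`PRel_subset_DRMA_zero`).

If `k ≥ 1`, adaptive queries have to be handled without extra rounds. Merlin's first message claims
an oracle answer for every step of the machine and commits to a first message of `P` for every step.
The claims alone determine a whole computation, hence all queries, and the composed protocol outputs
the result of that computation. Arthur selects the step `j` to be checked by the number of leading
zeros of his first random string, reveals `j` in his first answer, and in this and the remaining
rounds `P` is played on the query of step `j`. The reward is `1/2 + R/4` if the value computed by
`P` agrees with the claim and `0` otherwise, scaled by `2^(-jN)`, where `N` is the length of each of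
Arthur's strings.

A rational Merlin then tells the truth, for two reasons. First, a false claim on a correct query has
a noticeable price (`Protocol.Computes.optGen_valueReward_add_le`). To support a wrong value Merlin
must either leave rational play of `P`, which lowers the expected `R`, or obtain the true value and
reward `0`; so his optimum is strictly smaller. Optimal values are integer multiples of a power of
`1/2` with polynomial exponent, so strictly smaller means smaller by such a power. Second, early
steps outweigh late ones. At the first step `J` with a missing or false claim, the earlier steps
yield at most what honest play yields; step `J` loses at least `2^(-JN) * 2^(-N)` when it is
selected; the later steps yield at most `3/4 * 2^(-(J+1)N)`, and `more than J zeros` is exactly as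
likely as `J zeros`. Hence honesty is strictly better (`Composition.correct_of_optimal`).

That `P` is faithfully played inside the composed protocol, although Arthur's coins are private, is
the content of `Protocol.Embeds`: once the selected step is known, a window of the coins is
uniformly distributed and the conditional expectations agree.

Polynomial time refers to concrete Turing machines. It is handled through a small language of stack
programs with good closure properties (`PT`), which is equivalent to machine computability by
`PT.polyTimeOnTuples` and `PolyTimeOnTuples.pt`. -/

open scoped BigOperators
namespace RationalProofs

/-! ### Stack programs -/

/-- Structured programs acting on finitely many stacks of natural numbers. -/
inductive Cmd (K : Type) : Type
  | skip : Cmd K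
  | push (k : K) (a : ℕ) : Cmd K
  | pop (k : K) : Cmd K
  | seq (c d : Cmd K) : Cmd K
  | ite (k : K) (o : Option ℕ) (c d : Cmd K) : Cmd K
  | loop (k : K) (c : Cmd K) : Cmd K

/-- The contents of all stacks. -/
abbrev Store (K : Type) : Type := K → List ℕ

/-- `Run c s t n`: started on the store `s`, the program `c` ends on the store `t` after exactly
`n` steps. -/
inductive Run {K : Type} [DecidableEq K] : Cmd K → Store K → Store K → ℕ → Prop
  | skip (s) : Run .skip s s 1
  | push (k a s) : Run (.push k a) s (Function.update s k (a :: s k)) 1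
  | pop (k s) : Run (.pop k) s (Function.update s k (s k).tail) 1
  | seq {c d s t u m n} : Run c s t m → Run d t u n → Run (.seq c d) s u (m + n)
  | ite_true {k o c d s t n} : (s k).head? = o → Run c s t n → Run (.ite k o c d) s t (n + 1)
  | ite_false {k o c d s t n} : (s k).head? ≠ o → Run d s t n → Run (.ite k o c d) s t (n + 1)
  | loop_nil {k c s} : s k = [] → Run (.loop k c) s s 1
  | loop_cons {k c s t u m n} : s k ≠ [] → Run c s t m → Run (.loop k c) t u n →
      Run (.loop k c) s u (m + n + 1)

namespace Cmd

variable {K K' : Type}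

/-- Renaming the stacks of a program. -/
def map (e : K → K') : Cmd K → Cmd K'
  | skip => skip
  | push k a => push (e k) a
  | pop k => pop (e k)
  | seq c d => seq (c.map e) (d.map e)
  | ite k o c d => ite (e k) o (c.map e) (d.map e)
  | loop k c => loop (e k) (c.map e)

/-- Every instruction `push k a` of the program satisfies `P k a`. -/
def PushesIn (P : K → ℕ → Prop) : Cmd K → Prop
  | skip => True
  | push k a => P k a
  | pop _ => True
  | seq c d => c.PushesIn P ∧ d.PushesIn P
  | ite _ _ c d => c.PushesIn P ∧ d.PushesIn P
  | loop _ c => c.PushesIn P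

theorem PushesIn.map {P : K' → ℕ → Prop} {e : K → K'} (h : ∀ k a, P (e k) a) (c : Cmd K) :
    (c.map e).PushesIn P := by
  induction c <;> simp_all [Cmd.map, PushesIn]

/-- Branching on the top letter of stack `k`, which has to be less than `N`. -/
def dispatch (k : K) (f : ℕ → Cmd K) : ℕ → Cmd K
  | 0 => skip
  | N + 1 => ite k (some N) (f N) (dispatch k f N)

/-- Empty all stacks of a list. -/
def clear : List K → Cmd K
  | [] => skip
  | k :: l => seq (loop k (pop k)) (clear l)

/-- Move the contents of stack `k` on top of stack `k'`, in reverse order. Letters are less than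
`N`. -/
def moveRev (N : ℕ) (k k' : K) : Cmd K :=
  loop k (dispatch k (fun a => seq (pop k) (push k' a)) N)

/-- Move the contents of stack `k` on top of the stacks `k'` and `k''`, in reverse order. -/
def moveRev₂ (N : ℕ) (k k' k'' : K) : Cmd K :=
  loop k (dispatch k (fun a => seq (pop k) (seq (push k' a) (push k'' a))) N)

/-- Copy the contents of stack `k` on top of stack `k'`. -/
def copy (N : ℕ) (k k' tmp : K) : Cmd K :=
  seq (moveRev N k tmp) (moveRev₂ N tmp k k')

/-- Perform a list of programs in order. -/
def seqs : List (Cmd K) → Cmd K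
  | [] => skip
  | c :: l => seq c (seqs l)

end Cmd

/-- The total length of all stacks. -/
def Store.size {K : Type} [Fintype K] (s : Store K) : ℕ := ∑ k, (s k).length

theorem Store.size_update {K : Type} [Fintype K] [DecidableEq K] (s : Store K) (k : K)
    (l : List ℕ) : Store.size (Function.update s k l) + (s k).length = s.size + l.length := by
  have h := Finset.add_sum_erase Finset.univ (fun i => (s i).length) (Finset.mem_univ k)
  have h' := Finset.add_sum_erase Finset.univ
    (fun i => (Function.update s k l i).length) (Finset.mem_univ k)
  have : ∑ i ∈ Finset.univ.erase k, (Function.update s k l i).length =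
      ∑ i ∈ Finset.univ.erase k, (s i).length :=
    Finset.sum_congr rfl fun i hi => by rw [Function.update_of_ne (Finset.ne_of_mem_erase hi)]
  simp only [Function.update_self] at h'
  simp only [Store.size]
  omega

namespace Run

variable {K K' : Type} [DecidableEq K] [DecidableEq K']

theorem of_eq {c : Cmd K} {s t t' : Store K} {n : ℕ} (h : Run c s t n) (ht : t = t') :
    Run c s t' n :=
  ht ▸ h

/-- A step pushes at most one letter. This is how a time bound yields a bound on the size of the
output. -/
theorem size_le [Fintype K] {c : Cmd K} {s t : Store K} {n : ℕ} (h : Run c s t n) :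
    t.size ≤ s.size + n := by
  induction h with
  | skip s => omega
  | push k a s => have := Store.size_update s k (a :: s k); simp at this; omega
  | pop k s => have := Store.size_update s k (s k).tail; simp at this; omega
  | _ => omega

/-- Injectivity keeps renamed stacks distinct, so the renamed program works on the image of `e`
only; `Function.extend` keeps every other stack as it was. Programs can thus be run side by side on
a larger store. -/
theorem map_extend {e : K → K'} (he : Function.Injective e) {c : Cmd K} {s₁ t₁ : Store K} {n : ℕ}
    (h : Run c s₁ t₁ n) : ∀ s : Store K', (∀ i, s (e i) = s₁ i) →
      Run (c.map e) s (Function.extend e t₁ s) n := by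
  have upd : ∀ (s₁ : Store K) (s : Store K') (k : K) (l : List ℕ), (∀ i, s (e i) = s₁ i) →
      Function.extend e (Function.update s₁ k l) s = Function.update s (e k) l := by
    intro s₁ s k l hs
    funext j
    by_cases hj : ∃ i, e i = j
    · obtain ⟨i, rfl⟩ := hj
      rw [he.extend_apply]
      by_cases hi : i = k
      · subst hi; simp
      · rw [Function.update_of_ne hi, Function.update_of_ne (he.ne hi), hs]
    · rw [Function.extend_apply' _ _ _ hj, Function.update_of_ne]
      rintro rfl
      exact hj ⟨k, rfl⟩
  have refl : ∀ (s₁ : Store K) (s : Store K'), (∀ i, s (e i) = s₁ i) →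
      Function.extend e s₁ s = s := by
    intro s₁ s hs
    funext j
    by_cases hj : ∃ i, e i = j
    · obtain ⟨i, rfl⟩ := hj
      rw [he.extend_apply, hs]
    · rw [Function.extend_apply' _ _ _ hj]
  have trans : ∀ (t u : Store K) (s : Store K'),
      Function.extend e u (Function.extend e t s) = Function.extend e u s := by
    intro t u s
    funext j
    by_cases hj : ∃ i, e i = j
    · obtain ⟨i, rfl⟩ := hj
      rw [he.extend_apply, he.extend_apply]
    · simp only [Function.extend_apply' _ _ _ hj]
  induction h with
  | skip s₁ => intro s hs; rw [refl _ _ hs]; exact .skip s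
  | push k a s₁ => intro s hs; rw [upd _ _ _ _ hs, ← hs k]; exact .push _ _ _
  | pop k s₁ => intro s hs; rw [upd _ _ _ _ hs, ← hs k]; exact .pop _ _
  | @seq c d s₁ t₁ u₁ m n _ _ ih₁ ih₂ =>
    intro s hs
    have := ih₂ (Function.extend e t₁ s) fun i => he.extend_apply _ _ _
    rw [trans] at this
    exact .seq (ih₁ s hs) this
  | ite_true h₀ _ ih => intro s hs; exact .ite_true (by rw [hs, h₀]) (ih s hs)
  | ite_false h₀ _ ih => intro s hs; exact .ite_false (by rwa [hs]) (ih s hs)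
  | loop_nil h₀ => intro s hs; rw [refl _ _ hs]; exact .loop_nil (by rw [hs, h₀])
  | @loop_cons k c s₁ t₁ u₁ m n h₀ _ _ ih₁ ih₂ =>
    intro s hs
    have := ih₂ (Function.extend e t₁ s) fun i => he.extend_apply _ _ _
    rw [trans] at this
    exact .loop_cons (by rwa [hs]) (ih₁ s hs) this

theorem map {e : K → K'} (he : Function.Injective e) {c : Cmd K} {s₁ t₁ : Store K} {n : ℕ}
    (h : Run c s₁ t₁ n) {s t : Store K'} (hs : ∀ i, s (e i) = s₁ i) (ht : ∀ i, t (e i) = t₁ i)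
    (hne : ∀ j, (∀ i, e i ≠ j) → t j = s j) : Run (c.map e) s t n := by
  have : t = Function.extend e t₁ s := by
    funext j
    by_cases hj : ∃ i, e i = j
    · obtain ⟨i, rfl⟩ := hj
      rw [he.extend_apply, ht]
    · rw [Function.extend_apply' _ _ _ hj]
      exact hne j fun i hi => hj ⟨i, hi⟩
  rw [this]
  exact h.map_extend he s hs

/-- The top letter is compared with `N - 1`, `N - 2`, … in turn, so at most `N` tests are added to
the time of the selected branch. -/
theorem dispatch {k : K} {f : ℕ → Cmd K} {s t : Store K} {a n : ℕ} (ha : (s k).head? = some a)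
    (h : Run (f a) s t n) : ∀ {N : ℕ}, a < N → ∃ m ≤ n + N, Run (Cmd.dispatch k f N) s t m
  | 0, h => by omega
  | N + 1, hN => by
    by_cases haN : a = N
    · subst haN
      exact ⟨n + 1, by omega, .ite_true ha h⟩
    · obtain ⟨m, hm, h'⟩ := dispatch ha h (N := N) (by omega)
      refine ⟨m + 1, by omega, .ite_false ?_ h'⟩
      rw [ha]
      simpa using haN

theorem clear_one (k : K) : ∀ (l : List ℕ) (s : Store K), s k = l →
    Run (.loop k (.pop k)) s (Function.update s k []) (2 * l.length + 1)
  | [], s, h => by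
    have : Function.update s k [] = s := by rw [← h, Function.update_eq_self]
    rw [this]
    exact .loop_nil h
  | a :: l, s, h => by
    have h₁ := clear_one k l (Function.update s k (s k).tail) (by simp [h])
    rw [Function.update_idem] at h₁
    have := Run.loop_cons (by simp [h]) (Run.pop k s) h₁
    convert this using 1
    simp; ring

theorem clear [Fintype K] : ∀ (l : List K) (s : Store K), ∃ n ≤ l.length * (2 * s.size + 1) + 1,
    Run (Cmd.clear l) s (fun k => if k ∈ l then [] else s k) n
  | [], s => ⟨1, by simp, by simpa [Cmd.clear] using Run.skip s⟩
  | k :: l, s => by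
    obtain ⟨n, hn, h⟩ := clear l (Function.update s k [])
    have hsz := Store.size_update s k []
    have hk := clear_one k _ s rfl
    refine ⟨_, ?_, hk.seq (n := n) ?_⟩
    · have : (s k).length ≤ s.size :=
        Finset.single_le_sum (f := fun k => (s k).length) (fun _ _ => Nat.zero_le _)
          (Finset.mem_univ k)
      have h2 : Store.size (Function.update s k []) ≤ s.size := by simp at hsz; omega
      have h3 : l.length * (2 * Store.size (Function.update s k []) + 1) ≤
          l.length * (2 * s.size + 1) := by gcongr
      simp only [List.length_cons, add_mul]
      omega
    · convert h using 1
      funext j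
      by_cases hj : j = k
      · subst hj; simp
      · simp [hj]

/-- Each letter costs one loop test, at most `N` comparisons, one pop and one push; the last `1` is
the test that finds the stack empty. -/
theorem moveRev {N : ℕ} {k k' : K} (hk : k ≠ k') : ∀ (l : List ℕ) (s : Store K), s k = l →
    (∀ a ∈ l, a < N) → ∃ n ≤ (N + 3) * l.length + 1, Run (Cmd.moveRev N k k') s
      (Function.update (Function.update s k []) k' (l.reverse ++ s k')) n
  | [], s, h, _ => ⟨1, by simp, by
      have : Function.update s k [] = s := by rw [← h, Function.update_eq_self]
      simp only [List.reverse_nil, List.nil_append, this, Function.update_eq_self]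
      exact .loop_nil h⟩
  | a :: l, s, h, hl => by
    obtain ⟨m, hm, h₁⟩ := Run.dispatch (k := k) (s := s) (a := a) (N := N)
      (f := fun a => .seq (.pop k) (.push k' a)) (by simp [h])
      (.seq (.pop k s) (.push k' a _)) (hl a (by simp))
    obtain ⟨n, hn, h₂⟩ := moveRev hk l (Function.update (Function.update s k (s k).tail) k'
      (a :: Function.update s k (s k).tail k')) (by simp [hk, h]) (fun b hb => hl b (by simp [hb]))
    refine ⟨_, ?_, .loop_cons (by simp [h]) h₁ (h₂.of_eq (by
      funext j
      by_cases hj : j = k'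
      · subst hj; simp [hk.symm]
      · by_cases hj' : j = k
        · subst hj'; simp [hk]
        · simp [hj, hj']))⟩
    simp only [List.length_cons, mul_add]
    omega

theorem moveRev₂ {N : ℕ} {k k' k'' : K} (hk : k ≠ k') (hk' : k ≠ k'') (hkk : k' ≠ k'') :
    ∀ (l : List ℕ) (s : Store K), s k = l →
    (∀ a ∈ l, a < N) → ∃ n ≤ (N + 4) * l.length + 1, Run (Cmd.moveRev₂ N k k' k'') s
      (Function.update (Function.update (Function.update s k []) k' (l.reverse ++ s k')) k''
        (l.reverse ++ s k'')) n
  | [], s, h, _ => ⟨1, by simp, by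
      have : Function.update s k [] = s := by rw [← h, Function.update_eq_self]
      simp only [List.reverse_nil, List.nil_append, this, Function.update_eq_self]
      exact .loop_nil h⟩
  | a :: l, s, h, hl => by
    obtain ⟨m, hm, h₁⟩ := Run.dispatch (k := k) (s := s) (a := a) (N := N)
      (f := fun a => .seq (.pop k) (.seq (.push k' a) (.push k'' a))) (by simp [h])
      (.seq (.pop k s) (.seq (.push k' a _) (.push k'' a _))) (hl a (by simp))
    obtain ⟨n, hn, h₂⟩ := moveRev₂ hk hk' hkk l (Function.update (Function.update
      (Function.update s k (s k).tail) k' (a :: Function.update s k (s k).tail k')) k''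
      (a :: Function.update (Function.update s k (s k).tail) k'
        (a :: Function.update s k (s k).tail k') k'')) (by simp [hk, hk', h])
      (fun b hb => hl b (by simp [hb]))
    refine ⟨_, ?_, .loop_cons (by simp [h]) h₁ (h₂.of_eq (by
      funext j
      by_cases hj : j = k''
      · subst hj; simp [hk'.symm, hkk.symm]
      · by_cases hj'' : j = k'
        · subst hj''; simp [hk.symm, hkk]
        · by_cases hj' : j = k
          · subst hj'; simp [hk, hk']
          · simp [hj, hj', hj'']))⟩
    simp only [List.length_cons, mul_add]
    omega

/-- Two reversals restore the order, and the second one writes both to the source and to the target.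
The auxiliary stack must start empty, since its whole content is moved back. -/
theorem copy {N : ℕ} {k k' tmp : K} (h₁ : k ≠ k') (h₂ : k ≠ tmp) (h₃ : k' ≠ tmp) {s : Store K}
    (hl : ∀ a ∈ s k, a < N) (ht : s tmp = []) :
    ∃ n ≤ (2 * N + 7) * (s k).length + 2, Run (Cmd.copy N k k' tmp) s
      (Function.update s k' (s k ++ s k')) n := by
  obtain ⟨m, hm, h⟩ := moveRev (N := N) h₂ _ s rfl hl
  obtain ⟨n, hn, h'⟩ := moveRev₂ (N := N) h₂.symm h₃.symm h₁ _
    (Function.update (Function.update s k []) tmp ((s k).reverse ++ s tmp)) rfl (by simpa [ht])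
  refine ⟨m + n, ?_, .seq h (by
    convert h' using 1
    funext j
    by_cases hj : j = k'
    · subst hj; simp [h₁.symm, h₃, ht]
    · by_cases hj' : j = k
      · subst hj'; simp [h₁, h₂, ht]
      · by_cases hj'' : j = tmp
        · subst hj''; simp [h₂.symm, h₃.symm, ht]
        · simp [hj, hj', hj''])⟩
  simp [ht] at hn
  have : (2 * N + 7) * (s k).length = (N + 3) * (s k).length + (N + 4) * (s k).length := by ring
  omega

end Run


/-! ### Compiling stack programs to Turing machines -/

open Turing in
/-- The configuration `a` leads to `b` in exactly `n` steps. -/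
def StepsTo {C : Type} (f : C → Option C) (n : ℕ) (a b : C) : Prop :=
  (flip bind f)^[n] (some a) = some b

namespace StepsTo

variable {C : Type} {f : C → Option C}

theorem one {a b : C} (h : f a = some b) : StepsTo f 1 a b := h

theorem trans {m n : ℕ} {a b c : C} (h : StepsTo f m a b) (h' : StepsTo f n b c) :
    StepsTo f (m + n) a c := by
  unfold StepsTo at *
  rw [Nat.add_comm, Function.iterate_add_apply, h, h']

end StepsTo

namespace Cmd

variable {K : Type}

/-- The labels of the compiled program. -/
def Lab : Cmd K → Type
  | skip => Unit
  | push _ _ => Unit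
  | pop _ => Unit
  | seq c d => c.Lab ⊕ d.Lab
  | ite _ _ c d => Option (c.Lab ⊕ d.Lab)
  | loop _ c => Option c.Lab

instance Lab.finite : (c : Cmd K) → Finite c.Lab
  | skip => inferInstanceAs (Finite Unit)
  | push _ _ => inferInstanceAs (Finite Unit)
  | pop _ => inferInstanceAs (Finite Unit)
  | seq c d =>
    have := finite c
    have := finite d
    inferInstanceAs (Finite (c.Lab ⊕ d.Lab))
  | ite _ _ c d =>
    have := finite c
    have := finite d
    inferInstanceAs (Finite (Option (c.Lab ⊕ d.Lab)))
  | loop _ c =>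
    have := finite c
    inferInstanceAs (Finite (Option c.Lab))

/-- The label at which the compiled program starts. -/
def entry : (c : Cmd K) → c.Lab
  | skip => ()
  | push _ _ => ()
  | pop _ => ()
  | seq c _ => Sum.inl c.entry
  | ite _ _ _ _ => none
  | loop _ _ => none

open Turing.TM2.Stmt in
/-- The statements of the compiled program. The letters of stack `k` are coded by `code k` and
decoded by `dec k`, the labels are embedded by `e`, and at the end the program jumps to `exit`. -/
def stm {Γ : K → Type} {Λ : Type} (code : ∀ k, Γ k → ℕ) (dec : ∀ k, ℕ → Γ k) :
    (c : Cmd K) → (c.Lab → Λ) → Λ → c.Lab → Turing.TM2.Stmt Γ Λ Bool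
  | skip, _, exit, _ => goto fun _ => exit
  | push k a, _, exit, _ => Turing.TM2.Stmt.push k (fun _ => dec k a) (goto fun _ => exit)
  | pop k, _, exit, _ => Turing.TM2.Stmt.pop k (fun v _ => v) (goto fun _ => exit)
  | seq c d, e, _, Sum.inl l => c.stm code dec (fun l => e (Sum.inl l)) (e (Sum.inr d.entry)) l
  | seq _ d, e, exit, Sum.inr l => d.stm code dec (fun l => e (Sum.inr l)) exit l
  | ite k o c d, e, _, none => peek k (fun _ x => decide (x.map (code k) = o))
      (goto fun v => if v then e (some (Sum.inl c.entry)) else e (some (Sum.inr d.entry)))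
  | ite _ _ c _, e, exit, some (Sum.inl l) =>
      c.stm code dec (fun l => e (some (Sum.inl l))) exit l
  | ite _ _ _ d, e, exit, some (Sum.inr l) =>
      d.stm code dec (fun l => e (some (Sum.inr l))) exit l
  | loop k c, e, exit, none => peek k (fun _ x => x.isSome)
      (goto fun v => if v then e (some c.entry) else exit)
  | loop _ c, e, _, some l => c.stm code dec (fun l => e (some l)) (e none) l

variable [DecidableEq K]

-- Every instruction and every test is compiled to one statement block, so the step counts agree
-- exactly. The internal state only holds the outcome of the latest test and is therefore left
-- unspecified. `PushesIn` guarantees that pushed letters survive decoding and coding.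
open Turing.TM2 in
theorem stm_stepsTo {Γ : K → Type} {Λ : Type} {code : ∀ k, Γ k → ℕ} {dec : ∀ k, ℕ → Γ k}
    {m : Λ → Stmt Γ Λ Bool} {c : Cmd K} {s t : Store K} {n : ℕ} (h : Run c s t n) :
    ∀ (e : c.Lab → Λ) (exit : Λ), (∀ l, m (e l) = c.stm code dec e exit l) →
      c.PushesIn (fun k a => code k (dec k a) = a) → ∀ (v : Bool) (S : ∀ k, List (Γ k)),
      (∀ k, s k = (S k).map (code k)) → ∃ (v' : Bool) (S' : ∀ k, List (Γ k)),
      (∀ k, t k = (S' k).map (code k)) ∧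
      StepsTo (step m) n ⟨some (e c.entry), v, S⟩ ⟨some exit, v', S'⟩ := by
  induction h with
  | skip s =>
    intro e exit hm _ v S hS
    exact ⟨v, S, hS, .one (by simp [step, hm, stm])⟩
  | push k a s =>
    intro e exit hm hp v S hS
    refine ⟨v, Function.update S k (dec k a :: S k), fun j => ?_, .one (by simp [step, hm, stm])⟩
    by_cases hj : j = k
    · subst hj
      simp only [PushesIn] at hp
      simp [hS, hp]
    · simp [hj, hS]
  | pop k s =>
    intro e exit hm hp v S hS
    refine ⟨v, Function.update S k (S k).tail, fun j => ?_, .one (by simp [step, hm, stm])⟩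
    by_cases hj : j = k
    · subst hj
      simp [hS]
    · simp [hj, hS]
  | @seq c d s t u m' n _ _ ih₁ ih₂ =>
    intro e exit hm hp v S hS
    obtain ⟨v₁, S₁, hS₁, h₁⟩ := ih₁ (fun l => e (Sum.inl l)) (e (Sum.inr d.entry))
      (fun l => hm (Sum.inl l)) hp.1 v S hS
    obtain ⟨v₂, S₂, hS₂, h₂⟩ := ih₂ (fun l => e (Sum.inr l)) exit
      (fun l => hm (Sum.inr l)) hp.2 v₁ S₁ hS₁
    exact ⟨v₂, S₂, hS₂, h₁.trans h₂⟩
  | @ite_true k o c d s t n h₀ _ ih =>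
    intro e exit hm hp v S hS
    obtain ⟨v₁, S₁, hS₁, h₁⟩ := ih (fun l => e (some (Sum.inl l))) exit
      (fun l => hm (some (Sum.inl l))) hp.1 true S hS
    refine ⟨v₁, S₁, hS₁, ?_⟩
    rw [Nat.add_comm]
    refine StepsTo.trans (.one ?_) h₁
    have hm₀ : m (e none) = .peek k (fun _ x => decide (x.map (code k) = o))
      (.goto fun v => if v then e (some (Sum.inl c.entry)) else e (some (Sum.inr d.entry))) :=
      hm none
    have : Option.map (code k) (S k).head? = o := by rw [← h₀, hS]; simp
    simp [step, hm₀, entry, this]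
  | @ite_false k o c d s t n h₀ _ ih =>
    intro e exit hm hp v S hS
    obtain ⟨v₁, S₁, hS₁, h₁⟩ := ih (fun l => e (some (Sum.inr l))) exit
      (fun l => hm (some (Sum.inr l))) hp.2 false S hS
    refine ⟨v₁, S₁, hS₁, ?_⟩
    rw [Nat.add_comm]
    refine StepsTo.trans (.one ?_) h₁
    have hm₀ : m (e none) = .peek k (fun _ x => decide (x.map (code k) = o))
      (.goto fun v => if v then e (some (Sum.inl c.entry)) else e (some (Sum.inr d.entry))) :=
      hm none
    have : Option.map (code k) (S k).head? ≠ o := by rw [hS] at h₀; simpa using h₀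
    simp [step, hm₀, entry, this]
  | @loop_nil k c s h₀ =>
    intro e exit hm hp v S hS
    refine ⟨false, S, hS, .one ?_⟩
    have hm₀ : m (e none) = .peek k (fun _ x => x.isSome)
      (.goto fun v => if v then e (some c.entry) else exit) := hm none
    have : S k = [] := by rw [hS] at h₀; simpa using h₀
    simp [step, hm₀, entry, this]
  | @loop_cons k c s t u m' n h₀ _ _ ih₁ ih₂ =>
    intro e exit hm hp v S hS
    obtain ⟨v₁, S₁, hS₁, h₁⟩ := ih₁ (fun l => e (some l)) (e none)
      (fun l => hm (some l)) hp true S hS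
    obtain ⟨v₂, S₂, hS₂, h₂⟩ := ih₂ e exit hm hp v₁ S₁ hS₁
    refine ⟨v₂, S₂, hS₂, ?_⟩
    rw [Nat.add_comm, ← Nat.add_assoc, Nat.add_assoc]
    refine StepsTo.trans (n := m' + n) (.one ?_) (h₁.trans h₂)
    have hm₀ : m (e none) = .peek k (fun _ x => x.isSome)
      (.goto fun v => if v then e (some c.entry) else exit) := hm none
    have h₀' : S k ≠ [] := by rw [hS] at h₀; simpa using h₀
    obtain ⟨a, l, hal⟩ := List.exists_cons_of_ne_nil h₀'
    simp [step, hm₀, entry, hal]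

end Cmd

theorem initList_stk (tm : Turing.FinTM2) (s : List (tm.Γ tm.k₀)) :
    (Turing.initList tm s).stk = Function.update (fun _ => []) tm.k₀ s := by
  funext k
  by_cases h : k = tm.k₀
  · subst h; simp [Turing.initList]
  · simp [Turing.initList, h]

theorem haltList_stk (tm : Turing.FinTM2) (s : List (tm.Γ tm.k₁)) :
    (Turing.haltList tm s).stk = Function.update (fun _ => []) tm.k₁ s := by
  funext k
  by_cases h : k = tm.k₁
  · subst h; simp [Turing.haltList]
  · simp [Turing.haltList, h]

/-- The Turing machine compiled from a program whose input stack is `k₀` and whose output stack is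
`k₁`. -/
@[reducible] noncomputable def Cmd.machine {K : Type} [Fintype K] [DecidableEq K] (k₀ k₁ : K)
    (Γ : K → Type) [Finite (Γ k₀)] (code : ∀ k, Γ k → ℕ) (dec : ∀ k, ℕ → Γ k) (c : Cmd K) :
    Turing.FinTM2 where
  K := K
  k₀ := k₀
  k₁ := k₁
  Γ := Γ
  Λ := Option c.Lab
  main := some c.entry
  ΛFin := Fintype.ofFinite _
  σ := Bool
  initialState := false
  Γk₀Fin := Fintype.ofFinite _
  m
    | none => .load (fun _ => false) .halt
    | some l => c.stm code dec some none l

/-- The additional step is the block at label `none`: a halting configuration must carry the initial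
internal state, so it is reset before halting. -/
theorem Cmd.machine_outputs {K : Type} [Fintype K] [DecidableEq K] {k₀ k₁ : K}
    {Γ : K → Type} [Finite (Γ k₀)] {code : ∀ k, Γ k → ℕ} {dec : ∀ k, ℕ → Γ k} {c : Cmd K}
    (hcode : ∀ k, Function.Injective (code k))
    (hc : c.PushesIn (fun k a => code k (dec k a) = a)) {x : List (Γ k₀)} {y : List (Γ k₁)}
    {n p : ℕ} (hn : n + 1 ≤ p) (h : Run c (Function.update (fun _ => []) k₀ (x.map (code k₀)))
      (Function.update (fun _ => []) k₁ (y.map (code k₁))) n) :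
    Nonempty (Turing.TM2OutputsInTime (c.machine k₀ k₁ Γ code dec) x (some y) p) := by
  obtain ⟨v, S, hS, h'⟩ := Cmd.stm_stepsTo (m := (c.machine k₀ k₁ Γ code dec).m) h some none
    (fun l => rfl) hc false (Turing.initList (c.machine k₀ k₁ Γ code dec) x).stk (by
      intro k
      rw [initList_stk]
      by_cases hk : k₀ = k
      · subst hk; simp
      · rw [Function.update_of_ne (Ne.symm hk), Function.update_of_ne (Ne.symm hk)]
        rfl)
  refine ⟨⟨⟨n + 1, ?_⟩, hn⟩⟩
  refine StepsTo.trans h' (.one ?_)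
  have hS' : S = Function.update (fun _ => []) k₁ y := by
    funext k
    have := hS k
    by_cases hk : k₁ = k
    · subst hk
      simp only [Function.update_self] at this ⊢
      exact ((hcode k₁).list_map this).symm
    · simp only [Function.update_of_ne (Ne.symm hk)] at this ⊢
      simpa using this.symm
  simp only [Turing.FinTM2.step, Turing.TM2.step, Cmd.machine, Turing.TM2.stepAux]
  congr 1
  rw [hS', ← haltList_stk (c.machine k₀ k₁ Γ code dec) y]
  rfl


/-! ### Polynomial-time functions between represented types -/

theorem Polynomial.eval_mono_nat (p : Polynomial ℕ) {m n : ℕ} (h : m ≤ n) :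
    p.eval m ≤ p.eval n := by
  simp only [Polynomial.eval_eq_sum, Polynomial.sum]
  gcongr

/-- A representation of the elements of `X` as the contents of finitely many stacks. -/
class Rep (X : Type) where
  /-- the stacks -/
  Reg : Type
  [fin : Fintype Reg]
  [dec : DecidableEq Reg]
  /-- the contents of the stacks -/
  rep : X → Store Reg
  /-- all letters are less than this number -/
  bound : ℕ
  lt_bound : ∀ x i, ∀ a ∈ rep x i, a < bound

attribute [instance] Rep.fin Rep.dec

open RationalProofs.Rep (Reg rep bound)

/-- The size of the representation of `x`. -/
def Rep.size {X : Type} [Rep X] (x : X) : ℕ := (rep x).size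

open RationalProofs.Rep (size)

/-- A code for the elements of a finite type. -/
noncomputable def code {α : Type} [Finite α] (a : α) : ℕ := (Finite.equivFin α a).val

theorem code_lt {α : Type} [Finite α] (a : α) : code a < Nat.card α := (Finite.equivFin α a).2

theorem code_injective {α : Type} [Finite α] : Function.Injective (code (α := α)) :=
  Fin.val_injective.comp (Finite.equivFin α).injective

/-- A left inverse of `code` on its range. -/
noncomputable def ofCode {α : Type} [Finite α] (n : ℕ) : Option α :=
  if h : n < Nat.card α then some ((Finite.equivFin α).symm ⟨n, h⟩) else none

@[simp]
theorem ofCode_code {α : Type} [Finite α] (a : α) : ofCode (code a) = some a := by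
  have h : code a < Nat.card α := code_lt a
  simp only [ofCode, h, dif_pos]
  simp [code]

noncomputable instance (priority := low) Rep.ofFinite {F : Type} [Finite F] : Rep F where
  Reg := Unit
  rep a _ := [code a]
  bound := Nat.card F
  lt_bound x _ a ha := by simp only [List.mem_singleton] at ha; rw [ha]; exact code_lt x

noncomputable instance Rep.list {α : Type} [Finite α] : Rep (List α) where
  Reg := Unit
  rep l _ := l.map code
  bound := Nat.card α
  lt_bound x _ a ha := by
    obtain ⟨b, -, rfl⟩ := List.mem_map.1 ha
    exact code_lt b

instance Rep.prod {X Y : Type} [Rep X] [Rep Y] : Rep (X × Y) where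
  Reg := Reg X ⊕ Reg Y
  rep p := Sum.elim (rep p.1) (rep p.2)
  bound := max (bound X) (bound Y)
  lt_bound p i a ha := by
    rcases i with i | i
    · exact lt_max_of_lt_left (Rep.lt_bound _ _ a ha)
    · exact lt_max_of_lt_right (Rep.lt_bound _ _ a ha)

noncomputable instance Rep.pi {K : Type} [Fintype K] [DecidableEq K] {Γ : K → Type}
    [∀ k, Finite (Γ k)] : Rep (∀ k, List (Γ k)) where
  Reg := K
  rep S k := (S k).map code
  bound := ∑ k, Nat.card (Γ k)
  lt_bound S k a ha := by
    obtain ⟨b, -, rfl⟩ := List.mem_map.1 ha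
    exact (code_lt b).trans_le (Finset.single_le_sum (f := fun k => Nat.card (Γ k))
      (fun _ _ => Nat.zero_le _) (Finset.mem_univ k))

theorem Store.size_elim {K K' : Type} [Fintype K] [Fintype K'] (s : Store K) (s' : Store K') :
    Store.size (Sum.elim s s' : Store (K ⊕ K')) = s.size + s'.size := by
  simp [Store.size, Fintype.sum_sum_type]

@[simp]
theorem Store.size_empty {K : Type} [Fintype K] : Store.size (fun _ : K => []) = 0 := by
  simp [Store.size]

theorem Store.length_le_size {K : Type} [Fintype K] (s : Store K) (k : K) :
    (s k).length ≤ s.size :=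
  Finset.single_le_sum (f := fun k => (s k).length) (fun _ _ => Nat.zero_le _) (Finset.mem_univ k)

@[simp]
theorem Rep.size_list {α : Type} [Finite α] (l : List α) : size l = l.length := by
  simp [size, Store.size, rep, Reg]

@[simp]
theorem Rep.size_prod {X Y : Type} [Rep X] [Rep Y] (p : X × Y) : size p = size p.1 + size p.2 :=
  Store.size_elim _ _

theorem Rep.size_ofFinite {F : Type} [Finite F] (a : F) : @size F Rep.ofFinite a = 1 := by
  simp [size, Store.size, rep, Reg]

theorem Rep.size_pi {K : Type} [Fintype K] [DecidableEq K] {Γ : K → Type}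
    [∀ k, Finite (Γ k)] (S : ∀ k, List (Γ k)) : size S = ∑ k, (S k).length := by
  simp [size, Store.size, rep, Reg]

/-- The function `g` is bounded by a polynomial in the size of its argument. -/
def PBdd {X : Type} [Rep X] (g : X → ℕ) : Prop :=
  ∃ p : Polynomial ℕ, ∀ x, g x ≤ p.eval (size x)

namespace PBdd

variable {X Y : Type} [Rep X] [Rep Y] {f g : X → ℕ}

theorem mono (hg : PBdd g) (h : ∀ x, f x ≤ g x) : PBdd f :=
  hg.imp fun _ hp x => (h x).trans (hp x)

theorem size : PBdd (fun x : X => size x) := ⟨Polynomial.X, fun x => by simp⟩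

theorem const (n : ℕ) : PBdd (fun _ : X => n) := ⟨Polynomial.C n, fun x => by simp⟩

theorem add (hf : PBdd f) (hg : PBdd g) : PBdd (fun x => f x + g x) := by
  obtain ⟨p, hp⟩ := hf
  obtain ⟨q, hq⟩ := hg
  exact ⟨p + q, fun x => by simpa using add_le_add (hp x) (hq x)⟩

theorem mul (hf : PBdd f) (hg : PBdd g) : PBdd (fun x => f x * g x) := by
  obtain ⟨p, hp⟩ := hf
  obtain ⟨q, hq⟩ := hg
  exact ⟨p * q, fun x => by simpa using Nat.mul_le_mul (hp x) (hq x)⟩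

theorem eval (p : Polynomial ℕ) (hf : PBdd f) : PBdd (fun x => p.eval (f x)) := by
  obtain ⟨q, hq⟩ := hf
  exact ⟨p.comp q, fun x => by
    rw [Polynomial.eval_comp]; exact Polynomial.eval_mono_nat p (hq x)⟩

theorem comp {g : Y → ℕ} (hg : PBdd g) {f : X → Y} (hf : PBdd fun x => Rep.size (f x)) :
    PBdd (fun x => g (f x)) := by
  obtain ⟨p, hp⟩ := hg
  exact (hf.eval p).mono fun x => hp (f x)

end PBdd

/-- The store with contents `x` of the input stacks, `y` of the output stacks and `l` of the local
stacks. -/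
abbrev Store.mk3 {I J L : Type} (x : Store I) (y : Store J) (l : Store L) : Store (I ⊕ J ⊕ L) :=
  Sum.elim x (Sum.elim y l)

/-- The function `f` is computable in polynomial time, by a program that keeps its input. -/
def PT {X Y : Type} [Rep X] [Rep Y] (f : X → Y) : Prop :=
  ∃ (n : ℕ) (c : Cmd (Reg X ⊕ Reg Y ⊕ Fin n)) (g : X → ℕ), PBdd g ∧ ∀ x, ∃ m ≤ g x,
    Run c (Store.mk3 (rep x) (fun _ => []) (fun _ => []))
      (Store.mk3 (rep x) (rep (f x)) (fun _ => [])) m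

theorem Run.clear_range {K J : Type} [Fintype K] [DecidableEq K] [Fintype J] (e : J → K)
    (s t : Store K) (ht : ∀ j, t (e j) = []) (hne : ∀ k, (∀ j, e j ≠ k) → t k = s k) :
    ∃ n ≤ Fintype.card J * (2 * s.size + 1) + 1,
      Run (Cmd.clear (Finset.univ.toList.map e)) s t n := by
  obtain ⟨n, hn, h⟩ := Run.clear (Finset.univ.toList.map e) s
  refine ⟨n, by simpa using hn, h.of_eq ?_⟩
  funext k
  by_cases hk : ∃ j, e j = k
  · obtain ⟨j, rfl⟩ := hk
    simp [ht]
  · rw [hne k (fun j hj => hk ⟨j, hj⟩)]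
    simp only [List.mem_map, Finset.mem_toList, Finset.mem_univ, true_and, hk, if_false]

/-! ### Closure properties of polynomial-time maps -/

namespace PT

variable {X Y Z : Type} [Rep X] [Rep Y] [Rep Z]

/-- Lets each construction index its work stacks by whatever finite type is convenient; renaming
turns it into the `Fin n` of the definition. -/
theorem intro {f : X → Y} {L : Type} [Fintype L] [DecidableEq L] (c : Cmd (Reg X ⊕ Reg Y ⊕ L))
    {g : X → ℕ} (hg : PBdd g) (h : ∀ x, ∃ m ≤ g x,
      Run c (Store.mk3 (rep x) (fun _ => []) (fun _ => []))
        (Store.mk3 (rep x) (rep (f x)) (fun _ => [])) m) : PT f := by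
  let e : Reg X ⊕ Reg Y ⊕ L ≃ Reg X ⊕ Reg Y ⊕ Fin (Fintype.card L) :=
    Equiv.sumCongr (Equiv.refl _) (Equiv.sumCongr (Equiv.refl _) (Fintype.equivFin L))
  refine ⟨Fintype.card L, c.map e, g, hg, fun x => ?_⟩
  obtain ⟨m, hm, h⟩ := h x
  refine ⟨m, hm, h.map e.injective ?_ ?_ ?_⟩
  · rintro (i | i | i) <;> rfl
  · rintro (i | i | i) <;> rfl
  · intro j hj
    exact absurd (e.apply_symm_apply j) (hj _)

theorem of_eq {f f' : X → Y} (hf : PT f) (h : ∀ x, f x = f' x) : PT f' :=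
  (funext h : f = f') ▸ hf

theorem size {f : X → Y} (hf : PT f) : PBdd (fun x => Rep.size (f x)) := by
  obtain ⟨n, c, g, hg, h⟩ := hf
  refine (PBdd.size.add hg).mono fun x => ?_
  obtain ⟨m, hm, h⟩ := h x
  have := h.size_le
  simp only [Store.size_elim, Store.size_empty] at this
  simp only [Rep.size] at *
  omega

/-- If every stack of the value is a copy of some stack of the argument, copying is all there is to
compute. This covers the identity, projections, updates of a stack, and the passage from a tuple to
its encoding. -/
theorem reindex {f : X → Y} (σ : Reg Y → Reg X) (h : ∀ x j, rep (f x) j = rep x (σ j)) :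
    PT f := by
  let cp : Reg Y → Cmd (Reg X ⊕ Reg Y ⊕ Unit) := fun j =>
    .copy (bound X) (Sum.inl (σ j)) (Sum.inr (Sum.inl j)) (Sum.inr (Sum.inr ()))
  have key : ∀ (x : X) (l : List (Reg Y)), l.Nodup → ∀ y : Store (Reg Y), (∀ j ∈ l, y j = []) →
      ∃ n ≤ l.length * ((2 * bound X + 7) * Rep.size x + 2) + 1, Run (Cmd.seqs (l.map cp))
        (Store.mk3 (rep x) y fun _ => [])
        (Store.mk3 (rep x) (fun j => if j ∈ l then rep x (σ j) else y j) fun _ => []) n := by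
    intro x l
    induction l with
    | nil => exact fun _ y _ => ⟨1, by simp, by simpa [Cmd.seqs] using Run.skip _⟩
    | cons j l ih =>
      intro hl y hy
      rw [List.nodup_cons] at hl
      obtain ⟨m, hm, h₁⟩ := Run.copy (N := bound X) (k := Sum.inl (σ j)) (k' := Sum.inr (Sum.inl j))
        (tmp := (Sum.inr (Sum.inr ()) : Reg X ⊕ Reg Y ⊕ Unit))
        (s := Store.mk3 (rep x) y fun _ => []) (by simp) (by simp) (by simp)
        (Rep.lt_bound x _) rfl
      obtain ⟨n, hn, h₂⟩ := ih hl.2 (Function.update y j (rep x (σ j))) (by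
        intro i hi
        rw [Function.update_of_ne (by rintro rfl; exact hl.1 hi)]
        exact hy i (by simp [hi]))
      refine ⟨m + n, ?_, .seq (h₁.of_eq ?_) (h₂.of_eq ?_)⟩
      · have : (rep x (σ j)).length ≤ Rep.size x := Store.length_le_size _ _
        have h3 : (2 * bound X + 7) * (rep x (σ j)).length ≤ (2 * bound X + 7) * Rep.size x := by
          gcongr
        simp only [Sum.elim_inl] at hm
        obtain ⟨T, hT⟩ : ∃ T, T = (2 * bound X + 7) * Rep.size x := ⟨_, rfl⟩
        rw [← hT] at hn h3 ⊢
        simp only [List.length_cons, Nat.succ_mul]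
        omega
      · funext i
        rcases i with i | i | i
        · simp
        · by_cases hi : i = j
          · subst hi; simp [hy]
          · simp [hi]
        · simp
      · funext i
        rcases i with i | i | i
        · simp
        · by_cases hi : i = j
          · subst hi; simp
          · simp [hi]
        · simp
  refine intro (L := Unit) (Cmd.seqs (Finset.univ.toList.map cp))
    (g := fun x => Fintype.card (Reg Y) * ((2 * bound X + 7) * Rep.size x + 2) + 1)
    (((PBdd.const _).mul (((PBdd.const _).mul PBdd.size).add (.const _))).add (.const _))
    fun x => ?_
  obtain ⟨n, hn, h'⟩ := key x _ (Finset.nodup_toList Finset.univ) (fun _ => []) (by simp)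
  refine ⟨n, by simpa using hn, h'.of_eq ?_⟩
  simp [← h]

protected theorem id : PT (fun x : X => x) := reindex id fun _ _ => rfl

theorem fst : PT (fun p : X × Y => p.1) := reindex Sum.inl fun _ _ => rfl

theorem snd : PT (fun p : X × Y => p.2) := reindex Sum.inr fun _ _ => rfl

/-- The intermediate value lives on work stacks. It has to be erased at the end, because work stacks
must be returned empty; its size is polynomial by `PT.size`, so erasing is affordable. -/
theorem comp {g : Y → Z} {f : X → Y} (hg : PT g) (hf : PT f) : PT (fun x => g (f x)) := by
  have hsf := hf.size
  have hsg := hg.size.comp hsf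
  obtain ⟨nf, cf, tf, htf, hf⟩ := hf
  obtain ⟨ng, cg, tg, htg, hg⟩ := hg
  let ef : Reg X ⊕ Reg Y ⊕ Fin nf → (Reg X ⊕ Reg Z ⊕ (Reg Y ⊕ Fin nf ⊕ Fin ng)) := Sum.elim Sum.inl
    (Sum.elim (fun i => .inr (.inr (.inl i))) (fun i => .inr (.inr (.inr (.inl i)))))
  let eg : Reg Y ⊕ Reg Z ⊕ Fin ng → (Reg X ⊕ Reg Z ⊕ (Reg Y ⊕ Fin nf ⊕ Fin ng)) := Sum.elim (fun i => .inr (.inr (.inl i)))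
    (Sum.elim (fun i => .inr (.inl i)) (fun i => .inr (.inr (.inr (.inr i)))))
  let ey : Reg Y → (Reg X ⊕ Reg Z ⊕ (Reg Y ⊕ Fin nf ⊕ Fin ng)) := fun i => .inr (.inr (.inl i))
  refine intro (L := Reg Y ⊕ Fin nf ⊕ Fin ng)
    (.seq (cf.map ef) (.seq (cg.map eg) (.clear (Finset.univ.toList.map ey))))
    (htf.add ((htg.comp hsf).add (((PBdd.const (Fintype.card (Reg Y))).mul
      (((PBdd.const 2).mul ((PBdd.size.add hsf).add hsg)).add (.const 1))).add (.const 1))))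
    fun x => ?_
  obtain ⟨m₁, hm₁, h₁⟩ := hf x
  obtain ⟨m₂, hm₂, h₂⟩ := hg (f x)
  obtain ⟨m₃, hm₃, h₃⟩ := Run.clear_range ey
    (Sum.elim (rep x) (Sum.elim (rep (g (f x))) (Sum.elim (rep (f x)) fun _ => [])))
    (Sum.elim (rep x) (Sum.elim (rep (g (f x))) fun _ => []))
    (fun _ => rfl) (by
      rintro (i | i | i | i) hi
      · rfl
      · rfl
      · exact absurd rfl (hi i)
      · rfl)
  refine ⟨m₁ + (m₂ + m₃), ?_, .seq (h₁.map (e := ef) ?_ (t := Sum.elim (rep x)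
    (Sum.elim (fun _ => []) (Sum.elim (rep (f x)) fun _ => []))) ?_ ?_ ?_)
      (.seq (h₂.map (e := eg) ?_ ?_ ?_ ?_) h₃)⟩
  · simp only [Store.size_elim, Store.size_empty] at hm₃
    change m₃ ≤ _ * (2 * (Rep.size x + (Rep.size (g (f x)) + (Rep.size (f x) + 0))) + 1) + 1 at hm₃
    have : Rep.size x + (Rep.size (g (f x)) + (Rep.size (f x) + 0)) =
      Rep.size x + Rep.size (f x) + Rep.size (g (f x)) := by ring
    rw [this] at hm₃
    omega
  · rintro (i | i | i) (j | j | j) h <;> cases h <;> rfl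
  · rintro (i | i | i) <;> rfl
  · rintro (i | i | i) <;> rfl
  · rintro (i | i | i | i | i) hi
    · rfl
    · rfl
    · exact absurd rfl (hi (.inr (.inl i)))
    · rfl
    · rfl
  · rintro (i | i | i) (j | j | j) h <;> cases h <;> rfl
  · rintro (i | i | i) <;> rfl
  · rintro (i | i | i) <;> rfl
  · rintro (i | i | i | i | i) hi
    · rfl
    · exact absurd rfl (hi (.inr (.inl i)))
    · rfl
    · rfl
    · rfl

/-- Programs keep their input, so the second one can simply run after the first. -/
theorem pair {f : X → Y} {g : X → Z} (hf : PT f) (hg : PT g) : PT (fun x => (f x, g x)) := by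
  obtain ⟨nf, cf, tf, htf, hf⟩ := hf
  obtain ⟨ng, cg, tg, htg, hg⟩ := hg
  let ef : Reg X ⊕ Reg Y ⊕ Fin nf → (Reg X ⊕ (Reg Y ⊕ Reg Z) ⊕ (Fin nf ⊕ Fin ng)) := Sum.elim Sum.inl
    (Sum.elim (fun i => .inr (.inl (.inl i))) (fun i => .inr (.inr (.inl i))))
  let eg : Reg X ⊕ Reg Z ⊕ Fin ng → (Reg X ⊕ (Reg Y ⊕ Reg Z) ⊕ (Fin nf ⊕ Fin ng)) := Sum.elim Sum.inl
    (Sum.elim (fun i => .inr (.inl (.inr i))) (fun i => .inr (.inr (.inr i))))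
  refine intro (L := Fin nf ⊕ Fin ng) (.seq (cf.map ef) (cg.map eg)) (htf.add htg) fun x => ?_
  obtain ⟨m₁, hm₁, h₁⟩ := hf x
  obtain ⟨m₂, hm₂, h₂⟩ := hg x
  refine ⟨m₁ + m₂, by omega, .seq (h₁.map (e := ef) ?_ (t := Sum.elim (rep x)
    (Sum.elim (Sum.elim (rep (f x)) (fun _ => [])) fun _ => [])) ?_ ?_ ?_)
      (h₂.map (e := eg) ?_ ?_ ?_ ?_)⟩
  · rintro (i | i | i) (j | j | j) h <;> cases h <;> rfl
  · rintro (i | i | i) <;> rfl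
  · rintro (i | i | i) <;> rfl
  · rintro (i | (i | i) | i | i) hi
    · rfl
    · exact absurd rfl (hi (.inr (.inl i)))
    · rfl
    · rfl
    · rfl
  · rintro (i | i | i) (j | j | j) h <;> cases h <;> rfl
  · rintro (i | i | i) <;> rfl
  · rintro (i | i | i) <;> rfl
  · rintro (i | (i | i) | i | i) hi
    · rfl
    · rfl
    · exact absurd rfl (hi (.inr (.inl i)))
    · rfl
    · rfl

/-- Post-processing the output stacks by a program. -/
theorem after {f : X → Y} {g : X → Y} (hf : PT f) (c : Cmd (Reg Y)) {t : X → ℕ} (ht : PBdd t)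
    (h : ∀ x, ∃ m ≤ t x, Run c (rep (f x)) (rep (g x)) m) : PT g := by
  obtain ⟨nf, cf, tf, htf, hf⟩ := hf
  refine intro (L := Fin nf) (.seq cf (c.map fun i => .inr (.inl i))) (htf.add ht) fun x => ?_
  obtain ⟨m₁, hm₁, h₁⟩ := hf x
  obtain ⟨m₂, hm₂, h₂⟩ := h x
  refine ⟨m₁ + m₂, by omega, .seq h₁ (h₂.map ?_ ?_ ?_ ?_)⟩
  · intro i j h; simpa using h
  · intro i; rfl
  · intro i; rfl
  · rintro (i | i | i) hi
    · rfl
    · exact absurd rfl (hi i)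
    · rfl

theorem const_fin {F : Type} [Finite F] (a : F) : PT (fun _ : X => a) := by
  refine intro (L := Unit) (.push (Sum.inr (Sum.inl ())) (code a)) (.const 1) fun x =>
    ⟨1, le_rfl, (Run.push _ _ _).of_eq ?_⟩
  funext i
  rcases i with i | i | i
  · simp
  · exact Function.update_self _ _ _
  · simp

theorem nil {α : Type} [Finite α] : PT (fun _ : X => ([] : List α)) := by
  refine intro (L := Unit) .skip (.const 1) fun x => ⟨1, le_rfl, (Run.skip _).of_eq ?_⟩
  funext i
  rcases i with i | i | i <;> simp [rep]

theorem cons_const {α : Type} [Finite α] (a : α) {f : X → List α} (hf : PT f) :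
    PT (fun x => a :: f x) :=
  hf.after (.push () (code a)) (.const 1) fun x => ⟨1, le_rfl, (Run.push _ _ _).of_eq (by
    funext i; exact Function.update_self () _ _)⟩

theorem const_list {α : Type} [Finite α] : ∀ l : List α, PT (fun _ : X => l)
  | [] => nil
  | a :: l => (const_list l).cons_const a

theorem tail {α : Type} [Finite α] {f : X → List α} (hf : PT f) : PT (fun x => (f x).tail) :=
  hf.after (.pop ()) (.const 1) fun x => ⟨1, le_rfl, (Run.pop _ _).of_eq (by
    funext i; exact (Function.update_self () _ _).trans (by simp [rep]))⟩

theorem head?_aux {α : Type} [Finite α] : PT (fun l : List α => l.head?) := by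
  refine intro (L := Unit) (.ite (.inl ()) none
    (.push (.inr (.inl ())) (code (none : Option α)))
    (.dispatch (.inl ()) (fun n => .push (.inr (.inl ())) (code (ofCode n : Option α)))
      (Nat.card α))) (.const (2 + Nat.card α)) fun l => ?_
  rcases l with - | ⟨a, l⟩
  · exact ⟨2, by omega, .ite_true rfl ((Run.push _ _ _).of_eq (by
      funext i
      rcases i with i | i | i
      · simp
      · exact Function.update_self _ _ _
      · simp))⟩
  · obtain ⟨m, hm, h⟩ := Run.dispatch (K := Reg (List α) ⊕ Reg (Option α) ⊕ Unit)
      (k := .inl ()) (a := code a) (N := Nat.card α)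
      (f := fun n => .push (.inr (.inl ())) (code (ofCode n : Option α)))
      (s := Store.mk3 (rep (a :: l)) (fun _ => []) (fun _ => [])) (by simp [rep])
      (.push _ _ _) (code_lt a)
    exact ⟨m + 1, by omega, .ite_false (by simp [rep]) (h.of_eq (by
      funext i
      rw [ofCode_code]
      rcases i with i | i | i
      · simp
      · exact Function.update_self _ _ _
      · simp))⟩

theorem head? {α : Type} [Finite α] {f : X → List α} (hf : PT f) : PT (fun x => (f x).head?) :=
  head?_aux.comp hf

/-- A choice from a finite type is built into the control: the selector is computed on a work stack
and dispatched on. Summing the time bounds of the finitely many branches gives a bound that does not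
depend on the choice. -/
theorem cases {F : Type} [Finite F] {sel : X → F} {g : F → X → Y} (hs : PT sel)
    (hg : ∀ a, PT (g a)) : PT (fun x => g (sel x) x) := by
  obtain ⟨ns, cs, ts, hts, hs⟩ := hs
  choose n c t ht hg using hg
  have : Fintype F := Fintype.ofFinite F
  have : DecidableEq F := Classical.decEq F
  let es : Reg X ⊕ Reg F ⊕ Fin ns → (Reg X ⊕ Reg Y ⊕ (Unit ⊕ Fin ns ⊕ Σ a, Fin (n a))) := Sum.elim Sum.inl
    (Sum.elim (fun i => .inr (.inr (.inl i))) (fun i => .inr (.inr (.inr (.inl i)))))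
  let eg : ∀ a, Reg X ⊕ Reg Y ⊕ Fin (n a) → (Reg X ⊕ Reg Y ⊕ (Unit ⊕ Fin ns ⊕ Σ a, Fin (n a))) := fun a => Sum.elim Sum.inl
    (Sum.elim (fun i => .inr (.inl i)) (fun i => .inr (.inr (.inr (.inr ⟨a, i⟩)))))
  let k : (Reg X ⊕ Reg Y ⊕ (Unit ⊕ Fin ns ⊕ Σ a, Fin (n a))) := .inr (.inr (.inl ()))
  have hsum : PBdd (fun x => ∑ a, t a x) := by
    have : ∀ s : Finset F, PBdd (fun x => ∑ a ∈ s, t a x) := by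
      intro s
      induction s using Finset.induction_on with
      | empty => simpa using PBdd.const 0
      | insert a s ha ih => simp only [Finset.sum_insert ha]; exact (ht a).add ih
    exact this _
  refine intro (L := Unit ⊕ Fin ns ⊕ Σ a, Fin (n a))
    (.seq (cs.map es) (.seq (.dispatch k (fun i => match (ofCode i : Option F) with
      | none => .skip
      | some a => (c a).map (eg a)) (Nat.card F)) (.pop k)))
    (hts.add ((hsum.add (.const (Nat.card F))).add (.const 1))) fun x => ?_
  obtain ⟨m₁, hm₁, h₁⟩ := hs x
  obtain ⟨m₂, hm₂, h₂⟩ := hg (sel x) x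
  have h₁' : Run (cs.map es) (Store.mk3 (rep x) (fun _ => []) (fun _ => []))
      (Sum.elim (rep x) (Sum.elim (fun _ => []) (Sum.elim (rep (sel x)) fun _ => []))) m₁ := by
    refine h₁.map ?_ ?_ ?_ ?_
    · rintro (i | i | i) (j | j | j) h <;> cases h <;> rfl
    · rintro (i | i | i) <;> rfl
    · rintro (i | i | i) <;> rfl
    · rintro (i | i | i | i | i) hi
      · rfl
      · rfl
      · exact absurd rfl (hi (.inr (.inl i)))
      · rfl
      · rfl
  have h₂' : Run ((c (sel x)).map (eg (sel x)))
      (Sum.elim (rep x) (Sum.elim (fun _ => []) (Sum.elim (rep (sel x)) fun _ => [])))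
      (Sum.elim (rep x) (Sum.elim (rep (g (sel x) x)) (Sum.elim (rep (sel x)) fun _ => [])))
      m₂ := by
    refine h₂.map ?_ ?_ ?_ ?_
    · rintro (i | i | i) (j | j | j) h <;> cases h <;> rfl
    · rintro (i | i | i) <;> rfl
    · rintro (i | i | i) <;> rfl
    · rintro (i | i | i | i | i) hi
      · rfl
      · exact absurd rfl (hi (.inr (.inl i)))
      · rfl
      · rfl
      · rfl
  obtain ⟨m, hm, h₃⟩ := Run.dispatch (k := k) (a := code (sel x)) (N := Nat.card F)
    (f := fun i => match (ofCode i : Option F) with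
      | none => .skip
      | some a => (c a).map (eg a))
    (s := Sum.elim (rep x) (Sum.elim (fun _ => []) (Sum.elim (rep (sel x)) fun _ => [])))
    (by simp [rep, k]) (by rw [ofCode_code]; exact h₂')
      (code_lt _)
  refine ⟨m₁ + (m + 1), ?_, .seq h₁' (.seq h₃ ((Run.pop _ _).of_eq ?_))⟩
  · have : t (sel x) x ≤ ∑ a, t a x :=
      Finset.single_le_sum (f := fun a => t a x) (fun _ _ => Nat.zero_le _) (Finset.mem_univ _)
    omega
  · funext i
    rcases i with i | i | i | i | i <;> simp [rep, k]

theorem ite {b : X → Bool} {f g : X → Y} (hb : PT b) (hf : PT f) (hg : PT g) :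
    PT (fun x => if b x then f x else g x) :=
  (cases (g := fun b x => if b then f x else g x) hb (by rintro (_ | _) <;> simpa))

-- The word `l x` is the loop counter. The current value sits on the output stacks; each pass
-- computes the next one on a second set of stacks, erases the first set, copies back and erases the
-- second. The bound on all intermediate sizes is essential, since polynomially many polynomial-time
-- steps could otherwise produce exponential growth.
set_option synthInstance.maxSize 1000 in
set_option synthInstance.maxHeartbeats 200000 in
theorem iterate {α : Type} [Finite α] {l : X → List α} {y : X → Y} {step : Y → Y} (hl : PT l)
    (hy : PT y) (hstep : PT step) {b : X → ℕ} (hb : PBdd b)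
    (hsize : ∀ x, ∀ i ≤ (l x).length, Rep.size (step^[i] (y x)) ≤ b x) :
    PT (fun x => step^[(l x).length] (y x)) := by
  have hsl := hl.size
  simp only [Rep.size_list] at hsl
  obtain ⟨nl, cl, tl, htl, hl⟩ := hl
  obtain ⟨ny, cy, ty, hty, hy⟩ := hy
  obtain ⟨ns, cs, ts, ⟨ps, hps⟩, hstep⟩ := hstep
  obtain ⟨ni, ci, ti, ⟨pi, hpi⟩, hid⟩ := PT.id (X := Y)
  let el : Reg X ⊕ Reg (List α) ⊕ Fin nl → (Reg X ⊕ Reg Y ⊕ (Unit ⊕ Reg Y ⊕ (Fin nl ⊕ Fin ny ⊕ Fin ns ⊕ Fin ni))) := Sum.elim Sum.inl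
    (Sum.elim (fun i => .inr (.inr (.inl i))) (fun i => .inr (.inr (.inr (.inr (.inl i))))))
  let ey : Reg X ⊕ Reg Y ⊕ Fin ny → (Reg X ⊕ Reg Y ⊕ (Unit ⊕ Reg Y ⊕ (Fin nl ⊕ Fin ny ⊕ Fin ns ⊕ Fin ni))) := Sum.elim Sum.inl
    (Sum.elim (fun i => .inr (.inl i)) (fun i => .inr (.inr (.inr (.inr (.inr (.inl i)))))))
  let es : Reg Y ⊕ Reg Y ⊕ Fin ns → (Reg X ⊕ Reg Y ⊕ (Unit ⊕ Reg Y ⊕ (Fin nl ⊕ Fin ny ⊕ Fin ns ⊕ Fin ni))) := Sum.elim (fun i => .inr (.inl i))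
    (Sum.elim (fun i => .inr (.inr (.inr (.inl i))))
      (fun i => .inr (.inr (.inr (.inr (.inr (.inr (.inl i))))))))
  let ei : Reg Y ⊕ Reg Y ⊕ Fin ni → (Reg X ⊕ Reg Y ⊕ (Unit ⊕ Reg Y ⊕ (Fin nl ⊕ Fin ny ⊕ Fin ns ⊕ Fin ni))) := Sum.elim (fun i => .inr (.inr (.inr (.inl i))))
    (Sum.elim (fun i => .inr (.inl i)) (fun i => .inr (.inr (.inr (.inr (.inr (.inr (.inr i))))))))
  let e₁ : Reg Y → (Reg X ⊕ Reg Y ⊕ (Unit ⊕ Reg Y ⊕ (Fin nl ⊕ Fin ny ⊕ Fin ns ⊕ Fin ni))) := fun i => .inr (.inl i)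
  let e₂ : Reg Y → (Reg X ⊕ Reg Y ⊕ (Unit ⊕ Reg Y ⊕ (Fin nl ⊕ Fin ny ⊕ Fin ns ⊕ Fin ni))) := fun i => .inr (.inr (.inr (.inl i)))
  let k : (Reg X ⊕ Reg Y ⊕ (Unit ⊕ Reg Y ⊕ (Fin nl ⊕ Fin ny ⊕ Fin ns ⊕ Fin ni))) := .inr (.inr (.inl ()))
  let st : Store (Reg X) → Store (Reg Y) → List ℕ → Store (Reg Y) → Store (Reg X ⊕ Reg Y ⊕ (Unit ⊕ Reg Y ⊕ (Fin nl ⊕ Fin ny ⊕ Fin ns ⊕ Fin ni))) := fun x y l z =>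
    Sum.elim x (Sum.elim y (Sum.elim (fun _ => l) (Sum.elim z fun _ => [])))
  let body : Cmd (Reg X ⊕ Reg Y ⊕ (Unit ⊕ Reg Y ⊕ (Fin nl ⊕ Fin ny ⊕ Fin ns ⊕ Fin ni))) := .seq (.pop k) (.seq (cs.map es) (.seq (.clear (Finset.univ.toList.map e₁))
    (.seq (ci.map ei) (.clear (Finset.univ.toList.map e₂)))))
  let cost : ℕ → ℕ → ℕ → ℕ := fun sx sl B => 1 + (ps.eval B + ((Fintype.card (Reg Y) *
    (2 * (sx + 2 * B + sl) + 1) + 1) + (pi.eval B + (Fintype.card (Reg Y) *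
    (2 * (sx + 2 * B + sl) + 1) + 1))))
  have hsize_st : ∀ x y l z, Store.size (st x y l z) = x.size + y.size + l.length + z.size := by
    intro x y l z
    simp only [st, Store.size_elim, Store.size_empty]
    simp [Store.size]
    ring
  have hbody : ∀ (x : X) (y : Y) (a : ℕ) (l : List ℕ) (B : ℕ), Rep.size y ≤ B →
      Rep.size (step y) ≤ B → ∃ m ≤ cost (Rep.size x) l.length B,
      Run body (st (rep x) (rep y) (a :: l) fun _ => []) (st (rep x) (rep (step y)) l fun _ => [])
        m := by
    intro x y a l B hB₁ hB₂
    obtain ⟨m₁, hm₁, h₁⟩ := hstep y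
    obtain ⟨m₃, hm₃, h₃⟩ := hid (step y)
    obtain ⟨m₂, hm₂, h₂⟩ := Run.clear_range e₁ (st (rep x) (rep y) l (rep (step y)))
      (st (rep x) (fun _ => []) l (rep (step y))) (fun _ => rfl) (by
        rintro (i | i | i | i | i) hi
        · rfl
        · exact absurd rfl (hi i)
        · rfl
        · rfl
        · rfl)
    obtain ⟨m₄, hm₄, h₄⟩ := Run.clear_range e₂ (st (rep x) (rep (step y)) l (rep (step y)))
      (st (rep x) (rep (step y)) l (fun _ => [])) (fun _ => rfl) (by
        rintro (i | i | i | i | i) hi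
        · rfl
        · rfl
        · rfl
        · exact absurd rfl (hi i)
        · rfl)
    rw [hsize_st] at hm₂ hm₄
    refine ⟨1 + (m₁ + (m₂ + (m₃ + m₄))), ?_, .seq ((Run.pop _ _).of_eq (t' := st (rep x) (rep y) l
      fun _ => []) ?_) (.seq (t := st (rep x) (rep y) l (rep (step y))) (h₁.map ?_ ?_ ?_ ?_)
        (.seq h₂ (.seq (h₃.map ?_ ?_ ?_ ?_) h₄)))⟩
    · have e1 : ps.eval (Rep.size y) ≤ ps.eval B := Polynomial.eval_mono_nat _ hB₁
      have e2 : pi.eval (Rep.size (step y)) ≤ pi.eval B := Polynomial.eval_mono_nat _ hB₂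
      have e3 := hps y
      have e4 := hpi (step y)
      have e5 : Fintype.card (Reg Y) * (2 * ((rep x).size + (rep y).size + l.length +
          (rep (step y)).size) + 1) ≤
          Fintype.card (Reg Y) * (2 * (Rep.size x + 2 * B + l.length) + 1) := by
        refine Nat.mul_le_mul_left _ ?_
        change 2 * (Rep.size x + Rep.size y + l.length + Rep.size (step y)) + 1 ≤ _
        omega
      have e6 : Fintype.card (Reg Y) * (2 * ((rep x).size + (rep (step y)).size + l.length +
          (rep (step y)).size) + 1) ≤
          Fintype.card (Reg Y) * (2 * (Rep.size x + 2 * B + l.length) + 1) := by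
        refine Nat.mul_le_mul_left _ ?_
        change 2 * (Rep.size x + Rep.size (step y) + l.length + Rep.size (step y)) + 1 ≤ _
        omega
      simp only [cost]
      omega
    · funext i
      rcases i with i | i | i | i | i <;> simp [st, k]
    · rintro (i | i | i) (j | j | j) h <;> cases h <;> rfl
    · rintro (i | i | i) <;> rfl
    · rintro (i | i | i) <;> rfl
    · rintro (i | i | i | i | i | i | i | i) hi
      any_goals rfl
      exact absurd rfl (hi (.inr (.inl i)))
    · rintro (i | i | i) (j | j | j) h <;> cases h <;> rfl
    · rintro (i | i | i) <;> rfl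
    · rintro (i | i | i) <;> rfl
    · rintro (i | i | i | i | i | i | i | i) hi
      any_goals rfl
      exact absurd rfl (hi (.inr (.inl i)))
  have hloop : ∀ (x : X) (B : ℕ) (l : List ℕ) (y : Y),
      (∀ i ≤ l.length, Rep.size (step^[i] y) ≤ B) →
      ∃ m ≤ l.length * (cost (Rep.size x) l.length B + 1) + 1,
      Run (.loop k body) (st (rep x) (rep y) l fun _ => [])
        (st (rep x) (rep (step^[l.length] y)) [] fun _ => []) m := by
    intro x B l
    induction l with
    | nil => exact fun y _ => ⟨1, by simp, .loop_nil rfl⟩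
    | cons a l ih =>
      intro y hB
      obtain ⟨m₁, hm₁, h₁⟩ := hbody x y a l B (hB 0 (by simp)) (hB 1 (by simp))
      obtain ⟨m₂, hm₂, h₂⟩ := ih (step y) fun i hi => hB (i + 1) (by simpa using hi)
      refine ⟨m₁ + m₂ + 1, ?_, .loop_cons (by simp [st, k]) h₁ h₂⟩
      have : cost (Rep.size x) l.length B ≤ cost (Rep.size x) (l.length + 1) B := by
        simp only [cost]
        gcongr <;> omega
      have h3 : l.length * (cost (Rep.size x) l.length B + 1) ≤
          l.length * (cost (Rep.size x) (l.length + 1) B + 1) := by gcongr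
      simp only [List.length_cons, Nat.succ_mul]
      omega
  refine intro (L := Unit ⊕ Reg Y ⊕ (Fin nl ⊕ Fin ny ⊕ Fin ns ⊕ Fin ni))
    (.seq (cl.map el) (.seq (cy.map ey) (.loop k body)))
    (g := fun x => tl x + (ty x + ((l x).length *
      (cost (Rep.size x) (l x).length (b x) + 1) + 1))) ?_ fun x => ?_
  · have hc : PBdd (fun x => Fintype.card (Reg Y) * (2 * (Rep.size x + 2 * b x + (l x).length) + 1)
        + 1) :=
      ((PBdd.const _).mul (((PBdd.const 2).mul ((PBdd.size.add ((PBdd.const 2).mul hb)).add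
        hsl)).add (.const 1))).add (.const 1)
    exact htl.add (hty.add ((hsl.mul (((PBdd.const 1).add ((hb.eval ps).add (hc.add
      ((hb.eval pi).add hc)))).add (.const 1))).add (.const 1)))
  · obtain ⟨m₁, hm₁, h₁⟩ := hl x
    obtain ⟨m₂, hm₂, h₂⟩ := hy x
    obtain ⟨m₃, hm₃, h₃⟩ := hloop x (b x) ((l x).map code) (y x) (by simpa using hsize x)
    rw [List.length_map] at hm₃ h₃
    refine ⟨m₁ + (m₂ + m₃), by omega, .seq (t := st (rep x) (fun _ => []) ((l x).map code)
      fun _ => []) (h₁.map ?_ ?_ ?_ ?_) (.seq (h₂.map ?_ ?_ ?_ ?_) (h₃.of_eq ?_))⟩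
    · rintro (i | i | i) (j | j | j) h <;> cases h <;> rfl
    · rintro (i | i | i) <;> rfl
    · rintro (i | i | i) <;> rfl
    · rintro (i | i | i | i | i | i | i | i) hi
      any_goals rfl
      exact absurd rfl (hi (.inr (.inl i)))
    · rintro (i | i | i) (j | j | j) h <;> cases h <;> rfl
    · rintro (i | i | i) <;> rfl
    · rintro (i | i | i) <;> rfl
    · rintro (i | i | i | i | i | i | i | i) hi
      any_goals rfl
      exact absurd rfl (hi (.inr (.inl i)))
    · funext i
      rcases i with i | i | i | i | i <;> rfl

end PT


open RationalProofs.Rep (Reg rep bound)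

namespace PT

variable {X Y Z : Type} [Rep X] [Rep Y] [Rep Z] {α β : Type} [Finite α] [Finite β]

/-! ### Functions on lists -/

theorem pfst {f : X → Y × Z} (hf : PT f) : PT (fun x => (f x).1) := fst.comp hf

theorem psnd {f : X → Y × Z} (hf : PT f) : PT (fun x => (f x).2) := snd.comp hf

/-- A fold is an iteration on triples of parameter, accumulator and unread rest, which consumes one
letter per step and makes as many steps as there are letters. -/
theorem fold {l : X → List α} {y : X → Y} {step : α → X → Y → Y} (hl : PT l) (hy : PT y)
    (hstep : ∀ a, PT (fun p : X × Y => step a p.1 p.2)) {b : X → ℕ} (hb : PBdd b)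
    (hsize : ∀ x, ∀ i ≤ (l x).length,
      Rep.size (((l x).take i).foldl (fun y a => step a x y) (y x)) ≤ b x) :
    PT (fun x => (l x).foldl (fun y a => step a x y) (y x)) := by
  let next : (X × Y) × List α → (X × Y) × List α := fun z =>
    match z.2.head? with
    | none => z
    | some a => ((z.1.1, step a z.1.1 z.1.2), z.2.tail)
  have hnext : PT next := cases (sel := fun z : (X × Y) × List α => z.2.head?)
    (g := fun o z => match o with
      | none => z
      | some a => ((z.1.1, step a z.1.1 z.1.2), z.2.tail)) PT.snd.head? (by
      rintro (_ | a)
      · exact PT.id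
      · exact (fst.pfst.pair ((hstep a).comp fst)).pair snd.tail)
  have hiter : ∀ (x : X) (i : ℕ) (y : Y) (l : List α), i ≤ l.length → next^[i] ((x, y), l) =
      ((x, (l.take i).foldl (fun y a => step a x y) y), l.drop i) := by
    intro x i
    induction i with
    | zero => intro y l _; simp
    | succ i ih =>
      intro y l hi
      rcases l with - | ⟨a, l⟩
      · simp at hi
      · rw [Function.iterate_succ_apply]
        exact ih (step a x y) l (by simpa using hi)
  have := iterate hl (((PT.id).pair hy).pair hl) hnext
    (b := fun x => Rep.size x + b x + (l x).length) ((PBdd.size.add hb).add (by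
      simpa using hl.size)) (by
      intro x i hi
      rw [hiter x i _ _ hi]
      simp only [Rep.size_prod, Rep.size_list, List.length_drop]
      have := hsize x i hi
      omega)
  refine this.pfst.psnd.of_eq fun x => ?_
  rw [hiter x _ _ _ le_rfl]
  simp

/-- Growth by an amount `d x` that does not depend on the accumulator adds up to at most `(l
x).length * d x`, which is polynomial. -/
theorem fold_of_growth {l : X → List α} {y : X → Y} {step : α → X → Y → Y} (hl : PT l)
    (hy : PT y) (hstep : ∀ a, PT (fun p : X × Y => step a p.1 p.2)) {d : X → ℕ} (hd : PBdd d)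
    (hsize : ∀ a x y, Rep.size (step a x y) ≤ Rep.size y + d x) :
    PT (fun x => (l x).foldl (fun y a => step a x y) (y x)) := by
  have key : ∀ x (l : List α) (y : Y),
      Rep.size (l.foldl (fun y a => step a x y) y) ≤ Rep.size y + l.length * d x := by
    intro x l
    induction l with
    | nil => simp
    | cons a l ih =>
      intro y
      have h1 := ih (step a x y)
      have h2 := hsize a x y
      simp only [List.foldl_cons, List.length_cons, Nat.succ_mul]
      omega
  refine fold hl hy hstep (b := fun x => Rep.size (y x) + (l x).length * d x)
    (hy.size.add ((by simpa using hl.size : PBdd fun x => (l x).length).mul hd)) fun x i hi => ?_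
  refine (key x _ _).trans ?_
  gcongr
  simp

theorem revAppend {l l' : X → List α} (hl : PT l) (hl' : PT l') :
    PT (fun x => (l x).reverse ++ l' x) := by
  refine (fold_of_growth (step := fun a _ y => a :: y) hl hl' (fun a => snd.cons_const a)
    (PBdd.const 1) (by simp)).of_eq fun x => ?_
  generalize l x = u, l' x = v
  induction u generalizing v with
  | nil => rfl
  | cons a u ih => rw [List.foldl_cons, ih]; simp

theorem reverse {l : X → List α} (hl : PT l) : PT (fun x => (l x).reverse) :=
  (revAppend hl nil).of_eq fun _ => List.append_nil _

theorem append {l l' : X → List α} (hl : PT l) (hl' : PT l') : PT (fun x => l x ++ l' x) :=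
  (revAppend hl.reverse hl').of_eq fun x => by rw [List.reverse_reverse]

theorem cons {a : X → α} {l : X → List α} (ha : PT a) (hl : PT l) : PT (fun x => a x :: l x) :=
  cases (g := fun a x => a :: l x) ha fun a => hl.cons_const a

theorem foldr_of_growth {l : X → List α} {y : X → Y} {step : α → X → Y → Y} (hl : PT l)
    (hy : PT y) (hstep : ∀ a, PT (fun p : X × Y => step a p.1 p.2)) {d : X → ℕ} (hd : PBdd d)
    (hsize : ∀ a x y, Rep.size (step a x y) ≤ Rep.size y + d x) :
    PT (fun x => (l x).foldr (fun a y => step a x y) (y x)) :=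
  (fold_of_growth hl.reverse hy hstep hd hsize).of_eq fun x => by rw [List.foldl_reverse]

theorem flatMap {l : X → List α} {f : α → X → List β} (hl : PT l) (hf : ∀ a, PT (f a)) :
    PT (fun x => (l x).flatMap (fun a => f a x)) := by
  have : Fintype α := Fintype.ofFinite α
  have hsum : ∀ s : Finset α, PBdd (fun x => ∑ a ∈ s, (f a x).length) := by
    classical
    intro s
    induction s using Finset.induction_on with
    | empty => simpa using PBdd.const 0
    | insert a s ha ih =>
      simp only [Finset.sum_insert ha]
      exact (by simpa using (hf a).size : PBdd fun x => (f a x).length).add ih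
  refine (foldr_of_growth (step := fun a x y => f a x ++ y) hl nil
    (fun a => ((hf a).comp fst).append snd) (hsum Finset.univ) fun a x y => ?_).of_eq fun x => ?_
  · have : (f a x).length ≤ ∑ a, (f a x).length :=
      Finset.single_le_sum (f := fun a => (f a x).length) (fun _ _ => Nat.zero_le _)
        (Finset.mem_univ a)
    simp only [Rep.size_list, List.length_append]
    omega
  · induction l x with
    | nil => rfl
    | cons a u ih => rw [List.foldr_cons, ih, List.flatMap_cons]

theorem map (f : α → β) {l : X → List α} (hl : PT l) : PT (fun x => (l x).map f) :=
  (flatMap (f := fun a _ => [f a]) hl fun a => const_list _).of_eq fun x =>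
    (List.map_eq_flatMap ..).symm

theorem takeWhile (p : α → Bool) {l : X → List α} (hl : PT l) :
    PT (fun x => (l x).takeWhile p) := by
  refine (foldr_of_growth (step := fun a _ y => if p a then a :: y else []) hl nil (fun a => ?_)
    (PBdd.const 1) fun a x y => ?_).of_eq fun x => ?_
  · cases p a
    · exact nil
    · exact snd.cons_const a
  · cases p a <;> simp
  · induction l x with
    | nil => rfl
    | cons a u ih => rw [List.foldr_cons, ih, List.takeWhile_cons]

theorem drop {u : X → List β} {l : X → List α} (hu : PT u) (hl : PT l) :
    PT (fun x => (l x).drop (u x).length) := by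
  have key : ∀ (i : ℕ) (l : List α), List.tail^[i] l = l.drop i := by
    intro i
    induction i with
    | zero => simp
    | succ i ih => intro l; rw [Function.iterate_succ_apply, ih, List.drop_tail]
  refine (iterate hu hl PT.id.tail hl.size fun x i _ => ?_).of_eq fun x => key _ _
  rw [key]
  simp

/-- A prefix is what remains after dropping the surplus letters from the reversed word; the inner
`drop` provides their number as a length. -/
theorem take {u : X → List β} {l : X → List α} (hu : PT u) (hl : PT l) :
    PT (fun x => (l x).take (u x).length) :=
  (drop (drop hu hl) hl.reverse).reverse.of_eq fun x => by
    rw [List.drop_reverse, List.reverse_reverse, List.length_drop]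
    by_cases h : (u x).length ≤ (l x).length
    · congr 1; omega
    · rw [List.take_of_length_le (by omega), List.take_of_length_le (by omega)]

theorem dropWhile (p : α → Bool) {l : X → List α} (hl : PT l) :
    PT (fun x => (l x).dropWhile p) :=
  (drop (hl.takeWhile p) hl).of_eq fun x => by
    induction l x with
    | nil => rfl
    | cons a u ih => by_cases h : p a <;> simp [h, ih]

theorem apply_fin {F G : Type} [Finite F] [Finite G] (h : F → G) {f : X → F} (hf : PT f) :
    PT (fun x => h (f x)) :=
  cases (g := fun a _ => h a) hf fun a => const_fin _

theorem apply_fin₂ {F G H : Type} [Finite F] [Finite G] [Finite H] (h : F → G → H) {f : X → F}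
    {g : X → G} (hf : PT f) (hg : PT g) : PT (fun x => h (f x) (g x)) :=
  cases (g := fun a x => h a (g x)) hf fun a => hg.apply_fin (h a)

theorem length_eq (c : ℕ) : ∀ {l : X → List α}, PT l → PT (fun x => decide ((l x).length = c)) := by
  induction c with
  | zero =>
    intro l hl
    refine (hl.head?.apply_fin Option.isNone).of_eq fun x => ?_
    cases l x <;> simp
  | succ c ih =>
    intro l hl
    refine (hl.head?.apply_fin₂ (fun o b => o.isSome && b) (ih hl.tail)).of_eq fun x => ?_
    cases l x
    · simp
    · simp only [List.head?_cons, List.tail_cons, List.length_cons, Option.isSome_some,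
        Bool.true_and]
      exact decide_eq_decide.2 (by simp)

theorem eq_singleton (a : α) {l : X → List α} (hl : PT l) :
    PT (fun x => open Classical in decide (l x = [a])) := by
  classical
  refine (hl.head?.apply_fin₂ (fun o b => decide (o = some a) && b) (length_eq 0 hl.tail)).of_eq
    fun x => ?_
  rcases l x with - | ⟨b, _ | ⟨c, l⟩⟩ <;> simp

/-! ### Unary numbers -/

theorem unary_length {l : X → List α} (hl : PT l) :
    PT (fun x => List.replicate (l x).length ()) :=
  (hl.map fun _ => ()).of_eq fun x => by simp

theorem unary_add {m n : X → ℕ} (hm : PT fun x => List.replicate (m x) ())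
    (hn : PT fun x => List.replicate (n x) ()) : PT (fun x => List.replicate (m x + n x) ()) :=
  (hm.append hn).of_eq fun x => by rw [List.replicate_append_replicate]

theorem unary_mul {m n : X → ℕ} (hm : PT fun x => List.replicate (m x) ())
    (hn : PT fun x => List.replicate (n x) ()) : PT (fun x => List.replicate (m x * n x) ()) :=
  (hm.flatMap (f := fun _ x => List.replicate (n x) ()) fun _ => hn).of_eq fun x => by
    rw [List.eq_replicate_iff]
    simp

/-- Unary numbers are the lengths that drive `iterate`, so this provides a clock for every
polynomial time bound. -/
theorem unary_eval (p : Polynomial ℕ) {n : X → ℕ} (hn : PT fun x => List.replicate (n x) ()) :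
    PT (fun x => List.replicate (p.eval (n x)) ()) := by
  induction p using Polynomial.induction_on' with
  | add p q hp hq => simpa using unary_add hp hq
  | monomial i a =>
    simp only [Polynomial.eval_monomial]
    refine unary_mul (const_list _) ?_
    induction i with
    | zero => simpa using const_list _
    | succ i ih => simp only [pow_succ]; exact unary_mul ih hn

end PT

/-! ### Tuples of words -/

/-- Uses the very encoding that machines on tuples read, so the size counts letters and separators,
as in `PolyTimeOnTuples`. -/
noncomputable instance Rep.tuple {A : Type} [Finite A] : Rep (List (List A)) where
  Reg := Unit
  rep z _ := (encodeTuple z).map code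
  bound := Nat.card (Option A)
  lt_bound x _ a ha := by
    obtain ⟨b, -, rfl⟩ := List.mem_map.1 ha
    exact code_lt b

theorem Rep.size_tuple {A : Type} [Finite A] (z : List (List A)) :
    Rep.size z = (encodeTuple z).length := by
  simp [Rep.size, Store.size, Rep.rep, Rep.Reg]

section

variable {A : Type}

@[simp]
theorem encodeTuple_nil : encodeTuple ([] : List (List A)) = [] := rfl

@[simp]
theorem encodeTuple_cons (w : List A) (z : List (List A)) :
    encodeTuple (w :: z) = w.map some ++ none :: encodeTuple z := by
  simp [encodeTuple]

@[simp]
theorem encodeTuple_append (z z' : List (List A)) :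
    encodeTuple (z ++ z') = encodeTuple z ++ encodeTuple z' := by
  simp [encodeTuple]

end

/-! ### Polynomial-time operations on tuples -/

namespace PT

variable {X Y Z : Type} [Rep X] [Rep Y] [Rep Z] {A β : Type} [Finite A] [Finite β]

theorem encode {z : X → List (List A)} (hz : PT z) : PT (fun x => encodeTuple (z x)) :=
  (PT.reindex (f := fun z : List (List A) => encodeTuple z) (fun _ => ()) fun _ _ => rfl).comp hz

/-- A tuple and its encoding have the same stack contents, so the same program serves for both. -/
theorem of_encode {z : X → List (List A)} (hz : PT (fun x => encodeTuple (z x))) : PT z := by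
  obtain ⟨n, c, g, hg, h⟩ := hz
  exact ⟨n, c, g, hg, h⟩

theorem tuple_nil : PT (fun _ : X => ([] : List (List A))) := of_encode nil

theorem tuple_append {z z' : X → List (List A)} (hz : PT z) (hz' : PT z') :
    PT (fun x => z x ++ z' x) :=
  of_encode ((hz.encode.append hz'.encode).of_eq fun x => by simp)

theorem tuple_cons {w : X → List A} {z : X → List (List A)} (hw : PT w) (hz : PT z) :
    PT (fun x => w x :: z x) :=
  of_encode (((hw.map some).append (hz.encode.cons_const none)).of_eq fun x => by simp)

theorem tuple_map_const {ι : Type} (L : List ι) {f : ι → X → List A} (hf : ∀ i ∈ L, PT (f i)) :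
    PT (fun x => L.map fun i => f i x) := by
  induction L with
  | nil => exact tuple_nil
  | cons i L ih =>
    exact tuple_cons (hf i (by simp)) (ih fun j hj => hf j (by simp [hj]))

theorem tuple_flatMap_const {ι : Type} (L : List ι) {f : ι → X → List (List A)}
    (hf : ∀ i ∈ L, PT (f i)) : PT (fun x => L.flatMap fun i => f i x) := by
  induction L with
  | nil => exact tuple_nil
  | cons i L ih =>
    simp only [List.flatMap_cons]
    exact tuple_append (hf i (by simp)) (ih fun j hj => hf j (by simp [hj]))

theorem takeWhile_encodeTuple (w : List A) (u : List (Option A)) :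
    (w.map some ++ none :: u).takeWhile Option.isSome = w.map some := by
  induction w <;> simp_all

theorem dropWhile_encodeTuple (w : List A) (u : List (Option A)) :
    (w.map some ++ none :: u).dropWhile Option.isSome = none :: u := by
  induction w <;> simp_all

theorem tuple_headD {z : X → List (List A)} (hz : PT z) : PT (fun x => (z x).headD []) :=
  ((hz.encode.takeWhile Option.isSome).flatMap (f := fun o _ => o.toList)
    fun o => const_list _).of_eq fun x => by
      rcases z x with - | ⟨w, z⟩
      · rfl
      · rw [encodeTuple_cons, takeWhile_encodeTuple]
        simp [List.flatMap_map]

theorem tuple_tail {z : X → List (List A)} (hz : PT z) : PT (fun x => (z x).tail) :=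
  of_encode ((hz.encode.dropWhile Option.isSome).tail.of_eq fun x => by
      rcases z x with - | ⟨w, z⟩
      · rfl
      · rw [encodeTuple_cons, dropWhile_encodeTuple]
        simp)

theorem iterate_tail {α : Type} (i : ℕ) (l : List α) : List.tail^[i] l = l.drop i := by
  induction i generalizing l with
  | zero => simp
  | succ i ih => rw [Function.iterate_succ_apply, ih, List.drop_tail]

theorem tuple_drop_const {z : X → List (List A)} (hz : PT z) (i : ℕ) :
    PT (fun x => (z x).drop i) := by
  induction i with
  | zero => simpa using hz
  | succ i ih => exact ih.tuple_tail.of_eq fun x => by simp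

theorem tuple_getD_const {z : X → List (List A)} (hz : PT z) (i : ℕ) :
    PT (fun x => (z x).getD i []) :=
  (hz.tuple_drop_const i).tuple_headD.of_eq fun x => by
    rw [List.headD_eq_head?_getD, List.head?_drop, List.getD_eq_getElem?_getD]

theorem length_encodeTuple_drop_le (z : List (List A)) (i : ℕ) :
    (encodeTuple (z.drop i)).length ≤ (encodeTuple z).length := by
  conv_rhs => rw [← List.take_append_drop i z, encodeTuple_append, List.length_append]
  omega

theorem tuple_drop {u : X → List β} {z : X → List (List A)} (hu : PT u) (hz : PT z) :
    PT (fun x => (z x).drop (u x).length) := by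
  refine (iterate hu hz PT.id.tuple_tail hz.size fun x i _ => ?_).of_eq fun x => iterate_tail _ _
  rw [iterate_tail, Rep.size_tuple, Rep.size_tuple]
  exact length_encodeTuple_drop_le _ _

theorem tuple_getD {u : X → List β} {z : X → List (List A)} (hu : PT u) (hz : PT z) :
    PT (fun x => (z x).getD (u x).length []) :=
  (tuple_drop hu hz).tuple_headD.of_eq fun x => by
    rw [List.headD_eq_head?_getD, List.head?_drop, List.getD_eq_getElem?_getD]

theorem tuple_head? {z : X → List (List A)} (hz : PT z) : PT (fun x => (z x).isEmpty) :=
  (hz.encode.head?.apply_fin Option.isNone).of_eq fun x => by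
    rcases z x with - | ⟨_ | ⟨a, w⟩, z⟩ <;> simp

theorem tuple_length_eq {z : X → List (List A)} (hz : PT z) (c : ℕ) :
    PT (fun x => decide ((z x).length = c)) := by
  refine (length_eq c (hz.encode.flatMap (f := fun o _ => if o.isNone then [()] else [])
    fun o => const_list _)).of_eq fun x => ?_
  have : ((encodeTuple (z x)).flatMap fun o => if o.isNone then [()] else []).length =
      (z x).length := by
    induction z x with
    | nil => rfl
    | cons w z ih =>
      simp only [encodeTuple_cons, List.flatMap_append, List.flatMap_cons, List.length_append, ih,
        List.flatMap_map]
      simp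
      omega
  rw [this]

/-- The encoding is read letter by letter while the results and the current component are
accumulated in reverse; a separator triggers the evaluation of `f`. As `f` has values in a finite
type, each letter adds at most one to the size. -/
theorem tuple_map (f : List A → β) (hf : PT f) {z : X → List (List A)} (hz : PT z) :
    PT (fun x => (z x).map f) := by
  have key : ∀ (z : List (List A)) (out : List β), (encodeTuple z).foldl
      (fun (y : List β × List A) o => match o with
        | some a => (y.1, a :: y.2)
        | none => (f y.2.reverse :: y.1, [])) (out, []) = ((z.map f).reverse ++ out, []) := by
    intro z
    induction z with
    | nil => simp
    | cons w z ih =>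
      intro out
      have : ∀ (w : List A) (cur : List A), (w.map some).foldl
          (fun (y : List β × List A) o => match o with
            | some a => (y.1, a :: y.2)
            | none => (f y.2.reverse :: y.1, [])) (out, cur) = (out, w.reverse ++ cur) := by
        intro w
        induction w with
        | nil => simp
        | cons a w ih => intro cur; rw [List.map_cons, List.foldl_cons, ih]; simp
      rw [encodeTuple_cons, List.foldl_append, this, List.foldl_cons]
      simp [ih]
  refine (fold_of_growth (Y := List β × List A) (y := fun _ => ([], []))
    (step := fun o _ y => match o with
        | some a => (y.1, a :: y.2)
        | none => (f y.2.reverse :: y.1, [])) hz.encode (nil.pair nil) ?_ (PBdd.const 1)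
        ?_).pfst.reverse.of_eq fun x => ?_
  · rintro (_ | a)
    · exact (cons (hf.comp snd.psnd.reverse) snd.pfst).pair nil
    · exact snd.pfst.pair (snd.psnd.cons_const a)
  · rintro (_ | a) x y <;> simp <;> omega
  · rw [key]; simp

end PT

/-! ### Packing a tuple of words into one word over the same alphabet -/

section pack

variable {A : Type} (bit : Bool ↪ A)

/-- A self-delimiting encoding of tuples of words by words over the same alphabet. -/
def pack (z : List (List A)) : List A :=
  z.flatMap fun w => w.flatMap (fun a => [bit true, a]) ++ [bit false]

/-- One step of the decoding of `pack`: the state consists of the announcement of a letter, the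
current word (reversed) and the words read so far. -/
noncomputable def unpackStep (a : A) (s : (Bool × List A) × List (List A)) :
    (Bool × List A) × List (List A) :=
  open Classical in
  if s.1.1 then ((false, a :: s.1.2), s.2)
  else if a = bit true then ((true, s.1.2), s.2)
  else ((false, []), s.2 ++ [s.1.2.reverse])

/-- The inverse of `pack`. -/
noncomputable def unpack (w : List A) : List (List A) :=
  (w.foldl (fun s a => unpackStep bit a s) ((false, []), [])).2

theorem unpack_pack (z : List (List A)) : unpack bit (pack bit z) = z := by
  have hbit : bit false ≠ bit true := fun h => by simpa using bit.injective h
  have h₁ : ∀ (w cur : List A) (out : List (List A)) (rest : List A),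
      (w.flatMap (fun a => [bit true, a]) ++ rest).foldl (fun s a => unpackStep bit a s)
        ((false, cur), out) =
      rest.foldl (fun s a => unpackStep bit a s) ((false, w.reverse ++ cur), out) := by
    intro w
    induction w with
    | nil => simp
    | cons a w ih =>
      intro cur out rest
      have : ((a :: w).flatMap (fun a => [bit true, a]) ++ rest) =
        bit true :: a :: (w.flatMap (fun a => [bit true, a]) ++ rest) := by simp
      rw [this, List.foldl_cons, List.foldl_cons]
      have h2 : unpackStep bit a (unpackStep bit (bit true) ((false, cur), out)) =
        ((false, a :: cur), out) := by simp [unpackStep]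
      rw [h2, ih]
      simp
  have h₂ : ∀ (z out : List (List A)), (pack bit z).foldl (fun s a => unpackStep bit a s)
      ((false, []), out) = ((false, []), out ++ z) := by
    intro z
    induction z with
    | nil => simp [pack]
    | cons w z ih =>
      intro out
      have : pack bit (w :: z) = w.flatMap (fun a => [bit true, a]) ++ (bit false :: pack bit z) := by
        simp [pack]
      rw [this, h₁, List.foldl_cons]
      have h3 : unpackStep bit (bit false) ((false, w.reverse ++ []), out) =
          ((false, []), out ++ [w]) := by simp [unpackStep, hbit]
      rw [h3, ih]
      simp
  simp [unpack, h₂]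

theorem length_pack (z : List (List A)) :
    (pack bit z).length = (z.map fun w => 2 * w.length + 1).sum := by
  induction z with
  | nil => rfl
  | cons w z ih =>
    have : pack bit (w :: z) = w.flatMap (fun a => [bit true, a]) ++ (bit false :: pack bit z) := by
      simp [pack]
    rw [this, List.map_cons, List.sum_cons, ← ih]
    simp [List.length_flatMap, Nat.mul_comm]
    omega

theorem PT.unpack {X : Type} [Rep X] [Finite A] {w : X → List A} (hw : PT w) :
    PT (fun x => unpack bit (w x)) := by
  classical
  refine (PT.fold_of_growth (Y := (Bool × List A) × List (List A))
    (step := fun a _ s => unpackStep bit a s) hw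
    (((PT.const_fin false).pair .nil).pair .tuple_nil) (fun a => ?_) (PBdd.const 2)
    fun a x s => ?_).psnd
  · refine (PT.snd.pfst.pfst).ite
      (((PT.const_fin false).pair (PT.snd.pfst.psnd.cons_const a)).pair PT.snd.psnd) ?_
    by_cases h : a = bit true
    · simp only [h, if_true]
      exact ((PT.const_fin true).pair PT.snd.pfst.psnd).pair PT.snd.psnd
    · simp only [h, if_false]
      exact ((PT.const_fin false).pair .nil).pair
        (.tuple_append PT.snd.psnd (.tuple_cons PT.snd.pfst.psnd.reverse .tuple_nil))
  · obtain ⟨⟨b, cur⟩, out⟩ := s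
    simp only [unpackStep]
    split_ifs <;> simp only [Rep.size_prod, Rep.size_list, Rep.size_tuple, Rep.size_ofFinite] <;>
      simp <;> omega

end pack


open RationalProofs.Rep (Reg rep bound)

/-! ### From polynomial-time programs to Turing machines -/

namespace Cmd

variable {K : Type}

theorem PushesIn.dispatch {P : K → ℕ → Prop} {k : K} {f : ℕ → Cmd K} :
    ∀ {N : ℕ}, (∀ n < N, (f n).PushesIn P) → (Cmd.dispatch k f N).PushesIn P
  | 0, _ => trivial
  | N + 1, h => ⟨h N (by omega), PushesIn.dispatch fun n hn => h n (by omega)⟩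

theorem PushesIn.moveRev {P : K → ℕ → Prop} {k k' : K} {N : ℕ} (h : ∀ n < N, P k' n) :
    (Cmd.moveRev N k k').PushesIn P :=
  PushesIn.dispatch (f := fun a => .seq (.pop k) (.push k' a)) fun n hn => ⟨trivial, h n hn⟩

theorem PushesIn.clear {P : K → ℕ → Prop} : ∀ l : List K, (Cmd.clear l).PushesIn P
  | [] => trivial
  | _ :: l => ⟨trivial, PushesIn.clear l⟩

end Cmd

theorem Run.moveRev_of_empty {K : Type} [DecidableEq K] {N : ℕ} {k k' : K} (hk : k ≠ k')
    {s : Store K} {l : List ℕ} (h : ∀ a ∈ s k, a < N) (hk' : s k' = []) (hl : l = (s k).reverse) :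
    ∃ n ≤ (N + 3) * (s k).length + 1, Run (Cmd.moveRev N k k') s
      (Function.update (Function.update s k []) k' l) n := by
  obtain ⟨n, hn, h⟩ := Run.moveRev hk _ s rfl h
  exact ⟨n, hn, h.of_eq (by rw [hl, hk', List.append_nil])⟩

/-- Index set of the stacks of the machine computing a function on tuples. -/
abbrev WrapStack (n : ℕ) : Type := Bool ⊕ Unit ⊕ (Unit ⊕ Unit ⊕ Fin n)

/-- Alphabets of the stacks of the machine computing a function on tuples. -/
abbrev WrapAlphabet (A B : Type) (n : ℕ) : WrapStack n → Type
  | .inl false => Option A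
  | .inl true => B
  | .inr _ => ℕ

/-- The program is wrapped by transfers between the machine's input and output stacks and its own;
each transfer is a pair of reversals through an auxiliary stack. All stacks of the program itself
have alphabet `ℕ`, of which it pushes only finitely many letters. An arbitrary element of `B`
decodes the numbers that code no letter. -/
theorem PT.polyTimeOnTuples {A B : Type} [Finite A] [Finite B] [Nonempty B]
    {f : List (List A) → List B} (hf : PT f) : PolyTimeOnTuples f := by
  have hsize := hf.size
  obtain ⟨n, c, g, hg, h⟩ := hf
  let c' : Cmd (Unit ⊕ Unit ⊕ Fin n) := c
  let N := Nat.card (Option A)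
  let M := Nat.card B
  let e : (Unit ⊕ Unit ⊕ Fin n) → WrapStack n := fun i => .inr (.inr i)
  have he : Function.Injective e := fun i j hij => by simpa [e] using hij
  let cd : ∀ k, WrapAlphabet A B n k → ℕ := fun k => match k with
    | .inl false => fun a : Option A => code a
    | .inl true => fun b : B => code b
    | .inr _ => fun a : ℕ => a
  let dec : ∀ k, ℕ → WrapAlphabet A B n k := fun k => match k with
    | .inl false => fun _ : ℕ => (none : Option A)
    | .inl true => fun i : ℕ => ((ofCode i : Option B).getD (Classical.arbitrary B) : B)
    | .inr _ => fun a : ℕ => a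
  let prog : Cmd (WrapStack n) := .seq (.moveRev N (.inl false : WrapStack n) (.inr (.inl ()) : WrapStack n)) (.seq (.moveRev N (.inr (.inl ()) : WrapStack n) (.inr (.inr (.inl ())) : WrapStack n))
    (.seq (c'.map e) (.seq (.clear [(.inr (.inr (.inl ())) : WrapStack n)]) (.seq (.moveRev M (.inr (.inr (.inr (.inl ()))) : WrapStack n) (.inr (.inl ()) : WrapStack n)) (.moveRev M (.inr (.inl ()) : WrapStack n) (.inl true : WrapStack n))))))
  have hdec : ∀ i < M, cd (.inl true : WrapStack n) (dec (.inl true : WrapStack n) i) = i := by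
    intro i hi
    change code ((ofCode i : Option B).getD (Classical.arbitrary B)) = i
    rw [ofCode, dif_pos hi]
    simp [code]
  have hpush : prog.PushesIn (fun k a => cd k (dec k a) = a) :=
    ⟨.moveRev fun _ _ => rfl, .moveRev fun _ _ => rfl, .map (fun _ _ => rfl) _, .clear _,
      .moveRev fun _ _ => rfl, .moveRev hdec⟩
  let st : List ℕ → List ℕ → List ℕ → List ℕ → List ℕ → Store (WrapStack n) := fun i o t x y =>
    Sum.elim (fun b => if b then o else i) (Sum.elim (fun _ => t)
      (Sum.elim (fun _ => x) (Sum.elim (fun _ => y) fun _ => [])))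
  have hst : ∀ (s : Store (WrapStack n)) i o t x y, s (.inl false : WrapStack n) = i → s (.inl true : WrapStack n) = o → s (.inr (.inl ()) : WrapStack n) = t →
      s (.inr (.inr (.inl ())) : WrapStack n) = x → s (.inr (.inr (.inr (.inl ()))) : WrapStack n) = y → (∀ j, s (.inr (.inr (.inr (.inr j)))) = []) → s = st i o t x y := by
    intro s i o t x y h1 h2 h3 h4 h5 h6
    funext k
    rcases k with (_ | _) | k | k | k | k
    · exact h1
    · exact h2
    · exact h3
    · exact h4
    · exact h5
    · exact h6 k
  have hsz : ∀ i o t x y,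
      (st i o t x y).size = i.length + o.length + t.length + x.length + y.length := by
    intro i o t x y
    simp only [st, Store.size_elim, Store.size_empty]
    simp [Store.size]
    ring
  have hrun : ∀ z, ∃ m ≤ ((N + 3) * Rep.size z + 1) + (((N + 3) * Rep.size z + 1) + (g z +
      ((2 * (Rep.size z + Rep.size (f z)) + 1 + 1) + (((M + 3) * Rep.size (f z) + 1) +
        ((M + 3) * Rep.size (f z) + 1))))),
      Run prog (st ((encodeTuple z).map code) [] [] [] []) (st [] ((f z).map code) [] [] []) m := by
    intro z
    have hszz : Rep.size z = ((encodeTuple z).map (code (α := Option A))).length := by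
      rw [Rep.size_tuple, List.length_map]
    have hszf : Rep.size (f z) = ((f z).map code).length := by
      rw [Rep.size_list, List.length_map]
    rw [hszz, hszf]
    have hl : ∀ a ∈ (encodeTuple z).map (code (α := Option A)), a < N := by
      intro a ha
      obtain ⟨b, -, rfl⟩ := List.mem_map.1 ha
      exact code_lt b
    have hl' : ∀ a ∈ (f z).map (code (α := B)), a < M := by
      intro a ha
      obtain ⟨b, -, rfl⟩ := List.mem_map.1 ha
      exact code_lt b
    obtain ⟨m₃, hm₃, h₃⟩ := h z
    have h₃' : Run (c'.map e) (st [] [] [] ((encodeTuple z).map code) [])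
        (st [] [] [] ((encodeTuple z).map code) ((f z).map code)) m₃ := by
      refine Run.map he h₃ ?_ ?_ ?_
      · rintro (i | i | i) <;> rfl
      · rintro (i | i | i) <;> rfl
      · rintro ((_ | _) | k | k) hk
        · rfl
        · rfl
        · rfl
        · exact absurd rfl (hk k)
    generalize (encodeTuple z).map (code (α := Option A)) = u at *
    generalize (f z).map (code (α := B)) = v at *
    have hu : u = u.reverse.reverse := by simp
    have hv : v = v.reverse.reverse := by simp
    obtain ⟨m₁, hm₁, h₁⟩ := Run.moveRev_of_empty (N := N) (k := (.inl false : WrapStack n))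
      (k' := .inr (.inl ())) (by simp) (s := st u [] [] [] []) hl rfl rfl
    replace h₁ := h₁.of_eq (hst _ [] [] u.reverse [] [] rfl rfl rfl rfl rfl fun _ => rfl)
    obtain ⟨m₂, hm₂, h₂⟩ := Run.moveRev_of_empty (N := N) (k := (.inr (.inl ()) : WrapStack n))
      (k' := .inr (.inr (.inl ()))) (by simp) (s := st [] [] u.reverse [] [])
      (fun a ha => hl a (List.mem_reverse.1 ha)) rfl hu
    replace h₂ := h₂.of_eq (hst _ [] [] [] u [] rfl rfl rfl rfl rfl fun _ => rfl)
    obtain ⟨m₄, hm₄, h₄⟩ := Run.clear [(.inr (.inr (.inl ())) : WrapStack n)] (st [] [] [] u v)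
    replace h₄ := h₄.of_eq (hst _ [] [] [] [] v rfl rfl rfl rfl rfl fun _ => rfl)
    obtain ⟨m₅, hm₅, h₅⟩ := Run.moveRev_of_empty (N := M)
      (k := (.inr (.inr (.inr (.inl ()))) : WrapStack n))
      (k' := .inr (.inl ())) (by simp) (s := st [] [] [] [] v) hl' rfl rfl
    replace h₅ := h₅.of_eq (hst _ [] [] v.reverse [] [] rfl rfl rfl rfl rfl fun _ => rfl)
    obtain ⟨m₆, hm₆, h₆⟩ := Run.moveRev_of_empty (N := M) (k := (.inr (.inl ()) : WrapStack n))
      (k' := .inl true) (by simp) (s := st [] [] v.reverse [] [])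
      (fun a ha => hl' a (List.mem_reverse.1 ha)) rfl hv
    replace h₆ := h₆.of_eq (hst _ [] v [] [] [] rfl rfl rfl rfl rfl fun _ => rfl)
    change m₁ ≤ (N + 3) * u.length + 1 at hm₁
    change m₂ ≤ (N + 3) * u.reverse.length + 1 at hm₂
    change m₅ ≤ (M + 3) * v.length + 1 at hm₅
    change m₆ ≤ (M + 3) * v.reverse.length + 1 at hm₆
    refine ⟨_, ?_, h₁.seq (h₂.seq (h₃'.seq (h₄.seq (h₅.seq h₆))))⟩
    rw [hsz] at hm₄
    simp only [List.length_reverse, List.length_nil, List.length_singleton] at *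
    omega
  obtain ⟨p, hp⟩ : PBdd fun z => (((N + 3) * Rep.size z + 1) + (((N + 3) * Rep.size z + 1) + (g z +
      ((2 * (Rep.size z + Rep.size (f z)) + 1 + 1) + (((M + 3) * Rep.size (f z) + 1) +
        ((M + 3) * Rep.size (f z) + 1)))))) + 1 := by
    have h1 : PBdd fun z : List (List A) => (N + 3) * Rep.size z + 1 :=
      ((PBdd.const _).mul PBdd.size).add (.const 1)
    have h2 : PBdd fun z => (M + 3) * Rep.size (f z) + 1 :=
      ((PBdd.const _).mul hsize).add (.const 1)
    exact ((h1.add (h1.add (hg.add (((((PBdd.const 2).mul (PBdd.size.add hsize)).add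
      (.const 1)).add (.const 1)).add (h2.add h2))))).add (.const 1))
  have : Finite (WrapAlphabet A B n (.inl false : WrapStack n)) := inferInstanceAs (Finite (Option A))
  refine ⟨⟨⟨prog.machine (.inl false : WrapStack n) (.inl true : WrapStack n) (WrapAlphabet A B n) cd dec, Equiv.refl (Option A),
    Equiv.refl B⟩, p, fun z => Classical.choice ?_⟩⟩
  obtain ⟨m, hm, h'⟩ := hrun z
  refine Cmd.machine_outputs (n := m) ?_ hpush ?_ ?_
  · rintro ((_ | _) | k)
    · exact code_injective
    · exact code_injective
    · exact fun _ _ h => h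
  · have := hp z
    beta_reduce at this
    rw [Rep.size_tuple] at this
    rw [Rep.size_tuple] at hm
    omega
  · have e₁ : ∀ u : List (Option A), Function.update (fun _ => []) (.inl false : WrapStack n)
        ((u.map (Equiv.refl (Option A)).invFun).map (cd (.inl false))) =
        st (u.map code) [] [] [] [] := fun u =>
      hst _ _ _ _ _ _ (by rw [List.map_map]; rfl) rfl rfl rfl rfl fun _ => rfl
    have e₂ : ∀ u : List B, Function.update (fun _ => []) (.inl true : WrapStack n)
        ((u.map (Equiv.refl B).invFun).map (cd (.inl true))) = st [] (u.map code) [] [] [] :=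
      fun u => hst _ _ _ _ _ _ rfl (by rw [List.map_map]; rfl) rfl rfl rfl fun _ => rfl
    exact (e₁ _).symm ▸ (e₂ (f z)).symm ▸ h'


/-! ### Turing machines run in polynomial time -/

section machine

open Turing

/-- All letters that a statement can push. -/
def pushed {K : Type} {Γ : K → Type} {Λ σ : Type} : TM2.Stmt Γ Λ σ → Set (Σ k, Γ k)
  | .push k f q => Set.range (fun v => (⟨k, f v⟩ : Σ k, Γ k)) ∪ pushed q
  | .peek _ _ q => pushed q
  | .pop _ _ q => pushed q
  | .load _ q => pushed q
  | .branch _ q₁ q₂ => pushed q₁ ∪ pushed q₂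
  | .goto _ => ∅
  | .halt => ∅

/-- A pushed letter is a function of the internal state, which has finitely many values. Hence only
finitely many letters ever occur, even on stacks with an infinite alphabet. -/
theorem finite_pushed {K : Type} {Γ : K → Type} {Λ σ : Type} [Finite σ] (q : TM2.Stmt Γ Λ σ) :
    (pushed q).Finite := by
  induction q with
  | push k f q ih => exact (Set.finite_range _).union ih
  | branch _ _ _ ih₁ ih₂ => exact ih₁.union ih₂
  | goto => exact Set.finite_empty
  | halt => exact Set.finite_empty
  | _ => assumption

variable (tm : FinTM2)

/-- All letters that can occur on the stacks of the machine. -/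
def Letters : Set (Σ k, tm.Γ k) :=
  (⋃ l, pushed (tm.m l)) ∪ Set.range (fun g : tm.Γ tm.k₀ => (⟨tm.k₀, g⟩ : Σ k, tm.Γ k))

theorem finite_letters : (Letters tm).Finite := by
  have := tm.ΛFin
  have := tm.σFin
  have := tm.Γk₀Fin
  exact (Set.finite_iUnion fun l => finite_pushed _).union (Set.finite_range _)

/-- The letters that can occur on stack `k`. -/
abbrev Letter (k : tm.K) : Type := {g : tm.Γ k // (⟨k, g⟩ : Σ k, tm.Γ k) ∈ Letters tm}

instance (k : tm.K) : Finite (Letter tm k) :=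
  ((finite_letters tm).preimage (f := fun g : tm.Γ k => (⟨k, g⟩ : Σ k, tm.Γ k))
    (sigma_mk_injective.injOn)).to_subtype

/-- The label and the internal state of a machine. -/
structure Ctl where
  /-- the label -/
  l : Option tm.Λ
  /-- the internal state -/
  v : tm.σ

instance : Finite (Ctl tm) := by
  have := tm.ΛFin
  have := tm.σFin
  refine Finite.of_injective (fun c : Ctl tm => (c.l, c.v)) ?_
  rintro ⟨l, v⟩ ⟨l', v'⟩ h
  simpa using h

instance : Fintype tm.K := tm.kFin

/-- Stacks that hold only letters that can occur. -/
abbrev Stacks : Type := ∀ k, List (Letter tm k)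

variable {tm}

/-- Forgetting that only letters that can occur are on the stacks. -/
def Stacks.val (S : Stacks tm) : ∀ k, List (tm.Γ k) := fun k => (S k).map Subtype.val

/-- The configuration of the machine. -/
def toCfg (c : Ctl tm × Stacks tm) : tm.Cfg := ⟨c.1.l, c.1.v, c.2.val⟩

theorem PT.stack {X : Type} [Rep X] {f : X → Stacks tm} (hf : PT f) (k : tm.K) :
    PT (fun x => f x k) :=
  (PT.reindex (f := fun S : Stacks tm => S k) (fun _ => k) fun _ _ => rfl).comp hf

theorem PT.update {X : Type} [Rep X] {f : X → Stacks tm} (hf : PT f) (k : tm.K)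
    {l : X → List (Letter tm k)} (hl : PT l) : PT (fun x => Function.update (f x) k (l x)) :=
  (PT.reindex (f := fun p : Stacks tm × List (Letter tm k) => Function.update p.1 k p.2)
    (fun j : tm.K => (if j = k then Sum.inr () else Sum.inl j : tm.K ⊕ Unit)) fun p j => by
      by_cases h : j = k
      · subst h
        simp [rep]
      · simp [rep, h]).comp (hf.pair hl)

theorem Stacks.size_update (S : Stacks tm) (k : tm.K) (l : List (Letter tm k)) :
    Rep.size (Function.update S k l) + (S k).length = Rep.size S + l.length := by
  have := Store.size_update (rep S) k (l.map code)
  rw [List.length_map] at this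
  have h2 : rep (Function.update S k l) = Function.update (rep S) k (l.map code) := by
    funext j
    by_cases h : j = k
    · subst h
      simp [rep]
    · simp [rep, h]
  rw [← h2] at this
  simpa [Rep.size, rep] using this

theorem Stacks.val_update (S : Stacks tm) (k : tm.K) (l : List (Letter tm k)) :
    Stacks.val (Function.update S k l) = Function.update S.val k (l.map Subtype.val) := by
  funext j
  by_cases h : j = k
  · subst h
    simp [Stacks.val]
  · simp [Stacks.val, h]

/-- A statement contains no loop, and the internal state is a parameter with finitely many values.
Thus every branching is a finite case distinction on the state or on a top letter, and each `push`
contributes one to the growth `d`. -/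
theorem exists_PT_stmt (q : TM2.Stmt tm.Γ tm.Λ tm.σ) (hq : pushed q ⊆ Letters tm) :
    ∃ d : ℕ, ∀ v : tm.σ, ∃ F : Stacks tm → Ctl tm × Stacks tm, PT F ∧
      (∀ S, toCfg (F S) = TM2.stepAux q v S.val) ∧
      ∀ S, Rep.size (F S).2 ≤ Rep.size S + d := by
  induction q with
  | push k f q ih =>
    obtain ⟨d, h⟩ := ih (Set.subset_union_right.trans hq)
    refine ⟨d + 1, fun v => ?_⟩
    obtain ⟨F, hF, hF', hd⟩ := h v
    let a : Letter tm k := ⟨f v, hq (Set.mem_union_left _ ⟨v, rfl⟩)⟩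
    refine ⟨fun S => F (Function.update S k (a :: S k)),
      hF.comp (PT.id.update k ((PT.id.stack k).cons_const a)), fun S => ?_, fun S => ?_⟩
    · rw [hF', Stacks.val_update]; rfl
    · have h1 := hd (Function.update S k (a :: S k))
      have h2 := Stacks.size_update S k (a :: S k)
      rw [List.length_cons] at h2
      change Rep.size (F (Function.update S k (a :: S k))).2 ≤ _
      omega
  | peek k f q ih =>
    obtain ⟨d, h⟩ := ih hq
    refine ⟨d, fun v => ?_⟩
    choose F hF hF' hd using h
    refine ⟨fun S => F (f v ((S k).head?.map Subtype.val)) S,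
      PT.cases (g := fun o S => F (f v (o.map Subtype.val)) S) (PT.id.stack k).head?
        (fun o => hF _), fun S => ?_, fun S => hd _ _⟩
    rw [hF']
    rw [TM2.stepAux]
    simp only [Stacks.val, List.head?_map]
    rfl
  | pop k f q ih =>
    obtain ⟨d, h⟩ := ih hq
    refine ⟨d, fun v => ?_⟩
    choose F hF hF' hd using h
    refine ⟨fun S => F (f v ((S k).head?.map Subtype.val)) (Function.update S k (S k).tail),
      PT.cases (g := fun o S => F (f v (o.map Subtype.val)) (Function.update S k (S k).tail))
        (PT.id.stack k).head?
        (fun o => (hF _).comp (PT.id.update k (PT.id.stack k).tail)), fun S => ?_, fun S => ?_⟩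
    · rw [hF', Stacks.val_update]
      rw [TM2.stepAux]
      simp only [Stacks.val, List.head?_map, List.map_tail]
      rfl
    · refine (hd _ _).trans ?_
      have h2 := Stacks.size_update S k (S k).tail
      rw [List.length_tail] at h2
      omega
  | load a q ih =>
    obtain ⟨d, h⟩ := ih hq
    exact ⟨d, fun v => h (a v)⟩
  | branch p q₁ q₂ ih₁ ih₂ =>
    obtain ⟨d₁, h₁⟩ := ih₁ (Set.subset_union_left.trans hq)
    obtain ⟨d₂, h₂⟩ := ih₂ (Set.subset_union_right.trans hq)
    refine ⟨d₁ + d₂, fun v => ?_⟩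
    cases hp : p v
    · obtain ⟨F, hF, hF', hd⟩ := h₂ v
      exact ⟨F, hF, fun S => by rw [hF', TM2.stepAux, hp]; rfl, fun S => (hd S).trans (by omega)⟩
    · obtain ⟨F, hF, hF', hd⟩ := h₁ v
      exact ⟨F, hF, fun S => by rw [hF', TM2.stepAux, hp]; rfl, fun S => (hd S).trans (by omega)⟩
  | goto f =>
    exact ⟨0, fun v => ⟨fun S => (⟨some (f v), v⟩, S), (PT.const_fin _).pair PT.id,
      fun S => rfl, fun S => le_rfl⟩⟩
  | halt =>
    exact ⟨0, fun v => ⟨fun S => (⟨none, v⟩, S), (PT.const_fin _).pair PT.id,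
      fun S => rfl, fun S => le_rfl⟩⟩

theorem exists_PT_step (tm : FinTM2) : ∃ (d : ℕ) (F : Ctl tm × Stacks tm → Ctl tm × Stacks tm),
    PT F ∧ (∀ c, toCfg (F c) = (tm.step (toCfg c)).getD (toCfg c)) ∧
      ∀ c, Rep.size (F c).2 ≤ Rep.size c.2 + d := by
  have := tm.ΛFin
  have h : ∀ l, ∃ d : ℕ, ∀ v : tm.σ, ∃ F : Stacks tm → Ctl tm × Stacks tm, PT F ∧
      (∀ S, toCfg (F S) = TM2.stepAux (tm.m l) v S.val) ∧
      ∀ S, Rep.size (F S).2 ≤ Rep.size S + d := fun l =>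
    exists_PT_stmt (tm.m l)
      (Set.subset_union_of_subset_left (Set.subset_iUnion (fun l => pushed (tm.m l)) l) _)
  choose d F hF hF' hd using h
  refine ⟨∑ l, d l, fun c => match c.1.l with
    | none => c
    | some l => F l c.1.v c.2, ?_, ?_, ?_⟩
  · exact PT.cases (sel := fun c : Ctl tm × Stacks tm => c.1) (g := fun k c => match k.l with
      | none => c
      | some l => F l k.v c.2) PT.fst (by
        rintro ⟨_ | l, v⟩
        · exact PT.id
        · exact (hF l v).comp PT.snd)
  · rintro ⟨⟨_ | l, v⟩, S⟩
    · rfl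
    · exact hF' l v S
  · rintro ⟨⟨_ | l, v⟩, S⟩
    · simp
    · have : d l ≤ ∑ l, d l := Finset.single_le_sum (fun _ _ => Nat.zero_le _) (Finset.mem_univ _)
      exact (hd l v S).trans (by simpa using this)

theorem Rep.size_cfg (c : Ctl tm × Stacks tm) : Rep.size c = 1 + Rep.size c.2 := by
  rw [Rep.size_prod, Rep.size_ofFinite]

/-- A letter of the input. -/
def inputLetter {A : Type} (e : tm.Γ tm.k₀ ≃ A) (a : A) : Letter tm tm.k₀ :=
  ⟨e.symm a, Set.mem_union_right _ ⟨_, rfl⟩⟩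

/-- The initial stacks for the input `x`. -/
def initStacks {A : Type} (e : tm.Γ tm.k₀ ≃ A) (x : List A) : Stacks tm :=
  Function.update (fun _ => []) tm.k₀ (x.map (inputLetter e))

theorem PT.initStacks {X A : Type} [Rep X] [Finite A] (e : tm.Γ tm.k₀ ≃ A) {x : X → List A}
    (hx : PT x) : PT (fun y => initStacks e (x y)) := by
  refine PT.update ?_ tm.k₀ (hx.map _)
  refine PT.intro (L := Unit) .skip (.const 1) fun x => ⟨1, le_rfl, (Run.skip _).of_eq ?_⟩
  funext i
  rcases i with i | i | i <;> simp [rep]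

theorem size_initStacks {A : Type} (e : tm.Γ tm.k₀ ≃ A) (x : List A) :
    Rep.size (initStacks e x) = x.length := by
  have := Stacks.size_update (tm := tm) (fun _ => []) tm.k₀
    (x.map (inputLetter e))
  rw [List.length_nil, List.length_map] at this
  rw [initStacks]
  have h0 : Rep.size (fun k => [] : Stacks tm) = 0 := by simp [Rep.size_pi]
  omega

theorem toCfg_init {A : Type} (e : tm.Γ tm.k₀ ≃ A) (x : List A) :
    toCfg (⟨some tm.main, tm.initialState⟩, initStacks e x) = initList tm (x.map e.symm) := by
  have : (initStacks e x).val = (initList tm (x.map e.symm)).stk := by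
    rw [initList_stk, initStacks, Stacks.val_update, List.map_map]
    rfl
  rw [toCfg, this]
  rfl

/-- `none` is absorbing, so a run of `n` steps that ends in a configuration never meets it. Making
the step function total therefore does not change the run. -/
theorem StepsTo.iterate {C : Type} {f : C → Option C} {n : ℕ} {a b : C} (h : StepsTo f n a b) :
    (fun c => (f c).getD c)^[n] a = b := by
  induction n generalizing a with
  | zero => simpa [StepsTo] using h
  | succ n ih =>
    rw [StepsTo, Function.iterate_succ_apply] at h
    rw [Function.iterate_succ_apply]
    cases hf : f a with
    | none =>
      have : (flip bind f)^[n] (none : Option C) = none :=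
        Function.iterate_fixed (f := flip bind f) rfl n
      simp [flip, hf] at h
      exact absurd (this.symm.trans h) (by simp)
    | some c =>
      simp only [flip, Option.bind_eq_bind, Option.bind_some, hf] at h
      exact ih h

/-- The total step function is iterated for the full time bound. Overshooting is harmless because a
halted configuration is fixed, and sizes stay polynomial because a step adds at most `d` letters. -/
theorem PolyTimeOnTuples.pt {A B : Type} [Finite A] [Finite B] {f : List (List A) → List B}
    (hf : PolyTimeOnTuples f) : PT f := by
  obtain ⟨⟨⟨tm, ein, eout⟩, time, hout⟩⟩ := hf
  obtain ⟨d, F, hF, hF', hd⟩ := exists_PT_step tm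
  have hsize : ∀ (i : ℕ) c, Rep.size (F^[i] c).2 ≤ Rep.size c.2 + i * d := by
    intro i
    induction i with
    | zero => simp
    | succ i ih =>
      intro c
      rw [Function.iterate_succ_apply, Nat.succ_mul]
      have := ih (F c)
      have := hd c
      omega
  have hcfg : ∀ (i : ℕ) c, toCfg (F^[i] c) = (fun c => (tm.step c).getD c)^[i] (toCfg c) := by
    intro i
    induction i with
    | zero => simp
    | succ i ih => intro c; rw [Function.iterate_succ_apply, Function.iterate_succ_apply, ih, hF']
  have hclock := PT.unary_eval time (PT.unary_length (PT.encode (PT.id (X := List (List A)))))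
  have hinit : PT (fun z : List (List A) => ((⟨some tm.main, tm.initialState⟩ : Ctl tm),
      initStacks ein (encodeTuple z))) :=
    (PT.const_fin _).pair (PT.initStacks ein (PT.encode PT.id))
  have hrun := PT.iterate hclock hinit hF (b := fun z => 1 + (Rep.size z +
    time.eval (Rep.size z) * d)) ((PBdd.const 1).add (PBdd.size.add
      ((PBdd.size.eval time).mul (.const d)))) (by
    intro z i hi
    rw [List.length_replicate] at hi
    rw [Rep.size_cfg]
    have := hsize i (⟨some tm.main, tm.initialState⟩, initStacks ein (encodeTuple z))
    rw [size_initStacks] at this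
    have h2 : i * d ≤ time.eval (encodeTuple z).length * d := Nat.mul_le_mul_right _ hi
    rw [Rep.size_tuple]
    omega)
  refine ((hrun.psnd.stack tm.k₁).map (fun g => eout g.val)).of_eq fun z => ?_
  obtain ⟨⟨n, hn⟩, hle⟩ := hout z
  change n ≤ _ at hle
  have h1 := StepsTo.iterate (f := tm.step) hn
  rw [List.length_replicate]
  obtain ⟨j, hj⟩ := Nat.exists_eq_add_of_le hle
  have h2 := hcfg (time.eval (encodeTuple z).length)
    (⟨some tm.main, tm.initialState⟩, initStacks ein (encodeTuple z))
  rw [toCfg_init, hj, Nat.add_comm n j, Function.iterate_add_apply _ j n (initList _ _)] at h2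
  rw [hj, Nat.add_comm n j]
  change _ = (fun c => (tm.step c).getD c)^[j] ((fun c => (tm.step c).getD c)^[n]
    (initList tm (List.map ein.invFun (encodeTuple z)))) at h2
  have h5 : ∀ y, (fun c => (tm.step c).getD c)^[j] (haltList tm y) = haltList tm y :=
    fun y => Function.iterate_fixed rfl j
  rw [h1, h5] at h2
  have h3 := congrArg (fun c => c.stk tm.k₁) h2
  simp only [haltList_stk, Function.update_self, toCfg, Stacks.val] at h3
  have h4 := congrArg (List.map eout) h3
  rw [List.map_map] at h4
  refine h4.trans ?_
  simp

end machine


open RationalProofs.Rep (Reg rep bound)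

/-! ### Simulating an oracle machine with claimed oracle answers -/

namespace OracleTM

variable {A : Type} (M : OracleTM A)

/-- The initial configuration on the input `x`. -/
def start (x : List A) : M.tm.Cfg := Turing.initList M.tm (x.map M.inputAlphabet.symm)

/-- One step, in which the claimed answer `β` replaces that of the oracle. -/
noncomputable def claimStep (β : Bool) (c : M.tm.Cfg) : M.tm.Cfg :=
  open Classical in
  if c.l = some M.queryLabel then { c with l := some (if β then M.yesLabel else M.noLabel) }
  else (M.tm.step c).getD c

/-- The configuration after as many steps as there are claims. -/
noncomputable def sim (x : List A) (βs : List Bool) : M.tm.Cfg :=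
  βs.foldl (fun c β => M.claimStep β c) (M.start x)

/-- The word on the query stack. -/
def query (c : M.tm.Cfg) : List A := (c.stk M.queryStack).map M.queryAlphabet

/-- The word on the output stack. -/
def output (c : M.tm.Cfg) : List A := (c.stk M.tm.k₁).map M.outputAlphabet

/-- The configuration after `n` steps with oracle `O`. -/
noncomputable def run (O : Language A) (x : List A) (n : ℕ) : M.tm.Cfg :=
  (fun c => (M.step O c).getD c)^[n] (M.start x)

theorem run_succ (O : Language A) (x : List A) (n : ℕ) :
    M.run O x (n + 1) = (M.step O (M.run O x n)).getD (M.run O x n) := by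
  rw [run, Function.iterate_succ_apply']
  rfl

theorem claimStep_eq (O : Language A) (β : Bool) (c : M.tm.Cfg)
    (h : c.l = some M.queryLabel → (β = true ↔ M.query c ∈ O)) :
    M.claimStep β c = (M.step O c).getD c := by
  classical
  by_cases hc : c.l = some M.queryLabel
  · have h₁ : M.claimStep β c = ⟨some (if β then M.yesLabel else M.noLabel), c.var, c.stk⟩ :=
      if_pos hc
    have h₂ : M.step O c =
        some ⟨some (if M.query c ∈ O then M.yesLabel else M.noLabel), c.var, c.stk⟩ := if_pos hc
    have h₃ : (if β = true then M.yesLabel else M.noLabel) =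
        if M.query c ∈ O then M.yesLabel else M.noLabel := by
      by_cases hq : M.query c ∈ O
      · rw [if_pos ((h hc).2 hq), if_pos hq]
      · rw [if_neg (fun hb => hq ((h hc).1 hb)), if_neg hq]
    rw [h₁, h₂, h₃]
    rfl
  · have h₁ : M.claimStep β c = (M.tm.step c).getD c := if_neg hc
    have h₂ : M.step O c = M.tm.step c := if_neg hc
    rw [h₁, h₂]

/-- Claims are indexed by steps, not by queries: a claim at a step that is not a query is ignored
padding, so only the claims at query steps have to be correct. -/
theorem sim_eq_run (O : Language A) (x : List A) (βs : List Bool) (n : ℕ) (hn : n ≤ βs.length)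
    (h : ∀ (i : ℕ) (hi : i < n), (M.run O x i).l = some M.queryLabel →
      (βs[i] = true ↔ M.query (M.run O x i) ∈ O)) : M.sim x (βs.take n) = M.run O x n := by
  induction n with
  | zero => rfl
  | succ n ih =>
    have ih' := ih (by omega) fun i hi => h i (by omega)
    rw [List.take_succ_eq_append_getElem (by omega), sim, List.foldl_append]
    change M.claimStep _ (M.sim x (βs.take n)) = _
    rw [ih', run_succ]
    exact M.claimStep_eq O _ _ (h n (by omega))

theorem run_eq_of_halted (O : Language A) (x : List A) {m n : ℕ} (hmn : m ≤ n)
    (h : (M.run O x m).l = none) : M.run O x n = M.run O x m := by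
  obtain ⟨j, rfl⟩ := Nat.exists_eq_add_of_le hmn
  induction j with
  | zero => rfl
  | succ j ih =>
    rw [← Nat.add_assoc, run_succ, ih (by omega)]
    have : M.step O (M.run O x m) = none := by
      generalize M.run O x m = c at h
      obtain ⟨l, v, S⟩ := c
      change l = none at h
      subst h
      simp [step, Turing.TM2.step]
      rfl
    rw [this]
    rfl

theorem claimStep_of_halted {β : Bool} {c : M.tm.Cfg} (h : c.l = none) : M.claimStep β c = c := by
  obtain ⟨l, v, S⟩ := c
  change l = none at h
  subst h
  simp [claimStep, Turing.TM2.step]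
  rfl

/-- Merlin may send more claims than the computation has steps; the surplus has no effect. -/
theorem sim_append_of_halted (x : List A) (βs βs' : List Bool) (h : (M.sim x βs).l = none) :
    M.sim x (βs ++ βs') = M.sim x βs := by
  induction βs' using List.reverseRecOn with
  | nil => rw [List.append_nil]
  | append_singleton l β ih =>
    rw [← List.append_assoc, sim, List.foldl_append]
    change M.claimStep β (M.sim x (βs ++ l)) = _
    rw [ih, M.claimStep_of_halted h]

theorem exists_halting_time {O : Language A} {x y : List A} {n : ℕ}
    (h : M.OutputsInTime O x y n) : ∃ T ≤ n, (M.run O x T).l = none ∧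
      M.output (M.run O x T) = y ∧ ∀ t < T, (M.run O x t).l ≠ none := by
  classical
  obtain ⟨⟨⟨s, hs⟩, hle⟩⟩ := h
  have h1 : M.run O x s = Turing.haltList M.tm (y.map M.outputAlphabet.symm) := StepsTo.iterate hs
  have hex : ∃ t, (M.run O x t).l = none := ⟨s, by rw [h1]; rfl⟩
  have hT := Nat.find_spec hex
  have hTs : Nat.find hex ≤ s := Nat.find_min' hex (by rw [h1]; rfl)
  refine ⟨Nat.find hex, hTs.trans hle, hT, ?_, fun t ht => Nat.find_min hex ht⟩
  rw [← M.run_eq_of_halted O x hTs hT, h1, output, haltList_stk, Function.update_self]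
  simp

variable [Finite A]

/-- With claims in place of an oracle, the simulation is a fold over the claims of one machine step
each. -/
theorem exists_PT_sim : ∃ (d : ℕ) (F : List A × List Bool → Ctl M.tm × Stacks M.tm), PT F ∧
    (∀ p, toCfg (F p) = M.sim p.1 p.2) ∧
    ∀ p, Rep.size (F p).2 ≤ p.1.length + p.2.length * d := by
  classical
  obtain ⟨d, F, hF, hF', hd⟩ := exists_PT_step M.tm
  let G : Bool → Ctl M.tm × Stacks M.tm → Ctl M.tm × Stacks M.tm := fun β c =>
    if c.1.l = some M.queryLabel then
      (⟨some (if β then M.yesLabel else M.noLabel), c.1.v⟩, c.2) else F c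
  have hG : ∀ β, PT (G β) := fun β => PT.cases (sel := fun c : Ctl M.tm × Stacks M.tm => c.1)
    (g := fun k c => if k.l = some M.queryLabel then
      ((⟨some (if β then M.yesLabel else M.noLabel), k.v⟩ : Ctl M.tm), c.2) else F c) PT.fst (by
        intro k
        by_cases hk : k.l = some M.queryLabel
        · simp only [hk, if_true]
          exact (PT.const_fin _).pair PT.snd
        · simp only [hk, if_false]
          exact hF)
  have hG' : ∀ β c, toCfg (G β c) = M.claimStep β (toCfg c) := by
    intro β c
    by_cases hc : c.1.l = some M.queryLabel
    · have hc' : (toCfg c).l = some M.queryLabel := hc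
      simp only [G, hc, claimStep, hc', if_true]
      rfl
    · have hc' : (toCfg c).l ≠ some M.queryLabel := hc
      simp only [G, hc, claimStep, hc', if_false]
      exact hF' c
  have hGd : ∀ β c, Rep.size (G β c).2 ≤ Rep.size c.2 + d := by
    intro β c
    by_cases hc : c.1.l = some M.queryLabel
    · simp [G, hc]
    · simpa only [G, hc, if_false] using hd c
  refine ⟨d, fun p => p.2.foldl (fun c β => G β c)
    (⟨some M.tm.main, M.tm.initialState⟩, initStacks M.inputAlphabet p.1), ?_, ?_, ?_⟩
  · refine PT.fold_of_growth (step := fun β _ c => G β c) PT.snd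
      ((PT.const_fin _).pair (PT.initStacks _ PT.fst)) (fun β => (hG β).comp PT.snd) (.const d)
      fun β x c => ?_
    rw [Rep.size_cfg, Rep.size_cfg]
    have := hGd β c
    omega
  · rintro ⟨x, βs⟩
    have : ∀ (βs : List Bool) c, toCfg (βs.foldl (fun c β => G β c) c) =
        βs.foldl (fun c β => M.claimStep β c) (toCfg c) := by
      intro βs
      induction βs with
      | nil => intro c; rfl
      | cons β βs ih => intro c; rw [List.foldl_cons, List.foldl_cons, ih, hG']
    rw [this, toCfg_init]
    rfl
  · rintro ⟨x, βs⟩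
    have : ∀ (βs : List Bool) c, Rep.size (βs.foldl (fun c β => G β c) c).2 ≤
        Rep.size c.2 + βs.length * d := by
      intro βs
      induction βs with
      | nil => simp
      | cons β βs ih =>
        intro c
        have h1 := ih (G β c)
        have h2 := hGd β c
        rw [List.foldl_cons, List.length_cons, Nat.succ_mul]
        omega
    refine (this βs _).trans ?_
    rw [size_initStacks]

section PT

variable {X : Type} [Rep X] {x : X → List A} {βs : X → List Bool}

theorem PT_label {F : Type} [Finite F] (g : Option M.tm.Λ → F) (hx : PT x) (hβ : PT βs) :
    PT (fun y => g (M.sim (x y) (βs y)).l) := by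
  obtain ⟨d, F, hF, hF', -⟩ := M.exists_PT_sim
  exact ((hF.comp (hx.pair hβ)).pfst.apply_fin fun k => g k.l).of_eq fun y =>
    congrArg (fun c : M.tm.Cfg => g c.l) (hF' _)

theorem PT_stack (hx : PT x) (hβ : PT βs) (k : M.tm.K) (g : M.tm.Γ k → A) :
    PT (fun y => ((M.sim (x y) (βs y)).stk k).map g) := by
  obtain ⟨d, F, hF, hF', -⟩ := M.exists_PT_sim
  refine (((hF.comp (hx.pair hβ)).psnd.stack k).map fun a => g a.val).of_eq fun y => ?_
  rw [← hF' (x y, βs y)]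
  simp only [toCfg, Stacks.val]
  rw [List.map_map]
  rfl

theorem PT_query (hx : PT x) (hβ : PT βs) : PT (fun y => M.query (M.sim (x y) (βs y))) :=
  M.PT_stack hx hβ _ _

theorem PT_output (hx : PT x) (hβ : PT βs) : PT (fun y => M.output (M.sim (x y) (βs y))) :=
  M.PT_stack hx hβ _ _

end PT

/-- The stacks grow by a constant per step. The bound holds for false claims as well, for which no
time bound of the machine is available. -/
theorem exists_length_query_le : ∃ d : ℕ, ∀ (x : List A) (βs : List Bool),
    (M.query (M.sim x βs)).length ≤ x.length + βs.length * d := by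
  obtain ⟨d, F, hF, hF', hd⟩ := M.exists_PT_sim
  refine ⟨d, fun x βs => le_trans ?_ (hd (x, βs))⟩
  rw [← hF' (x, βs), query, List.length_map]
  refine le_trans ?_ (Store.length_le_size (rep (F (x, βs)).2) M.queryStack)
  simp [toCfg, Stacks.val, rep]

end OracleTM

/-! ### Every language is polynomial-time Turing reducible to itself -/

/-- The oracle machine that asks for its input and outputs the answer. -/
@[reducible] noncomputable def selfReduction {A : Type} [Finite A] (bit : Bool ↪ A) :
    OracleTM A where
  tm := {
    K := Unit
    k₀ := ()
    k₁ := ()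
    Γ := fun _ => A
    Λ := Option Bool
    main := none
    σ := Option A
    initialState := none
    σFin := Fintype.ofFinite _
    Γk₀Fin := Fintype.ofFinite _
    m := fun l => match l with
      | none => .halt
      | some b => .pop () (fun _ a => a) (.branch Option.isSome (.goto fun _ => some b)
          (.push () (fun _ => bit b) .halt)) }
  inputAlphabet := Equiv.refl A
  outputAlphabet := Equiv.refl A
  queryStack := ()
  queryAlphabet := Equiv.refl A
  queryLabel := none
  yesLabel := some true
  noLabel := some false

/-- The query word is erased before the answer is written, since nothing else may remain on the
stack. The extra step is the pop that finds the stack empty; it also restores the initial internal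
state `none`. -/
theorem selfReduction_steps {A : Type} [Finite A] (bit : Bool ↪ A) (O : Language A) (b : Bool)
    (w : List A) : ∀ v : Option A, StepsTo ((selfReduction bit).step O) (w.length + 1)
      ⟨some (some b), v, fun _ => w⟩ ⟨none, none, fun _ => [bit b]⟩ := by
  induction w with
  | nil =>
    refine fun v => .one ?_
    simp [OracleTM.step, Turing.TM2.step, Turing.TM2.stepAux]
    exact congrArg (fun S => some (Turing.TM2.Cfg.mk _ _ S)) (funext fun _ => rfl)
  | cons a w ih =>
    intro v
    rw [List.length_cons, Nat.add_comm (w.length + 1)]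
    refine StepsTo.trans (.one ?_) (ih (some a))
    simp [OracleTM.step, Turing.TM2.step, Turing.TM2.stepAux]
    exact congrArg (fun S => some (Turing.TM2.Cfg.mk _ _ S)) (funext fun _ => rfl)

theorem polyTimeTuringReducible_refl {A : Type} [Finite A] (bit : Bool ↪ A) (S : Language A) :
    PolyTimeTuringReducible bit S S := by
  classical
  refine ⟨selfReduction bit, Polynomial.X + 2, fun x => ⟨⟨⟨1 + (x.length + 1), ?_⟩, ?_⟩⟩⟩
  · have h : StepsTo ((selfReduction bit).step S) (1 + (x.length + 1))
        ⟨some none, none, fun _ => x⟩ ⟨none, none, fun _ => [bit (decide (x ∈ S))]⟩ := by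
      refine StepsTo.trans (.one ?_) (selfReduction_steps bit S (decide (x ∈ S)) x none)
      by_cases hx : x ∈ S <;> simp [OracleTM.step, hx]
    have e₁ : Turing.initList (selfReduction bit).tm (x.map (selfReduction bit).inputAlphabet.symm) =
        ⟨some none, none, fun _ => x⟩ := by
      simp [Turing.initList]
      rfl
    have e₂ : Turing.haltList (selfReduction bit).tm
        ((charFun bit S x).map (selfReduction bit).outputAlphabet.symm) =
        ⟨none, none, fun _ => [bit (decide (x ∈ S))]⟩ := by
      simp [Turing.haltList, charFun]
      rfl
    rw [e₁, e₂]
    exact h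
  · simp
    omega


/-! ### Optimal values for an arbitrary terminal reward -/

theorem binaryValue_nonneg : ∀ w : List Bool, 0 ≤ binaryValue w
  | [] => le_rfl
  | b :: w => by
    have := binaryValue_nonneg w
    rw [binaryValue]
    split_ifs <;> linarith

theorem exists_int_binaryValue {L : ℕ} : ∀ {w : List Bool}, w.length ≤ L →
    ∃ z : ℤ, 2 ^ L * binaryValue w = z := by
  induction L with
  | zero =>
    intro w hw
    rw [List.eq_nil_of_length_eq_zero (Nat.le_zero.1 hw)]
    exact ⟨0, by simp [binaryValue]⟩
  | succ L ih =>
    rintro (_ | ⟨b, w⟩) hw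
    · exact ⟨0, by simp [binaryValue]⟩
    · obtain ⟨z, hz⟩ := ih (Nat.le_of_succ_le_succ hw)
      refine ⟨2 ^ (L + 1) * (if b then 1 else 0) + z, ?_⟩
      push_cast
      rw [binaryValue, ← hz]
      ring

/-- Prefixing zeros is how the composed protocol scales its rewards by powers of two. -/
theorem binaryValue_replicate_append (n : ℕ) (w : List Bool) :
    binaryValue (List.replicate n false ++ w) = binaryValue w / 2 ^ n := by
  induction n with
  | zero => simp
  | succ n ih =>
    rw [List.replicate_succ, List.cons_append, binaryValue, ih, pow_succ]
    simp only [Bool.false_eq_true, if_false]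
    ring

namespace Protocol

variable {A : Type} {k : ℕ} (P : Protocol A k) (bit : Bool ↪ A) (x : List A)

instance [Finite A] : Finite (P.Message x) := (List.finite_length_le A _).to_subtype

instance : Nonempty (P.Message x) := ⟨⟨[], Nat.zero_le _⟩⟩

theorem consistent_nil : P.consistent bit x [] = Finset.univ := by
  simp [consistent]

theorem mem_consistent_append {t : Transcript A} {m a : List A} {r : P.Coins x} :
    r ∈ P.consistent bit x (t ++ [(m, a)]) ↔
      r ∈ P.consistent bit x t ∧ a = P.answer bit x t m r := by
  simp only [consistent, Finset.mem_filter, Finset.mem_univ, true_and, List.length_append,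
    List.length_singleton]
  constructor
  · intro h
    refine ⟨fun i hi => ?_, ?_⟩
    · have := h i (by omega)
      rwa [List.getElem_append_left hi, List.take_append_of_le_length hi.le] at this
    · have := h t.length (by omega)
      rw [List.getElem_append_right le_rfl, List.take_left] at this
      simpa using this
  · rintro ⟨h, rfl⟩ i hi
    rcases Nat.lt_or_ge i t.length with hi' | hi'
    · rw [List.getElem_append_left hi', List.take_append_of_le_length hi'.le]
      exact h i hi'
    · obtain rfl : i = t.length := by omega
      rw [List.getElem_append_right le_rfl, List.take_left]
      simp

theorem consistent_append_answer_nonempty {t : Transcript A} {m : List A} {r : P.Coins x}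
    (hr : r ∈ P.consistent bit x t) :
    (P.consistent bit x (t ++ [(m, P.answer bit x t m r)])).Nonempty :=
  ⟨r, (P.mem_consistent_append bit x).2 ⟨hr, rfl⟩⟩

theorem card_mul_expectNext (F : Transcript A → ℝ) (t : Transcript A) (m : List A) :
    (P.consistent bit x t).card * P.expectNext bit x F t m =
      ∑ r ∈ P.consistent bit x t, F (t ++ [(m, P.answer bit x t m r)]) :=
  Finset.card_mul_expect _ _

/-- Group the coins by the answer they produce. Weighting values by the number of consistent coins
clears the denominators of the conditional expectations. -/
theorem card_mul_expectNext_eq_sum_image [DecidableEq A] (F : Transcript A → ℝ) (t : Transcript A)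
    (m : List A) : (P.consistent bit x t).card * P.expectNext bit x F t m =
      ∑ a ∈ (P.consistent bit x t).image (P.answer bit x t m),
        (P.consistent bit x (t ++ [(m, a)])).card * F (t ++ [(m, a)]) := by
  rw [card_mul_expectNext, ← Finset.sum_fiberwise_of_maps_to
    (fun r hr => Finset.mem_image_of_mem (P.answer bit x t m) hr)]
  refine Finset.sum_congr rfl fun a _ => ?_
  have h : P.consistent bit x (t ++ [(m, a)]) =
      (P.consistent bit x t).filter fun r => P.answer bit x t m r = a := by
    ext r
    rw [mem_consistent_append, Finset.mem_filter, eq_comm (a := a)]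
  rw [h, ← nsmul_eq_mul]
  refine Finset.sum_eq_card_nsmul fun r hr => ?_
  rw [(Finset.mem_filter.1 hr).2]

variable {P bit x} in
theorem expectNext_le {F G : Transcript A → ℝ} {t : Transcript A} {m : List A}
    (h : ∀ r ∈ P.consistent bit x t, F (t ++ [(m, P.answer bit x t m r)]) ≤
      G (t ++ [(m, P.answer bit x t m r)])) :
    P.expectNext bit x F t m ≤ P.expectNext bit x G t m :=
  Finset.expect_le_expect h

/-- Nonemptiness matters: the average over the empty set is `0`, which would lose the constant `c`.
-/
theorem expectNext_affine (c d : ℝ) (F : Transcript A → ℝ) {t : Transcript A} (m : List A)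
    (ht : (P.consistent bit x t).Nonempty) :
    P.expectNext bit x (fun t => c + d * F t) t m = c + d * P.expectNext bit x F t m := by
  rw [expectNext, Finset.expect_add_distrib, Finset.expect_const ht, ← Finset.mul_expect]
  rfl

/-- The maximal conditional expectation of the quantity `ρ` given the transcript `t`, when `n`
rounds remain to be played. -/
noncomputable def optGen (ρ : Transcript A → P.Coins x → ℝ) : ℕ → Transcript A → ℝ
  | 0, t => 𝔼 r ∈ P.consistent bit x t, ρ t r
  | n + 1, t => ⨆ m : P.Message x, P.expectNext bit x (optGen ρ n) t m.1

theorem optValue_eq_optGen (n : ℕ) :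
    P.optValue bit x n = P.optGen bit x (P.reward bit x) n := by
  induction n with
  | zero => rfl
  | succ n ih =>
    funext t
    rw [optValue, optGen, ih]

section

variable [Finite A] {P bit x} {ρ : Transcript A → P.Coins x → ℝ}

theorem expectNext_le_iSup (F : Transcript A → ℝ) (t : Transcript A) {m : List A}
    (hm : m.length ≤ P.msgLen.eval x.length) :
    P.expectNext bit x F t m ≤ ⨆ m : P.Message x, P.expectNext bit x F t m.1 :=
  le_ciSup (f := fun m : P.Message x => P.expectNext bit x F t m.1)
    (Set.finite_range _).bddAbove ⟨m, hm⟩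

variable (P bit x) in
theorem exists_expectNext_eq_iSup (F : Transcript A → ℝ) (t : Transcript A) :
    ∃ m : List A, m.length ≤ P.msgLen.eval x.length ∧
      P.expectNext bit x F t m = ⨆ m : P.Message x, P.expectNext bit x F t m.1 := by
  obtain ⟨m, hm⟩ := exists_eq_ciSup_of_finite (f := fun m : P.Message x => P.expectNext bit x F t m.1)
  exact ⟨m.1, m.2, hm⟩

theorem optGen_le {c : ℝ} {n : ℕ} {t : Transcript A} (ht : (P.consistent bit x t).Nonempty)
    (h : ∀ t', t <+: t' → ∀ r ∈ P.consistent bit x t', ρ t' r ≤ c) :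
    P.optGen bit x ρ n t ≤ c := by
  induction n generalizing t with
  | zero => exact Finset.expect_le ht (h t (List.prefix_refl _))
  | succ n ih =>
    refine ciSup_le fun m => Finset.expect_le ht fun r hr => ?_
    exact ih (P.consistent_append_answer_nonempty bit x hr) fun t' ht' =>
      h t' ((List.prefix_append _ _).trans ht')

theorem le_optGen {c : ℝ} {n : ℕ} {t : Transcript A} (ht : (P.consistent bit x t).Nonempty)
    (h : ∀ t', t <+: t' → t'.length = t.length + n → ∀ r ∈ P.consistent bit x t', c ≤ ρ t' r) :
    c ≤ P.optGen bit x ρ n t := by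
  induction n generalizing t with
  | zero => exact Finset.le_expect ht (h t (List.prefix_refl _) rfl)
  | succ n ih =>
    -- Any admissible message bounds the supremum from below; the empty one is always admissible.
    refine le_trans ?_ (expectNext_le_iSup (m := []) (P.optGen bit x ρ n) t (Nat.zero_le _))
    refine Finset.le_expect ht fun r hr => ?_
    exact ih (P.consistent_append_answer_nonempty bit x hr) fun t' ht' hl =>
      h t' ((List.prefix_append _ _).trans ht') (by rw [hl]; simp; omega)

/-- Maxima over the finitely many messages are attained, so the optimum equals the expectation for
one message. Multiplied by the number of consistent coins, this is a sum over answers of the same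
quantity one round later; so no denominator beyond that of the terminal rewards appears. -/
theorem exists_int_optGen {D : ℝ} (h : ∀ t r, t.length = k →
      (∀ p ∈ t, p.1.length ≤ P.msgLen.eval x.length) → ∃ z : ℤ, D * ρ t r = z)
    (n : ℕ) (t : Transcript A) (hn : t.length + n = k)
    (ht : ∀ p ∈ t, p.1.length ≤ P.msgLen.eval x.length) :
    ∃ z : ℤ, D * ((P.consistent bit x t).card * P.optGen bit x ρ n t) = z := by
  classical
  have hsum : ∀ {ι : Type} (s : Finset ι) (g : ι → ℝ), (∀ i ∈ s, ∃ z : ℤ, D * g i = z) →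
      ∃ z : ℤ, D * ∑ i ∈ s, g i = z := by
    intro ι s g hg
    choose! z hz using hg
    exact ⟨∑ i ∈ s, z i, by rw [Finset.mul_sum, Int.cast_sum]; exact Finset.sum_congr rfl hz⟩
  induction n generalizing t with
  | zero =>
    rw [optGen, Finset.card_mul_expect]
    exact hsum _ _ fun r _ => h t r hn ht
  | succ n ih =>
    obtain ⟨m, hm, hm'⟩ := exists_expectNext_eq_iSup P bit x (P.optGen bit x ρ n) t
    rw [optGen, ← hm', card_mul_expectNext_eq_sum_image]
    refine hsum _ _ fun a _ => ih _ (by simp; omega) ?_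
    intro p hp
    rcases List.mem_append.1 hp with hp | hp
    · exact ht p hp
    · rw [List.mem_singleton.1 hp]
      exact hm

end

/-- The reward for the computed value: `1/2` plus a quarter of the reward if it is `y`, and
nothing otherwise. -/
noncomputable def valueReward (y : List A) (t : Transcript A) (r : P.Coins x) : ℝ :=
  open Classical in
  if P.φ (x :: (words t).dropLast) = y then 1 / 2 + 1 / 4 * P.reward bit x t r else 0

/-! ### The price of a wrong value -/

section

variable [Finite A] {P bit x} {f : List A → List A} {y : List A} {n : ℕ} {t : Transcript A}

theorem reward_nonneg (r : P.Coins x) : 0 ≤ P.reward bit x t r := binaryValue_nonneg _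

theorem optGen_valueReward_le (ht : (P.consistent bit x t).Nonempty) :
    P.optGen bit x (P.valueReward bit x y) n t ≤ 1 / 2 + 1 / 4 * P.optValue bit x n t := by
  induction n generalizing t with
  | zero =>
    rw [optGen, optValue, Finset.mul_expect, ← Finset.expect_const ht (1 / 2 : ℝ),
      ← Finset.expect_add_distrib]
    refine Finset.expect_le_expect fun r _ => ?_
    have := reward_nonneg (bit := bit) (t := t) r
    rw [valueReward]
    split_ifs <;> linarith
  | succ n ih =>
    refine ciSup_le fun m => ?_
    calc _ ≤ P.expectNext bit x (fun t => 1 / 2 + 1 / 4 * P.optValue bit x n t) t m.1 :=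
          expectNext_le fun r hr => ih (P.consistent_append_answer_nonempty bit x hr)
      _ = 1 / 2 + 1 / 4 * P.expectNext bit x (P.optValue bit x n) t m.1 :=
          P.expectNext_affine bit x _ _ _ _ ht
      _ ≤ _ := by
        have := expectNext_le_iSup (P.optValue bit x n) (bit := bit) t m.2
        rw [optValue]
        linarith

theorem IsRational.append (h : P.IsRational bit x t) {m a : List A} (hn : t.length + (n + 1) = k)
    (hm : m.length ≤ P.msgLen.eval x.length)
    (hopt : P.expectNext bit x (P.optValue bit x n) t m = P.optValue bit x (n + 1) t) :
    P.IsRational bit x (t ++ [(m, a)]) := by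
  intro i hi
  rcases Nat.lt_or_ge i t.length with hi' | hi'
  · rw [List.getElem_append_left hi', List.take_append_of_le_length hi'.le]
    exact h i hi'
  · obtain rfl : i = t.length := by
      rw [List.length_append, List.length_singleton] at hi
      omega
    rw [List.getElem_append_right le_rfl, List.take_left]
    simp only [Nat.sub_self, List.getElem_cons_zero]
    obtain rfl : n = k - (t.length + 1) := by omega
    exact ⟨hm, fun m' => by rw [hopt]; exact expectNext_le_iSup _ _ m'.2⟩

/-- Rational play of `P` always produces `f x`, so along it the terminal reward is the affine image
of `R`. Hence the same play attains the upper bound of `optGen_valueReward_le`. -/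
theorem Computes.optGen_valueReward_eq (hP : P.Computes bit f) (hn : t.length + n = k)
    (ht : (P.consistent bit x t).Nonempty) (h : P.IsRational bit x t) :
    P.optGen bit x (P.valueReward bit x (f x)) n t = 1 / 2 + 1 / 4 * P.optValue bit x n t := by
  induction n generalizing t with
  | zero =>
    rw [optGen, optValue, Finset.mul_expect, ← Finset.expect_const ht (1 / 2 : ℝ),
      ← Finset.expect_add_distrib]
    refine Finset.expect_congr rfl fun r _ => ?_
    rw [valueReward, if_pos (hP x t hn ht h)]
  | succ n ih =>
    refine le_antisymm (optGen_valueReward_le ht) ?_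
    obtain ⟨m, hm, hm'⟩ := exists_expectNext_eq_iSup P bit x (P.optValue bit x n) t
    rw [optValue, ← hm', ← P.expectNext_affine bit x _ _ _ _ ht]
    refine le_trans (expectNext_le fun r hr => ?_) (expectNext_le_iSup _ t hm)
    exact (ih (by simp; omega) (P.consistent_append_answer_nonempty bit x hr)
      (h.append hn hm hm')).ge

/-- Consider a best message for the goal `y`. Either it is not rational in `P`, and the expectation
of `R` drops; or it is, and the argument continues with the next round. If play stays rational to
the end, the value is `f x`, not `y`, and the reward is `0`. -/
theorem Computes.optGen_valueReward_lt (hP : P.Computes bit f) (hy : y ≠ f x)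
    (hn : t.length + n = k) (ht : (P.consistent bit x t).Nonempty) (h : P.IsRational bit x t) :
    P.optGen bit x (P.valueReward bit x y) n t < 1 / 2 + 1 / 4 * P.optValue bit x n t := by
  induction n generalizing t with
  | zero =>
    have h0 : 0 ≤ P.optValue bit x 0 t := Finset.expect_nonneg fun r _ => reward_nonneg r
    have h1 : P.optGen bit x (P.valueReward bit x y) 0 t = 0 :=
      Finset.expect_eq_zero fun r _ => by
        rw [valueReward, if_neg]
        rw [hP x t hn ht h]
        exact hy.symm
    linarith
  | succ n ih =>
    obtain ⟨m, hm, hm'⟩ :=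
      exists_expectNext_eq_iSup P bit x (P.optGen bit x (P.valueReward bit x y) n) t
    have hle := expectNext_le_iSup (P.optValue bit x n) (bit := bit) t hm
    rw [optGen, ← hm']
    rcases hle.lt_or_eq with hlt | heq
    · calc _ ≤ P.expectNext bit x (fun t => 1 / 2 + 1 / 4 * P.optValue bit x n t) t m :=
            expectNext_le fun r hr =>
              optGen_valueReward_le (P.consistent_append_answer_nonempty bit x hr)
        _ = 1 / 2 + 1 / 4 * P.expectNext bit x (P.optValue bit x n) t m :=
            P.expectNext_affine bit x _ _ _ _ ht
        _ < _ := by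
          rw [optValue]
          linarith
    · rw [optValue, ← heq, ← P.expectNext_affine bit x _ _ _ _ ht]
      refine Finset.expect_lt_expect (fun r hr => ?_) ?_
      · exact (ih (by simp; omega) (P.consistent_append_answer_nonempty bit x hr)
          (h.append hn hm heq)).le
      · obtain ⟨r, hr⟩ := ht
        exact ⟨r, hr, ih (by simp; omega) (P.consistent_append_answer_nonempty bit x hr)
          (h.append hn hm heq)⟩

theorem isRational_nil : P.IsRational bit x [] := fun i hi => absurd hi (Nat.not_lt_zero i)

theorem exists_int_valueReward {L : ℕ} {r : P.Coins x}
    (hL : (P.R (x :: (List.zipWith (fun p s => [p.1, s]) t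
      (P.coinWords bit x r)).flatten)).length ≤ L) :
    ∃ z : ℤ, 2 ^ (L + 2) * P.valueReward bit x y t r = z := by
  rw [valueReward]
  split_ifs with h
  · obtain ⟨z, hz⟩ := exists_int_binaryValue hL
    refine ⟨2 ^ (L + 1) + z, ?_⟩
    push_cast
    rw [reward, ← hz]
    ring
  · exact ⟨0, by simp⟩

/-- A wrong value costs Merlin a noticeable amount. -/
theorem Computes.optGen_valueReward_add_le (hP : P.Computes bit f) (hy : y ≠ f x) {L : ℕ}
    (hL : ∀ (t : Transcript A) (r : P.Coins x), t.length = k →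
      (∀ p ∈ t, p.1.length ≤ P.msgLen.eval x.length) →
      (P.R (x :: (List.zipWith (fun p s => [p.1, s]) t (P.coinWords bit x r)).flatten)).length ≤ L) :
    P.optGen bit x (P.valueReward bit x y) k [] +
        (1 / 2) ^ (L + 2 + k * P.randLen.eval x.length) ≤
      P.optGen bit x (P.valueReward bit x (f x)) k [] := by
  have ht : (P.consistent bit x []).Nonempty := by
    rw [consistent_nil]
    exact Finset.univ_nonempty
  have hlt := hP.optGen_valueReward_lt hy (Nat.zero_add k) ht isRational_nil
  rw [← hP.optGen_valueReward_eq (Nat.zero_add k) ht isRational_nil] at hlt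
  obtain ⟨z, hz⟩ := exists_int_optGen (D := 2 ^ (L + 2)) (ρ := P.valueReward bit x y) (bit := bit)
    (fun t r h₁ h₂ => exists_int_valueReward (hL t r h₁ h₂)) k [] (Nat.zero_add k) (by simp)
  obtain ⟨z', hz'⟩ := exists_int_optGen (D := 2 ^ (L + 2)) (ρ := P.valueReward bit x (f x))
    (bit := bit)
    (fun t r h₁ h₂ => exists_int_valueReward (hL t r h₁ h₂)) k [] (Nat.zero_add k) (by simp)
  have hcard : ((P.consistent bit x []).card : ℝ) = 2 ^ (k * P.randLen.eval x.length) := by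
    rw [consistent_nil, Finset.card_univ]
    simp [← pow_mul, mul_comm]
  rw [hcard, ← mul_assoc, ← pow_add] at hz hz'
  set N := L + 2 + k * P.randLen.eval x.length
  have hN : (0 : ℝ) < 2 ^ N := by positivity
  -- Multiplied by `2 ^ N`, both optima are integers, so the strict inequality becomes a gap of at
  -- least one unit. Here `N` accounts for the denominator of the rewards and for the number `2 ^ (k
  -- * randLen)` of coin outcomes.
  have hzz : z + 1 ≤ z' := by
    refine Int.add_one_le_iff.2 ?_
    rw [← Int.cast_lt (R := ℝ), ← hz, ← hz']
    exact mul_lt_mul_of_pos_left hlt hN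
  rw [← mul_le_mul_iff_right₀ hN, mul_add, hz, hz', ← mul_pow]
  norm_num
  exact_mod_cast hzz

end

end Protocol


namespace Protocol

/-! ### Playing one protocol inside another -/

/-- The messages and answers of a transcript, translated. -/
def mapTranscript {A : Type} (μ η : List A → List A) (t : Transcript A) : Transcript A :=
  t.map fun p => (μ p.1, η p.2)

/-- Once Merlin has opened the game `P'` on `x'` with the message `m₁`, and Arthur's coins lie in
`E`, the game `P` on `x` is played with the terminal reward `ρ`, scaled by `w`: messages are read
through `μ`, answers through `η`, and coins through `π`. Answers that are `good` reveal that the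
coins lie in `E`. -/
structure Embeds {A : Type} {k : ℕ} (P' : Protocol A k) (P : Protocol A k) (bit : Bool ↪ A)
    (x' x m₁ : List A) (E : Finset (P'.Coins x')) (π : P'.Coins x' → P.Coins x)
    (μ η : List A → List A) (good : List A → Prop) (w : ℝ) (ρ : Transcript A → P.Coins x → ℝ) :
    Prop where
  w_nonneg : 0 ≤ w
  fiber : ∃ N, 0 < N ∧ ∀ s, (E.filter fun r => π r = s).card = N
  length_μ : ∀ m, (μ m).length ≤ P.msgLen.eval x.length
  exists_μ : ∀ m : List A, m.length ≤ P.msgLen.eval x.length →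
    ∃ m' : List A, m'.length ≤ P'.msgLen.eval x'.length ∧ μ m' = m
  injOn : ∀ a b, good a → good b → η a = η b → a = b
  good_answer : ∀ t m r, t.length < k → (t.map Prod.fst).headD m = m₁ → r ∈ E →
    good (P'.answer bit x' t m r)
  answer : ∀ t m r, t.length < k → (t.map Prod.fst).headD m = m₁ → r ∈ E →
    η (P'.answer bit x' t m r) = P.answer bit x (mapTranscript μ η t) (μ m) (π r)
  not_good : ∀ t m r, t.length < k → (t.map Prod.fst).headD m = m₁ → r ∉ E →
    ¬ good (P'.answer bit x' t m r)
  reward : ∀ t r, t.length = k → (t.map Prod.fst).head? = some m₁ → r ∈ E →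
    π r ∈ P.consistent bit x (mapTranscript μ η t) →
    P'.reward bit x' t r = w * ρ (mapTranscript μ η t) (π r)

namespace Embeds

variable {A : Type} {k : ℕ} {P' P : Protocol A k} {bit : Bool ↪ A} {x' x m₁ : List A}
  {E : Finset (P'.Coins x')} {π : P'.Coins x' → P.Coins x} {μ η : List A → List A}
  {good : List A → Prop} {w : ℝ} {ρ : Transcript A → P.Coins x → ℝ}

/-- `η` is injective on good answers, and on `E` Arthur's answers are good. So an answer in the
large game is reproduced exactly when its translation is reproduced in the small one. -/
theorem mem_consistent (h : Embeds P' P bit x' x m₁ E π μ η good w ρ) {t : Transcript A}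
    {m : List A} (ht : t.length ≤ k) (hm : (t.map Prod.fst).headD m = m₁)
    (hg : ∀ p ∈ t, good p.2) {r : P'.Coins x'} (hr : r ∈ E) :
    r ∈ P'.consistent bit x' t ↔ π r ∈ P.consistent bit x (mapTranscript μ η t) := by
  induction t using List.reverseRecOn generalizing m with
  | nil => simp [mapTranscript, consistent_nil]
  | append_singleton t p ih =>
    obtain ⟨m', a⟩ := p
    rw [List.length_append, List.length_singleton] at ht
    have hm' : (t.map Prod.fst).headD m' = m₁ := by
      rw [← hm]
      cases t <;> simp
    have hga : good a := hg _ (List.mem_append_right _ (List.mem_singleton_self _))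
    rw [mem_consistent_append, mapTranscript, List.map_append, List.map_singleton,
      mem_consistent_append, ih (by omega) hm' fun p hp => hg p (List.mem_append_left _ hp)]
    refine and_congr_right fun _ => ?_
    have ha := h.answer t m' r (by omega) hm' hr
    constructor
    · rintro rfl
      exact ha
    · intro he
      exact h.injOn _ _ hga (h.good_answer t m' r (by omega) hm' hr) (he.trans ha.symm)

/-- One good answer already reveals that the coins lie in `E`; this is why the transcript must be
nonempty. -/
theorem consistent_subset (h : Embeds P' P bit x' x m₁ E π μ η good w ρ) {t : Transcript A}
    (ht : t.length ≤ k) (hm : (t.map Prod.fst).head? = some m₁) (hg : ∀ p ∈ t, good p.2)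
    {r : P'.Coins x'} (hr : r ∈ P'.consistent bit x' t) : r ∈ E := by
  rcases t.eq_nil_or_concat' with rfl | ⟨t, ⟨m, a⟩, rfl⟩
  · simp at hm
  · rw [List.length_append, List.length_singleton] at ht
    have hm' : (t.map Prod.fst).headD m = m₁ := by
      cases t <;> simpa using hm
    rw [mem_consistent_append] at hr
    by_contra hE
    refine h.not_good t m r (by omega) hm' hE ?_
    rw [← hr.2]
    exact hg _ (List.mem_append_right _ (List.mem_singleton_self _))

/-- All fibers of `π` in `E` have the same size, so `π` carries the uniform distribution on `E` to
the uniform distribution on the coins of `P`, and this persists after conditioning on the coins in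
`C`. -/
theorem sum_comp_eq {N : ℕ} {F : Finset (P'.Coins x')} {C : Finset (P.Coins x)}
    (hN : ∀ s, (E.filter fun r => π r = s).card = N) (hF : ∀ r, r ∈ F ↔ r ∈ E ∧ π r ∈ C)
    (g : P.Coins x → ℝ) : ∑ r ∈ F, g (π r) = N * ∑ s ∈ C, g s := by
  classical
  rw [← Finset.sum_fiberwise_of_maps_to (t := C) (g := π) fun r hr => ((hF r).1 hr).2,
    Finset.mul_sum]
  refine Finset.sum_congr rfl fun s hs => ?_
  have : F.filter (fun r => π r = s) = E.filter fun r => π r = s := by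
    ext r
    simp only [Finset.mem_filter, hF]
    constructor
    · exact fun h => ⟨h.1.1, h.2⟩
    · exact fun h => ⟨⟨h.1, h.2 ▸ hs⟩, h.2⟩
  rw [this, ← hN s, ← nsmul_eq_mul]
  exact Finset.sum_eq_card_nsmul fun r hr => by rw [(Finset.mem_filter.1 hr).2]

theorem expect_comp_eq {N : ℕ} {F : Finset (P'.Coins x')} {C : Finset (P.Coins x)} (hN0 : 0 < N)
    (hN : ∀ s, (E.filter fun r => π r = s).card = N) (hF : ∀ r, r ∈ F ↔ r ∈ E ∧ π r ∈ C)
    (g : P.Coins x → ℝ) : 𝔼 r ∈ F, g (π r) = 𝔼 s ∈ C, g s := by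
  have hcard := sum_comp_eq hN hF fun _ => (1 : ℝ)
  simp only [Finset.sum_const, nsmul_eq_mul, mul_one] at hcard
  have hN0' : (N : ℝ) ≠ 0 := by positivity
  rw [Finset.expect_eq_sum_div_card, Finset.expect_eq_sum_div_card, sum_comp_eq hN hF, hcard,
    mul_div_mul_left _ _ hN0']

theorem mem_iff (h : Embeds P' P bit x' x m₁ E π μ η good w ρ) {t : Transcript A}
    (ht : t.length ≤ k) (hm : (t.map Prod.fst).head? = some m₁) (hg : ∀ p ∈ t, good p.2)
    (r : P'.Coins x') : r ∈ P'.consistent bit x' t ↔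
      r ∈ E ∧ π r ∈ P.consistent bit x (mapTranscript μ η t) := by
  have hm' : (t.map Prod.fst).headD [] = m₁ := by
    rw [List.headD_eq_head?_getD, hm]
    rfl
  constructor
  · intro hr
    have hE := h.consistent_subset ht hm hg hr
    exact ⟨hE, (h.mem_consistent ht hm' hg hE).1 hr⟩
  · rintro ⟨hE, hr⟩
    exact (h.mem_consistent ht hm' hg hE).2 hr

/-- Backward induction. Once a good answer has been seen, the conditional distribution of the coins
is that of `P`; and since `μ` maps admissible messages onto the admissible messages of `P`, the two
maxima agree. -/
theorem optValue_eq (h : Embeds P' P bit x' x m₁ E π μ η good w ρ) (n : ℕ) {t : Transcript A}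
    (ht : t.length + n = k) (hm : (t.map Prod.fst).head? = some m₁) (hg : ∀ p ∈ t, good p.2) :
    P'.optValue bit x' n t = w * P.optGen bit x ρ n (mapTranscript μ η t) := by
  obtain ⟨N, hN0, hN⟩ := h.fiber
  induction n generalizing t with
  | zero =>
    have hF := h.mem_iff ht.le hm hg
    rw [optValue, optGen, Finset.mul_expect, ← expect_comp_eq hN0 hN hF]
    exact Finset.expect_congr rfl fun r hr => h.reward t r ht hm ((hF r).1 hr).1 ((hF r).1 hr).2
  | succ n ih =>
    have hF := h.mem_iff (by omega) hm hg
    have key : ∀ m : List A, P'.expectNext bit x' (P'.optValue bit x' n) t m =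
        w * P.expectNext bit x (P.optGen bit x ρ n) (mapTranscript μ η t) (μ m) := by
      intro m
      have hm' : (t.map Prod.fst).headD m = m₁ := by
        rw [List.headD_eq_head?_getD, hm]
        rfl
      rw [expectNext, expectNext, Finset.mul_expect, ← expect_comp_eq hN0 hN hF]
      refine Finset.expect_congr rfl fun r hr => ?_
      have hE := ((hF r).1 hr).1
      rw [ih (by simp; omega) (by rw [List.map_append, List.head?_append, hm]; rfl), mapTranscript,
        List.map_append, List.map_singleton, h.answer t m r (by omega) hm' hE]
      · rfl
      · intro p hp
        rcases List.mem_append.1 hp with hp | hp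
        · exact hg p hp
        · rw [List.mem_singleton.1 hp]
          exact h.good_answer t m r (by omega) hm' hE
    rw [optValue, optGen, Real.mul_iSup_of_nonneg h.w_nonneg]
    simp only [key]
    have hsurj : Function.Surjective
        (fun m : P'.Message x' => (⟨μ m.1, h.length_μ m.1⟩ : P.Message x)) := by
      rintro ⟨m, hm⟩
      obtain ⟨m', hm', rfl⟩ := h.exists_μ m hm
      exact ⟨⟨m', hm'⟩, rfl⟩
    exact hsurj.iSup_comp fun m : P.Message x =>
      w * P.expectNext bit x (P.optGen bit x ρ n) (mapTranscript μ η t) m.1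

/-- When sending `m₁`, Merlin does not yet know that the coins lie in `E`. So the first message of
`P` is fixed as `μ m₁`, and only the later ones are optimized. -/
theorem sum_optValue_eq (h : Embeds P' P bit x' x m₁ E π μ η good w ρ) {n : ℕ} (hn : n + 1 = k) :
    ∑ r ∈ E, P'.optValue bit x' n [(m₁, P'.answer bit x' [] m₁ r)] =
      E.card * (w * P.expectNext bit x (P.optGen bit x ρ n) [] (μ m₁)) := by
  obtain ⟨N, hN0, hN⟩ := h.fiber
  have hE : ∀ r, r ∈ E ↔ r ∈ E ∧ π r ∈ P.consistent bit x [] := by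
    simp [consistent_nil]
  have hcard := sum_comp_eq hN hE fun _ => (1 : ℝ)
  simp only [Finset.sum_const, nsmul_eq_mul, mul_one] at hcard
  rw [hcard, mul_assoc, mul_left_comm _ w, card_mul_expectNext, Finset.mul_sum,
    ← sum_comp_eq hN hE]
  refine Finset.sum_congr rfl fun r hr => ?_
  rw [h.optValue_eq n (by simp; omega) rfl, mapTranscript, List.map_singleton,
    h.answer [] m₁ r (by simp; omega) rfl hr]
  · rfl
  · intro p hp
    rw [List.mem_singleton.1 hp]
    exact h.good_answer [] m₁ r (by simp; omega) rfl hr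

end Embeds

end Protocol


open RationalProofs.Rep (Reg rep bound)

/-! ### The composed protocol

Merlin's first message claims all oracle answers and contains, for each step of the oracle machine,
a first message for the protocol that decides the oracle. The number `j` of leading zeros of
Arthur's first random string selects the step that is checked, and step `j` carries a much larger
weight than all later steps together. -/

namespace Composition

variable {A : Type} (bit : Bool ↪ A) (M : OracleTM A) {n : ℕ} (P : Protocol A (n + 1))

/-- The leading zeros. -/
noncomputable def lead (r : List A) : List A :=
  open Classical in r.takeWhile fun a => decide (a = bit false)

/-- The claim contained in one component of Merlin's first message. -/
noncomputable def claim (w : List A) : Bool :=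
  open Classical in decide (w.head? = some (bit true))

/-- The oracle answers claimed by Merlin's first message. -/
noncomputable def claims (m : List A) : List Bool := (unpack bit m).map (claim bit)

/-- The configuration that is checked, when Arthur's random string has the leading zeros `u`. -/
noncomputable def cfg (x m u : List A) : M.tm.Cfg := M.sim x ((claims bit m).take u.length)

/-- The query that is checked. -/
noncomputable def qry (x m u : List A) : List A := M.query (cfg bit M x m u)

/-- The message for the protocol `P` on the query `q`. -/
noncomputable def subMsg (q u m : List A) : List A :=
  ((unpack bit m).getD u.length []).tail.take (P.msgLen.eval q.length)

/-- The answer of the protocol `P`. -/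
noncomputable def subAns (a : List A) : List A :=
  open Classical in (a.dropWhile fun a => decide (a = bit false)).tail

/-- The random string for the protocol `P` on the query `q`. -/
noncomputable def subCoin (q u r : List A) : List A :=
  (r.drop (u.length + 1)).take (P.randLen.eval q.length)

/-- Arthur's answer in round `i + 1`. -/
noncomputable def roundAnswer (z : List (List A)) (i : ℕ) : List A :=
  -- In round `i + 1` the tuple is `x, m₁, a₁, …, mᵢ₊₁, r₁, …, rᵢ₊₁`, so component `2 * i + 2` is
  -- `r₁`.
  let u := lead bit (z.getD (2 * i + 2) [])
  let q := qry bit M (z.getD 0 []) (z.getD 1 []) u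
  -- The prefix, `j` zeros and a one, tells Merlin which step is being checked.
  u ++ bit true :: P.V (q :: ((List.range i).flatMap (fun s =>
    [subMsg bit P q u (z.getD (2 * s + 1) []), subAns bit (z.getD (2 * s + 2) [])]) ++
      [subMsg bit P q u (z.getD (2 * i + 1) [])] ++
      (List.range (i + 1)).map fun s => subCoin P q u (z.getD (2 * i + 2 + s) [])))

/-- Arthur's answer in any round. -/
noncomputable def answerFun (z : List (List A)) : List A :=
  (List.range (n + 1)).foldr
    -- The round is recognized by the number of words: one input, `2 * i + 1` messages and answers,
    -- `i + 1` random strings.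
    (fun i a => if z.length = 3 * i + 3 then roundAnswer bit M P z i else a) []

/-- The messages and answers of the first `s` rounds, when Merlin sends `ms` and Arthur has the
random strings `cs`. -/
def interaction (V : List (List A) → List A) (q : List A) (ms cs : ℕ → List A) :
    ℕ → List (List A)
  | 0 => []
  | s + 1 => interaction V q ms cs s ++
      [ms s, V (q :: (interaction V q ms cs s ++ [ms s] ++ (List.range (s + 1)).map cs))]

/-- The reward for a correct claim at a query. -/
noncomputable def queryReward (q : List A) (β : Bool) (ms cs : ℕ → List A) : List Bool :=
  open Classical in
  -- The value function of `P` reads Arthur's answers, which a reward function is not given; they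
  -- are recomputed from messages and coins.
  if decide (P.φ (q :: (interaction P.V q ms cs n ++ [ms n])) = [bit β]) then
    -- In binary this prefix turns a reward `R` into `1/2 + R/4`.
    [false, true] ++ P.R (q :: (List.range (n + 1)).flatMap fun s => [ms s, cs s])
  else []

/-- The reward before scaling. -/
noncomputable def levelReward (z : List (List A)) : List Bool :=
  -- Here the tuple is `x, m₁, r₁, m₂, r₂, …`, so `r₁` is component `2`.
  let u := lead bit (z.getD 2 [])
  let q := qry bit M (z.getD 0 []) (z.getD 1 []) u
  open Classical in
  if ((unpack bit (z.getD 1 [])).drop u.length).isEmpty then []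
  else if decide ((cfg bit M (z.getD 0 []) (z.getD 1 []) u).l = some M.queryLabel) then
    queryReward bit P q (claim bit ((unpack bit (z.getD 1 [])).getD u.length []))
      (fun s => subMsg bit P q u (z.getD (2 * s + 1) []))
      fun s => subCoin P q u (z.getD (2 * s + 2) [])
  else [false, true]

/-- The reward function of the composed protocol. -/
noncomputable def rewardFun (z : List (List A)) : List Bool :=
  -- One block of `N` zeros for each of the `j` leading zeros, where `N` is the length of `r₁`: the
  -- reward is multiplied by `2^(-jN)`.
  ((lead bit (z.getD 2 [])).flatMap fun _ => (z.getD 2 []).map fun _ => false) ++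
    levelReward bit M P z

/-- The value function of the composed protocol. -/
noncomputable def valueFun (z : List (List A)) : List A :=
  M.output (M.sim (z.getD 0 []) (claims bit (z.getD 1 [])))

/-! ### The composed functions are computable in polynomial time -/

section PT

variable [Finite A] {bit M P} {X : Type} [Rep X] {x m u q r a : X → List A}

theorem PT_lead (hr : PT r) : PT (fun y => lead bit (r y)) := hr.takeWhile _

theorem PT_claim : PT (claim bit) := by
  classical
  exact (PT.id.head?.apply_fin fun o : Option A => decide (o = some (bit true))).of_eq fun w => rfl

theorem PT_claims (hm : PT m) : PT (fun y => claims bit (m y)) :=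
  PT.tuple_map _ PT_claim (PT.unpack bit hm)

theorem PT_qry (hx : PT x) (hm : PT m) (hu : PT u) : PT (fun y => qry bit M (x y) (m y) (u y)) :=
  M.PT_query hx (PT.take hu (PT_claims hm))

theorem PT_take_eval (p : Polynomial ℕ) (hq : PT q) (ha : PT a) :
    PT (fun y => (a y).take (p.eval (q y).length)) :=
  (PT.take (PT.unary_eval p (PT.unary_length hq)) ha).of_eq fun y => by rw [List.length_replicate]

theorem PT_subMsg (hq : PT q) (hu : PT u) (hm : PT m) :
    PT (fun y => subMsg bit P (q y) (u y) (m y)) :=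
  PT_take_eval _ hq (PT.tuple_getD hu (PT.unpack bit hm)).tail

theorem PT_subAns (ha : PT a) : PT (fun y => subAns bit (a y)) := (ha.dropWhile _).tail

theorem PT_subCoin (hq : PT q) (hu : PT u) (hr : PT r) :
    PT (fun y => subCoin P (q y) (u y) (r y)) :=
  (PT_take_eval _ hq (PT.drop hu hr).tail).of_eq fun y => by rw [List.tail_drop]; rfl

theorem PT_roundAnswer (i : ℕ) : PT (fun z => roundAnswer bit M P z i) := by
  have hget : ∀ i, PT fun z : List (List A) => z.getD i [] := PT.id.tuple_getD_const
  have hu := PT_lead (bit := bit) (hget (2 * i + 2))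
  have hq := PT_qry (bit := bit) (M := M) (hget 0) (hget 1) hu
  refine hu.append ((P.V_polyTime.pt.comp (PT.tuple_cons hq (PT.tuple_append (PT.tuple_append
    (PT.tuple_flatMap_const _ fun s _ => ?_) (.tuple_cons ?_ .tuple_nil))
    (PT.tuple_map_const _ fun s _ => ?_)))).cons_const (bit true))
  · exact .tuple_cons (PT_subMsg hq hu (hget _)) (.tuple_cons (PT_subAns (hget _)) .tuple_nil)
  · exact PT_subMsg hq hu (hget _)
  · exact PT_subCoin hq hu (hget _)

theorem PT_answerFun : PT (answerFun bit M P) := by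
  have : ∀ L : List ℕ, PT fun z : List (List A) => L.foldr
      (fun i a => if z.length = 3 * i + 3 then roundAnswer bit M P z i else a) [] := by
    intro L
    induction L with
    | nil => exact .nil
    | cons i L ih =>
      exact ((PT.id.tuple_length_eq (3 * i + 3)).ite (PT_roundAnswer (bit := bit) (M := M) (P := P) i) ih).of_eq fun z => by
        simp
  exact this _

theorem PT_interaction {V : List (List A) → List A} (hV : PT V) {ms cs : X → ℕ → List A}
    (hq : PT q) (hms : ∀ s, PT fun y => ms y s) (hcs : ∀ s, PT fun y => cs y s) (s : ℕ) :
    PT (fun y => interaction V (q y) (ms y) (cs y) s) := by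
  induction s with
  | zero => exact .tuple_nil
  | succ s ih =>
    exact .tuple_append ih (.tuple_cons (hms s) (.tuple_cons (hV.comp (.tuple_cons hq
      (.tuple_append (.tuple_append ih (.tuple_cons (hms s) .tuple_nil))
        (.tuple_map_const _ fun s _ => hcs s)))) .tuple_nil))

theorem PT_queryReward {ms cs : X → ℕ → List A} {β : X → Bool} (hq : PT q) (hβ : PT β)
    (hms : ∀ s, PT fun y => ms y s) (hcs : ∀ s, PT fun y => cs y s) :
    PT (fun y => queryReward bit P (q y) (β y) (ms y) (cs y)) := by
  classical
  refine PT.cases (g := fun β y => queryReward bit P (q y) β (ms y) (cs y)) hβ fun β => ?_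
  refine PT.ite (PT.eq_singleton (bit β) (P.φ_polyTime.pt.comp (.tuple_cons hq (.tuple_append
    (PT_interaction P.V_polyTime.pt hq hms hcs n) (.tuple_cons (hms n) .tuple_nil))))) ?_ .nil
  exact (PT.const_list _).append (P.R_polyTime.pt.comp (.tuple_cons hq
    (.tuple_flatMap_const _ fun s _ => .tuple_cons (hms s) (.tuple_cons (hcs s) .tuple_nil))))

theorem PT_rewardFun : PT (rewardFun bit M P) := by
  classical
  have hget : ∀ i, PT fun z : List (List A) => z.getD i [] := PT.id.tuple_getD_const
  have hu := PT_lead (bit := bit) (hget 2)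
  have hq := PT_qry (bit := bit) (M := M) (hget 0) (hget 1) hu
  have hm := PT.unpack bit (hget 1)
  refine (hu.flatMap fun _ => (hget 2).map _).append
    (PT.ite (PT.tuple_head? (PT.tuple_drop hu hm)) .nil (PT.ite
      (M.PT_label (fun l => decide (l = some M.queryLabel)) (hget 0) (PT.take hu (PT_claims (hget 1))))
      ?_ (PT.const_list _)))
  exact PT_queryReward hq (PT_claim.comp (PT.tuple_getD hu hm))
    (fun s => PT_subMsg hq hu (hget _)) fun s => PT_subCoin hq hu (hget _)

theorem PT_valueFun : PT (valueFun bit M) :=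
  M.PT_output (PT.id.tuple_getD_const 0) (PT_claims (PT.id.tuple_getD_const 1))

end PT

variable {bit M P}

theorem binaryValue_levelReward_le (z : List (List A)) :
    binaryValue (levelReward bit M P z) ≤ 3 / 4 := by
  simp only [levelReward, queryReward]
  split_ifs
  · norm_num [binaryValue]
  · have := P.R_le_one (qry bit M (z.getD 0 []) (z.getD 1 []) (lead bit (z.getD 2 [])) ::
      (List.range (n + 1)).flatMap fun s =>
        [subMsg bit P (qry bit M (z.getD 0 []) (z.getD 1 []) (lead bit (z.getD 2 [])))
          (lead bit (z.getD 2 [])) (z.getD (2 * s + 1) []),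
        subCoin P (qry bit M (z.getD 0 []) (z.getD 1 []) (lead bit (z.getD 2 [])))
          (lead bit (z.getD 2 [])) (z.getD (2 * s + 2) [])])
    simp only [List.cons_append, List.nil_append, binaryValue, Bool.false_eq_true, if_false, if_true]
    linarith
  · norm_num [binaryValue]
  · norm_num [binaryValue]

theorem binaryValue_rewardFun (z : List (List A)) : binaryValue (rewardFun bit M P z) =
    binaryValue (levelReward bit M P z) /
      2 ^ ((lead bit (z.getD 2 [])).length * (z.getD 2 []).length) := by
  have : ((lead bit (z.getD 2 [])).flatMap fun _ => (z.getD 2 []).map fun _ => false) =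
      List.replicate ((lead bit (z.getD 2 [])).length * (z.getD 2 []).length) false := by
    rw [List.eq_replicate_iff]
    simp [List.length_flatMap]
  rw [rewardFun, this, binaryValue_replicate_append]

variable (bit M P)

/-- The composed protocol, for an oracle machine that runs in time `time` and asks queries of
length at most `query`, and a bound `rewardLen` for the length of the rewards of `P`. -/
noncomputable def protocol [Finite A] (time query rewardLen : Polynomial ℕ) :
    Protocol A (n + 1) where
  V := answerFun bit M P
  R := rewardFun bit M P
  φ := valueFun bit M
  V_polyTime := have : Nonempty A := ⟨bit true⟩; PT_answerFun.polyTimeOnTuples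
  R_polyTime := PT_rewardFun.polyTimeOnTuples
  φ_polyTime := have : Nonempty A := ⟨bit true⟩; PT_valueFun.polyTimeOnTuples
  R_le_one z := by
    rw [binaryValue_rewardFun]
    refine (div_le_self (binaryValue_nonneg _) (one_le_pow₀ one_le_two)).trans ?_
    exact (binaryValue_levelReward_le z).trans (by norm_num)
  -- Packing doubles each letter and adds a terminator; there is one component per step, a claim
  -- followed by a message of `P`.
  msgLen := time * (2 * (1 + P.msgLen.comp query) + 1)
  -- The first line leaves room for the leading zeros, the one that ends them, and the coins of `P`.
  -- The second makes `2^(-N)` smaller than the price of a wrong claim.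
  randLen := time + 1 + P.randLen.comp query +
    (rewardLen.comp query + 3 + Polynomial.C (n + 1) * P.randLen.comp query)

end Composition


/-! ### Arthur's coins in the composed protocol -/

section coins

variable {k N : ℕ}

theorem lt_length_takeWhile_iff {α : Type} (p : α → Bool) (w : List α) (j : ℕ) :
    j < (w.takeWhile p).length ↔ ∃ h : j < w.length, ∀ (i : ℕ) (hi : i ≤ j), p w[i] = true := by
  induction w generalizing j with
  | nil => simp
  | cons a w ih =>
    rw [List.takeWhile_cons]
    by_cases ha : p a
    · simp only [ha, if_true]
      rcases j with - | j
      · simp only [List.length_cons, Nat.zero_lt_succ, Nat.le_zero, exists_true_left, true_iff]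
        rintro i rfl
        exact ha
      · rw [List.length_cons, Nat.succ_lt_succ_iff, ih]
        constructor
        · rintro ⟨h, h'⟩
          refine ⟨by simpa using h, fun i hi => ?_⟩
          rcases i with - | i
          · exact ha
          · exact h' i (by omega)
        · rintro ⟨h, h'⟩
          exact ⟨by simpa using h, fun i hi => h' (i + 1) (by omega)⟩
    · simp only [ha]
      constructor
      · intro h
        simp at h
      · rintro ⟨h, h'⟩
        exact absurd (h' 0 (Nat.zero_le _)) ha

/-- The number of leading zeros of the first random string. -/
def zeros (r : Fin (k + 1) → Fin N → Bool) : ℕ := ((List.ofFn (r 0)).takeWhile (!·)).length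

theorem lt_zeros_iff {r : Fin (k + 1) → Fin N → Bool} {j : ℕ} (hj : j < N) :
    j < zeros r ↔ ∀ i : Fin N, i.1 ≤ j → r 0 i = false := by
  rw [zeros, lt_length_takeWhile_iff]
  constructor
  · rintro ⟨h, h'⟩ i hi
    simpa using h' i hi
  · intro h
    refine ⟨by simpa using hj, fun i hi => ?_⟩
    simpa using h ⟨i, by omega⟩ hi

theorem zeros_eq_iff {r : Fin (k + 1) → Fin N → Bool} {j : ℕ} (hj : j < N) :
    zeros r = j ↔ (∀ i : Fin N, i.1 < j → r 0 i = false) ∧ r 0 ⟨j, hj⟩ = true := by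
  have h₁ := lt_zeros_iff (r := r) hj
  have h₂ : j ≤ zeros r ↔ ∀ i : Fin N, i.1 < j → r 0 i = false := by
    rcases j with - | j
    · simp
    · rw [Nat.succ_le_iff, lt_zeros_iff (by omega)]
      simp only [Nat.lt_succ_iff]
  constructor
  · intro h
    have h₃ := h₂.1 h.ge
    refine ⟨h₃, ?_⟩
    by_contra hf
    refine h.not_gt (h₁.2 fun i hi => ?_)
    rcases hi.lt_or_eq with hi | hi
    · exact h₃ i hi
    · obtain rfl : i = ⟨j, hj⟩ := Fin.ext hi
      simpa using hf
  · rintro ⟨h, h'⟩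
    refine le_antisymm (not_lt.1 fun hlt => ?_) (h₂.2 h)
    have := h₁.1 hlt ⟨j, hj⟩ le_rfl
    rw [h'] at this
    cases this

/-- Flipping coin `j` of the first string exchanges the outcomes with exactly `j` leading zeros and
those with more. -/
theorem card_zeros_eq {j : ℕ} (hj : j < N) :
    (Finset.univ.filter fun r : Fin (k + 1) → Fin N → Bool => zeros r = j).card =
      (Finset.univ.filter fun r : Fin (k + 1) → Fin N → Bool => j < zeros r).card := by
  let flip : (Fin (k + 1) → Fin N → Bool) → Fin (k + 1) → Fin N → Bool := fun r =>
    Function.update r 0 (Function.update (r 0) ⟨j, hj⟩ (!r 0 ⟨j, hj⟩))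
  have hne : ∀ i : Fin N, i.1 < j → i ≠ ⟨j, hj⟩ := by
    rintro i hi rfl
    exact lt_irrefl _ hi
  refine Finset.card_nbij' flip flip ?_ ?_ ?_ ?_
  · intro r hr
    simp only [Finset.coe_filter, Finset.mem_univ, true_and, Set.mem_ofPred_eq] at hr ⊢
    rw [zeros_eq_iff hj] at hr
    rw [lt_zeros_iff hj]
    intro i hi
    simp only [flip, Function.update_self]
    rcases hi.lt_or_eq with hi | hi
    · rw [Function.update_of_ne (hne i hi)]
      exact hr.1 i hi
    · obtain rfl : i = ⟨j, hj⟩ := Fin.ext hi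
      rw [Function.update_self, hr.2]
      rfl
  · intro r hr
    simp only [Finset.coe_filter, Finset.mem_univ, true_and, Set.mem_ofPred_eq] at hr ⊢
    rw [lt_zeros_iff hj] at hr
    rw [zeros_eq_iff hj]
    simp only [flip, Function.update_self]
    refine ⟨fun i hi => ?_, ?_⟩
    · rw [Function.update_of_ne (hne i hi)]
      exact hr i hi.le
    · rw [hr _ le_rfl]
      rfl
  · intro r _
    simp [flip]
  · intro r _
    simp [flip]

/-- The `l` coins of every round that follow the first `j + 1` ones. -/
def window {j l : ℕ} (h : j + 1 + l ≤ N) (r : Fin k → Fin N → Bool) : Fin k → Fin l → Bool :=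
  fun i s => r i ⟨j + 1 + s, by omega⟩

/-- Overwriting the window (`ov`) is injective from one fiber to any other. The window begins after
position `j`, where the first one stands, so the number of leading zeros does not change. -/
theorem exists_card_window_eq {j l : ℕ} (h : j + 1 + l ≤ N) :
    ∃ c, 0 < c ∧ ∀ s : Fin (k + 1) → Fin l → Bool,
      ((Finset.univ.filter fun r : Fin (k + 1) → Fin N → Bool => zeros r = j).filter
        fun r => window h r = s).card = c := by
  have hj : j < N := by omega
  let ov : (Fin (k + 1) → Fin l → Bool) → (Fin (k + 1) → Fin N → Bool) →
      Fin (k + 1) → Fin N → Bool := fun s r i t =>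
    if ht : j + 1 ≤ t.1 ∧ t.1 < j + 1 + l then s i ⟨t.1 - (j + 1), by omega⟩ else r i t
  have hz : ∀ s r, zeros r = j → zeros (ov s r) = j := by
    intro s r hr
    rw [zeros_eq_iff hj] at hr ⊢
    refine ⟨fun i hi => ?_, ?_⟩
    · have : ¬ (j + 1 ≤ i.1 ∧ i.1 < j + 1 + l) := by omega
      simp only [ov, this, dite_false]
      exact hr.1 i hi
    · simp [ov, hr.2]
  have hw : ∀ s r, window h (ov s r) = s := by
    intro s r
    funext i t
    have : j + 1 ≤ j + 1 + t.1 ∧ j + 1 + t.1 < j + 1 + l := by omega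
    simp [window, ov]
    omega
  have hov : ∀ s r, window h r = s → ov s r = r := by
    rintro s r rfl
    funext i t
    simp only [ov, window]
    split_ifs with ht
    · congr
      omega
    · rfl
  have hov₂ : ∀ s s' r, ov s (ov s' r) = ov s r := by
    intro s s' r
    funext i t
    simp only [ov]
    split_ifs <;> rfl
  have hcard : ∀ s s', ((Finset.univ.filter fun r : Fin (k + 1) → Fin N → Bool => zeros r = j).filter
      fun r => window h r = s).card ≤ ((Finset.univ.filter
        fun r : Fin (k + 1) → Fin N → Bool => zeros r = j).filter fun r => window h r = s').card := by
    intro s s'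
    refine Finset.card_le_card_of_injOn (ov s') ?_ ?_
    · intro r hr
      simp only [Finset.coe_filter, Finset.mem_filter, Finset.mem_univ, true_and,
        Set.mem_ofPred_eq] at hr ⊢
      exact ⟨hz _ _ hr.1, hw _ _⟩
    · intro r hr r' hr' he
      simp only [Finset.coe_filter, Finset.mem_filter, Finset.mem_univ, true_and,
        Set.mem_ofPred_eq] at hr hr'
      rw [← hov s r hr.2, ← hov s r' hr'.2, ← hov₂ s s' r, ← hov₂ s s' r', he]
  let s₀ : Fin (k + 1) → Fin l → Bool := fun _ _ => false
  refine ⟨_, Finset.card_pos.2 ?_, fun s => le_antisymm (hcard s s₀) (hcard s₀ s)⟩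
  -- An outcome with exactly `j` leading zeros, so that the fibers are not empty.
  let r₀ : Fin (k + 1) → Fin N → Bool := fun _ t => decide (t.1 = j)
  refine ⟨ov s₀ r₀, ?_⟩
  simp only [Finset.mem_filter, Finset.mem_univ, true_and]
  refine ⟨hz _ _ ((zeros_eq_iff hj).2 ⟨fun i hi => ?_, by simp [r₀]⟩), hw _ _⟩
  simp [r₀, hi.ne]

/-- Sums over all coins, split at the step `J`. -/
theorem sum_eq_sum_zeros (J : ℕ) (g : (Fin (k + 1) → Fin N → Bool) → ℝ) :
    ∑ r, g r = ∑ j ∈ Finset.range J, ∑ r with zeros r = j, g r +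
      ∑ r with zeros r = J, g r + ∑ r with J < zeros r, g r := by
  rw [← Finset.sum_range_succ (fun j => ∑ r with zeros r = j, g r),
    ← Finset.sum_filter_add_sum_filter_not Finset.univ fun r => zeros r < J + 1]
  congr 1
  · rw [← Finset.sum_fiberwise_of_maps_to (t := Finset.range (J + 1)) (g := zeros)
      fun r hr => Finset.mem_range.2 (Finset.mem_filter.1 hr).2]
    refine Finset.sum_congr rfl fun j hj => ?_
    rw [Finset.filter_filter]
    refine Finset.sum_congr (Finset.filter_congr fun r _ => ?_) fun _ _ => rfl
    have := Finset.mem_range.1 hj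
    constructor
    · exact fun h => h.2
    · exact fun h => ⟨by omega, h⟩
  · refine Finset.sum_congr (Finset.filter_congr fun r _ => ?_) fun _ _ => rfl
    omega

end coins


open Protocol

/-! ### Words of transcripts -/

section words

variable {A : Type}

theorem words_cons (p : List A × List A) (t : Transcript A) :
    words (p :: t) = p.1 :: p.2 :: words t := rfl

theorem words_append (t t' : Transcript A) : words (t ++ t') = words t ++ words t' :=
  List.flatMap_append

theorem length_words (t : Transcript A) : (words t).length = 2 * t.length := by
  induction t with
  | nil => rfl
  | cons p t ih => simp only [words_cons, List.length_cons, ih]; omega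

theorem words_mapTranscript (μ η : List A → List A) (t : Transcript A) (rest : List (List A)) :
    words (mapTranscript μ η t) = (List.range t.length).flatMap fun s =>
      [μ ((words t ++ rest).getD (2 * s) []), η ((words t ++ rest).getD (2 * s + 1) [])] := by
  induction t with
  | nil => rfl
  | cons p t ih =>
    rw [List.length_cons, List.range_succ_eq_map, List.flatMap_cons, List.flatMap_map]
    change _ :: _ :: words (mapTranscript μ η t) = _
    rw [ih]
    rfl

theorem getD_words_fst (t : Transcript A) (rest : List (List A)) {s : ℕ} (hs : s < t.length) :
    (words t ++ rest).getD (2 * s) [] = t[s].1 := by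
  induction t generalizing s with
  | nil => simp at hs
  | cons p t ih =>
    rcases s with - | s
    · rfl
    · exact ih (by simpa using hs)

theorem flatten_zipWith_eq_words (t : Transcript A) (cs : List (List A)) :
    (List.zipWith (fun p s => [p.1, s]) t cs).flatten =
      words (List.zipWith (fun p s => (p.1, s)) t cs) := by
  rw [words, List.flatMap_def, List.map_zipWith]

theorem getD_words_snd (t : Transcript A) (rest : List (List A)) {s : ℕ} (hs : s < t.length) :
    (words t ++ rest).getD (2 * s + 1) [] = t[s].2 := by
  induction t generalizing s with
  | nil => simp at hs
  | cons p t ih =>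
    rcases s with - | s
    · rfl
    · exact ih (by simpa using hs)

end words

/-! ### Answers and rewards of the composed protocol in closed form -/

namespace Composition

variable {A : Type} [Finite A] {bit : Bool ↪ A} {M : OracleTM A} {n : ℕ} {P : Protocol A (n + 1)}

theorem bit_false_ne_true : bit false ≠ bit true := fun h => by simpa using bit.injective h

theorem lead_map {N : ℕ} (r : Fin (n + 1) → Fin N → Bool) :
    lead bit ((List.ofFn (r 0)).map bit) = List.replicate (zeros r) (bit false) := by
  classical
  rw [zeros, lead]
  induction List.ofFn (r 0) with
  | nil => rfl
  | cons b w ih =>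
    cases b
    · simpa [List.replicate_succ] using ih
    · simp [bit_false_ne_true.symm]

theorem subAns_append (j : ℕ) (v : List A) :
    subAns bit (List.replicate j (bit false) ++ bit true :: v) = v := by
  classical
  rw [subAns]
  induction j with
  | zero => simp [bit_false_ne_true.symm]
  | succ j ih => simpa [List.replicate_succ] using ih

theorem lead_append (j : ℕ) (v : List A) :
    lead bit (List.replicate j (bit false) ++ bit true :: v) = List.replicate j (bit false) := by
  classical
  rw [lead]
  induction j with
  | zero => simp [bit_false_ne_true.symm]
  | succ j ih => simpa [List.replicate_succ] using ih

theorem subCoin_map {N j : ℕ} {q u : List A} (hu : u.length = j)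
    (h : j + 1 + P.randLen.eval q.length ≤ N) (r : Fin (n + 1) → Fin N → Bool) (i : Fin (n + 1)) :
    subCoin P q u ((List.ofFn (r i)).map bit) = (List.ofFn (window h r i)).map bit := by
  subst hu
  apply List.ext_getElem
  · simp [subCoin]
    omega
  · intro s h₁ h₂
    simp [subCoin, window]

theorem answerFun_eq {z : List (List A)} {i : ℕ} (hi : i < n + 1) (hz : z.length = 3 * i + 3) :
    answerFun bit M P z = roundAnswer bit M P z i := by
  have : ∀ L : List ℕ, i ∈ L → L.foldr
      (fun i a => if z.length = 3 * i + 3 then roundAnswer bit M P z i else a) [] =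
      roundAnswer bit M P z i := by
    intro L
    induction L with
    | nil => simp
    | cons i' L ih =>
      intro h
      rw [List.foldr_cons]
      split_ifs with h'
      · obtain rfl : i' = i := by omega
        rfl
      · rcases List.mem_cons.1 h with rfl | h
        · exact absurd hz h'
        · exact ih h
  exact this _ (List.mem_range.2 hi)

variable {time query rewardLen : Polynomial ℕ} {x m₁ : List A}

theorem getD_coinWords {k : ℕ} (P : Protocol A k) (r : P.Coins x) (i : Fin k) :
    (P.coinWords bit x r).getD i.1 [] = (List.ofFn (r i)).map bit := by
  rw [List.getD_eq_getElem _ _ (by simp [coinWords])]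
  simp [coinWords]

theorem getElem_coinWords {k : ℕ} (P : Protocol A k) (r : P.Coins x) {s : ℕ} (hs : s < k)
    (h : s < (P.coinWords bit x r).length) :
    (P.coinWords bit x r)[s] = (List.ofFn (r ⟨s, hs⟩)).map bit := by
  simp [coinWords]

theorem length_coinWords {k : ℕ} (P : Protocol A k) (r : P.Coins x) :
    (P.coinWords bit x r).length = k := by
  simp [coinWords]

/-- Arthur's answer after the transcript `t`, in terms of the query checked. -/
theorem answer_eq {t : Transcript A} {m : List A}
    {r : (protocol bit M P time query rewardLen).Coins x} (ht : t.length < n + 1)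
    (hm : (t.map Prod.fst).headD m = m₁) {u q : List A}
    (hu : u = List.replicate (zeros r) (bit false)) (hq : q = qry bit M x m₁ u) :
    (protocol bit M P time query rewardLen).answer bit x t m r = u ++ bit true :: P.V (q ::
      (words (mapTranscript (subMsg bit P q u) (subAns bit) t) ++ [subMsg bit P q u m] ++
        (List.range (t.length + 1)).map fun s => subCoin P q u
          (((protocol bit M P time query rewardLen).coinWords bit x r).getD s []))) := by
  set cs := (protocol bit M P time query rewardLen).coinWords bit x r
  have hcs : cs.length = n + 1 := length_coinWords _ r
  set z := x :: (words t ++ [m] ++ cs.take (t.length + 1)) with hz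
  have hlen : z.length = 3 * t.length + 3 := by
    simp only [hz, List.length_cons, List.length_append, length_words, List.length_take, hcs,
      List.length_nil]
    omega
  have hcoin : ∀ s < t.length + 1, z.getD (2 * t.length + 2 + s) [] = cs.getD s [] := by
    intro s hs
    have : z.getD (2 * t.length + 2 + s) [] =
        (words t ++ [m] ++ cs.take (t.length + 1)).getD (2 * t.length + 1 + s) [] := by
      rw [show 2 * t.length + 2 + s = (2 * t.length + 1 + s) + 1 by omega]
      rfl
    rw [this, List.getD_append_right _ _ _ _ (by simp [length_words])]
    rw [List.getD_eq_getElem?_getD, List.getD_eq_getElem?_getD, List.getElem?_take_of_lt]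
    · simp [length_words]
    · simp [length_words]
      omega
  have hmsg : z.getD (2 * t.length + 1) [] = m := by
    change (words t ++ [m] ++ cs.take (t.length + 1)).getD (2 * t.length) [] = m
    rw [List.append_assoc, List.getD_append_right _ _ _ _ (by rw [length_words])]
    simp [length_words]
  have hm₁ : z.getD 1 [] = m₁ := by
    rw [← hm]
    cases t <;> rfl
  have hlead : lead bit (z.getD (2 * t.length + 2) []) = u := by
    have := hcoin 0 (by omega)
    rw [Nat.add_zero] at this
    rw [this, hu, ← lead_map]
    exact congrArg _ (getD_coinWords _ r 0)
  change answerFun bit M P z = _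
  rw [answerFun_eq ht hlen, roundAnswer]
  simp only [hlead, hm₁, hmsg]
  have hx : z.getD 0 [] = x := rfl
  rw [hx, ← hq, words_mapTranscript _ _ _ ([m] ++ cs.take (t.length + 1)), ← List.append_assoc,
    List.map_congr_left fun s hs => by rw [hcoin s (List.mem_range.1 hs)]]
  rfl

/-- Arthur's first answer starts with the leading zeros of his first string, followed by a one, so
it determines which step is checked. -/
theorem zeros_eq_of_answer_eq {m : List A}
    {r r' : (protocol bit M P time query rewardLen).Coins x}
    (h : (protocol bit M P time query rewardLen).answer bit x [] m r =
      (protocol bit M P time query rewardLen).answer bit x [] m r') : zeros r = zeros r' := by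
  rw [answer_eq (by simp) rfl rfl rfl, answer_eq (by simp) rfl rfl rfl] at h
  simpa [lead_append] using congrArg (fun a => (lead bit a).length) h

theorem levelReward_eq {z : List (List A)} {u : List A} (h₀ : z.getD 0 [] = x)
    (h₁ : z.getD 1 [] = m₁) (hu : lead bit (z.getD 2 []) = u) : levelReward bit M P z =
      open Classical in
      if ((unpack bit m₁).drop u.length).isEmpty then []
      else if decide ((cfg bit M x m₁ u).l = some M.queryLabel) then
        queryReward bit P (qry bit M x m₁ u) (claim bit ((unpack bit m₁).getD u.length []))
          (fun s => subMsg bit P (qry bit M x m₁ u) u (z.getD (2 * s + 1) []))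
          fun s => subCoin P (qry bit M x m₁ u) u (z.getD (2 * s + 2) [])
      else [false, true] := by
  subst h₀ h₁ hu
  rfl

/-- The reward, in terms of the unscaled one. -/
theorem reward_eq {t : Transcript A} (hm : (t.map Prod.fst).head? = some m₁)
    {r : (protocol bit M P time query rewardLen).Coins x} {z : List (List A)}
    (hz : z = x :: words (List.zipWith (fun p s => (p.1, s)) t
      ((protocol bit M P time query rewardLen).coinWords bit x r))) :
    (protocol bit M P time query rewardLen).reward bit x t r = binaryValue (levelReward bit M P z) /
        2 ^ (zeros r * (protocol bit M P time query rewardLen).randLen.eval x.length) ∧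
      z.getD 0 [] = x ∧ z.getD 1 [] = m₁ ∧
      lead bit (z.getD 2 []) = List.replicate (zeros r) (bit false) := by
  have h₂ : z.getD 2 [] = (List.ofFn (r 0)).map bit := by
    rcases t with - | ⟨p, t⟩
    · simp at hm
    · rw [hz, coinWords, List.ofFn_succ]
      rfl
  have h₁ : z.getD 1 [] = m₁ := by
    rcases t with - | ⟨p, t⟩
    · simp at hm
    · rw [hz, coinWords, List.ofFn_succ]
      simp only [List.map_cons, List.head?_cons, Option.some.injEq] at hm
      exact hm
  have h₃ : lead bit (z.getD 2 []) = List.replicate (zeros r) (bit false) := by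
    rw [h₂, lead_map]
  refine ⟨?_, by rw [hz]; rfl, h₁, h₃⟩
  rw [reward, flatten_zipWith_eq_words, ← hz]
  change binaryValue (rewardFun bit M P z) = _
  rw [binaryValue_rewardFun, h₃, h₂]
  simp

theorem reward_le {t : Transcript A} (hm : (t.map Prod.fst).head? = some m₁)
    (r : (protocol bit M P time query rewardLen).Coins x) :
    (protocol bit M P time query rewardLen).reward bit x t r ≤ 3 / 4 /
      2 ^ (zeros r * (protocol bit M P time query rewardLen).randLen.eval x.length) := by
  rw [(reward_eq hm rfl).1]
  exact div_le_div_of_nonneg_right (binaryValue_levelReward_le _) (by positivity)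

theorem reward_eq_zero {t : Transcript A} (hm : (t.map Prod.fst).head? = some m₁)
    {r : (protocol bit M P time query rewardLen).Coins x}
    (h : (unpack bit m₁).length ≤ zeros r) :
    (protocol bit M P time query rewardLen).reward bit x t r = 0 := by
  obtain ⟨h₁, h₂, h₃, h₄⟩ := reward_eq (r := r) hm rfl
  rw [h₁, levelReward_eq h₂ h₃ h₄, if_pos (by simpa using h)]
  simp [binaryValue]

theorem reward_of_not_query {t : Transcript A} (hm : (t.map Prod.fst).head? = some m₁)
    {r : (protocol bit M P time query rewardLen).Coins x} (h : zeros r < (unpack bit m₁).length)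
    (hl : (cfg bit M x m₁ (List.replicate (zeros r) (bit false))).l ≠ some M.queryLabel) :
    (protocol bit M P time query rewardLen).reward bit x t r = 1 / 2 /
      2 ^ (zeros r * (protocol bit M P time query rewardLen).randLen.eval x.length) := by
  obtain ⟨h₁, h₂, h₃, h₄⟩ := reward_eq (r := r) hm rfl
  rw [h₁, levelReward_eq h₂ h₃ h₄, if_neg (by simpa using h), if_neg (by simpa using hl)]
  norm_num [binaryValue]

/-- Consistent coins reproduce the recorded answers, so recomputing Arthur's answers gives back the
transcript. -/
theorem interaction_eq {q : List A} {r : P.Coins q} {t : Transcript A}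
    (hr : r ∈ P.consistent bit q t) {ms cs : ℕ → List A}
    (hms : ∀ (s : ℕ) (hs : s < t.length), ms s = t[s].1)
    (hcs : ∀ s < t.length, (List.range (s + 1)).map cs = (P.coinWords bit q r).take (s + 1))
    (s : ℕ) (hs : s ≤ t.length) : interaction P.V q ms cs s = words (t.take s) := by
  simp only [consistent, Finset.mem_filter, Finset.mem_univ, true_and] at hr
  induction s with
  | zero => rfl
  | succ s ih =>
    rw [interaction, ih (by omega), List.take_succ_eq_append_getElem (by omega), words_append,
      hms s (by omega), hcs s (by omega)]
    have h := hr s (by omega)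
    rw [answer, List.length_take, min_eq_left (by omega)] at h
    rw [← h]
    rfl

theorem binaryValue_queryReward {q : List A} {r : P.Coins q} {t : Transcript A}
    (ht : t.length = n + 1) (hr : r ∈ P.consistent bit q t) {ms cs : ℕ → List A}
    (hms : ∀ (s : ℕ) (hs : s < t.length), ms s = t[s].1)
    (hcs : ∀ s < n + 1, cs s = (P.coinWords bit q r).getD s []) (β : Bool) :
    binaryValue (queryReward bit P q β ms cs) = P.valueReward bit q [bit β] t r := by
  have hcs' : ∀ s < t.length,
      (List.range (s + 1)).map cs = (P.coinWords bit q r).take (s + 1) := by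
    intro s hs
    apply List.ext_getElem
    · simp [length_coinWords]
      omega
    · intro i h₁ h₂
      simp only [List.length_map, List.length_range] at h₁
      rw [List.getElem_map, List.getElem_range, hcs i (by omega), List.getElem_take,
        List.getD_eq_getElem]
  have hφ : interaction P.V q ms cs n ++ [ms n] = (words t).dropLast := by
    have h := interaction_eq hr hms hcs' (n + 1) ht.ge
    rw [List.take_of_length_le ht.le] at h
    rw [← h, interaction]
    simp
  have hR : ((List.range (n + 1)).flatMap fun s => [ms s, cs s]) =
      (List.zipWith (fun p s => [p.1, s]) t (P.coinWords bit q r)).flatten := by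
    rw [List.flatMap_def]
    congr 1
    apply List.ext_getElem
    · simp [length_coinWords, ht]
    · intro i h₁ h₂
      simp only [List.length_map, List.length_range] at h₁
      rw [List.getElem_map, List.getElem_range, List.getElem_zipWith, hms i (by omega),
        hcs i h₁, List.getD_eq_getElem]
  rw [queryReward, valueReward, hφ, hR]
  by_cases h : P.φ (q :: (words t).dropLast) = [bit β]
  · rw [if_pos (by simpa using h), if_pos h, reward]
    simp only [List.cons_append, List.nil_append, binaryValue]
    norm_num
    ring
  · rw [if_neg (by simpa using h), if_neg h, binaryValue]

end Composition


open Protocol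

/-! ### The protocol for the oracle inside the composed protocol -/

namespace Composition

variable {A : Type} [Finite A] {bit : Bool ↪ A} {M : OracleTM A} {n : ℕ} {P : Protocol A (n + 1)}
  {time query rewardLen : Polynomial ℕ} {x m₁ : List A} {j : ℕ}

/-- At a step at which the oracle machine asks the oracle, the composed protocol plays the protocol
for the oracle. -/
theorem embeds {q : List A} (hq : q = qry bit M x m₁ (List.replicate j (bit false)))
    (hl : (cfg bit M x m₁ (List.replicate j (bit false))).l = some M.queryLabel)
    (hj : j < (unpack bit m₁).length)
    (hN : j + 1 + P.randLen.eval q.length ≤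
      (protocol bit M P time query rewardLen).randLen.eval x.length)
    (hmsg : j + (2 * (1 + P.msgLen.eval q.length) + 1) ≤
      (protocol bit M P time query rewardLen).msgLen.eval x.length) :
    Embeds (protocol bit M P time query rewardLen) P bit x q m₁
      (Finset.univ.filter fun r => zeros r = j) (window hN)
      (subMsg bit P q (List.replicate j (bit false))) (subAns bit)
      (fun a => ∃ v, a = List.replicate j (bit false) ++ bit true :: v)
      (1 / 2 ^ (j * (protocol bit M P time query rewardLen).randLen.eval x.length))
      (P.valueReward bit q [bit (claim bit ((unpack bit m₁).getD j []))]) where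
  w_nonneg := by positivity
  fiber := exists_card_window_eq hN
  length_μ m := by
    rw [subMsg, List.length_take]
    exact min_le_left _ _
  exists_μ m hm := by
    -- Only component `j` is read, so those before it may be empty. Its first letter occupies the
    -- place of the claim and is discarded by `subMsg`.
    refine ⟨pack bit (List.replicate j [] ++ [bit true :: m]), ?_, ?_⟩
    · rw [length_pack]
      simp only [List.map_append, List.map_replicate, List.sum_append, List.sum_replicate,
        List.map_singleton, List.sum_singleton, List.length_nil, List.length_cons, smul_eq_mul]
      omega
    · rw [subMsg, unpack_pack, List.length_replicate, List.getD_append_right _ _ _ _ (by simp)]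
      simpa using hm
  injOn := by
    rintro _ _ ⟨v, rfl⟩ ⟨v', rfl⟩ h
    rw [subAns_append, subAns_append] at h
    rw [h]
  good_answer t m r ht hm hr := by
    rw [answer_eq ht hm rfl rfl, (Finset.mem_filter.1 hr).2]
    exact ⟨_, rfl⟩
  answer t m r ht hm hr := by
    have hz := (Finset.mem_filter.1 hr).2
    rw [answer_eq ht hm (u := List.replicate j (bit false)) (by rw [hz]) hq, subAns_append,
      Protocol.answer]
    congr 3
    apply List.ext_getElem
    · simp [length_coinWords, mapTranscript]
      omega
    · intro s h₁ h₂
      simp only [List.length_map, List.length_range] at h₁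
      rw [List.getElem_map, List.getElem_range, List.getElem_take]
      have hs : s < n + 1 := by omega
      rw [getD_coinWords _ r ⟨s, hs⟩, subCoin_map (List.length_replicate ..) hN,
        getElem_coinWords P _ hs]
  not_good := by
    rintro t m r ht hm hr ⟨v, hv⟩
    refine hr (Finset.mem_filter.2 ⟨Finset.mem_univ _, ?_⟩)
    rw [answer_eq ht hm rfl rfl] at hv
    simpa [lead_append] using congrArg (fun a => (lead bit a).length) hv
  reward t r ht hm hr hcons := by
    have hz := (Finset.mem_filter.1 hr).2
    set t' := List.zipWith (fun p s => (p.1, s)) t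
      ((protocol bit M P time query rewardLen).coinWords bit x r) with ht'
    have htl : t'.length = n + 1 := by simp [ht', length_coinWords, ht]
    obtain ⟨h₁, h₂, h₃, h₄⟩ := reward_eq (r := r) hm (z := x :: words t') rfl
    rw [hz] at h₁ h₄
    rw [h₁, levelReward_eq h₂ h₃ h₄, if_neg (by simpa using hj), if_pos (by simpa using hl), ← hq,
      binaryValue_queryReward (t := mapTranscript (subMsg bit P q (List.replicate j (bit false)))
        (subAns bit) t) (by simpa [mapTranscript] using ht) hcons, List.length_replicate]
    · ring
    · intro s hs
      have hs' : s < t.length := by simpa [mapTranscript] using hs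
      have := getD_words_fst t' [] (s := s) (by omega)
      rw [List.append_nil] at this
      change subMsg bit P q _ ((words t').getD (2 * s) []) = _
      rw [this]
      simp [mapTranscript, ht']
    · intro s hs
      have := getD_words_snd t' [] (s := s) (by omega)
      rw [List.append_nil] at this
      change subCoin P q _ ((words t').getD (2 * s + 1) []) = _
      rw [this, getD_coinWords P _ ⟨s, hs⟩, ← subCoin_map (List.length_replicate ..) hN]
      simp only [ht', List.getElem_zipWith]
      rw [getElem_coinWords _ r hs]

theorem head?_of_prefix {m a : List A} {t : Transcript A} (h : [(m, a)] <+: t) :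
    (t.map Prod.fst).head? = some m := by
  obtain ⟨t, rfl⟩ := h
  rfl

/-- All coins that are consistent with Arthur's first answer have the same number of leading
zeros. -/
theorem zeros_eq_of_mem_consistent {m : List A} {t : Transcript A}
    {r r' : (protocol bit M P time query rewardLen).Coins x}
    (ht : [(m, (protocol bit M P time query rewardLen).answer bit x [] m r)] <+: t)
    (hr : r' ∈ (protocol bit M P time query rewardLen).consistent bit x t) :
    zeros r' = zeros r := by
  simp only [consistent, Finset.mem_filter, Finset.mem_univ, true_and] at hr
  obtain ⟨t, rfl⟩ := ht
  exact (zeros_eq_of_answer_eq (hr 0 (by simp))).symm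

theorem consistent_singleton_nonempty (m : List A)
    (r : (protocol bit M P time query rewardLen).Coins x) :
    ((protocol bit M P time query rewardLen).consistent bit x
      [(m, (protocol bit M P time query rewardLen).answer bit x [] m r)]).Nonempty :=
  Protocol.consistent_append_answer_nonempty (t := []) _ _ _
    (by rw [consistent_nil]; exact Finset.mem_univ r)

/-! ### Values after Merlin's first message -/

section values

variable (bit M P time query rewardLen x m₁)

/-- The optimal value after Merlin's first message `m₁`, when Arthur has the coins `r`. -/
noncomputable def opening (r : (protocol bit M P time query rewardLen).Coins x) : ℝ :=
  (protocol bit M P time query rewardLen).optValue bit x n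
    [(m₁, (protocol bit M P time query rewardLen).answer bit x [] m₁ r)]

variable {bit M P time query rewardLen x m₁} {r : (protocol bit M P time query rewardLen).Coins x}

theorem opening_nonneg : 0 ≤ opening bit M P time query rewardLen x m₁ r := by
  rw [opening, optValue_eq_optGen]
  exact le_optGen (consistent_singleton_nonempty _ _) fun t _ _ r _ => reward_nonneg r

/-- After Arthur's first answer all consistent coins have the same number of leading zeros, so every
continuation carries the same weight. -/
theorem opening_le : opening bit M P time query rewardLen x m₁ r ≤ 3 / 4 /
    2 ^ (zeros r * (protocol bit M P time query rewardLen).randLen.eval x.length) := by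
  rw [opening, optValue_eq_optGen]
  refine optGen_le (consistent_singleton_nonempty _ _) fun t ht r' hr' => ?_
  rw [← zeros_eq_of_mem_consistent ht hr']
  exact reward_le (head?_of_prefix ht) r'

theorem opening_eq_zero (h : (unpack bit m₁).length ≤ zeros r) :
    opening bit M P time query rewardLen x m₁ r = 0 := by
  refine le_antisymm ?_ opening_nonneg
  rw [opening, optValue_eq_optGen]
  refine optGen_le (consistent_singleton_nonempty _ _) fun t ht r' hr' => ?_
  refine (reward_eq_zero (head?_of_prefix ht) ?_).le
  rwa [zeros_eq_of_mem_consistent ht hr']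

theorem opening_of_not_query (h : zeros r < (unpack bit m₁).length)
    (hl : (cfg bit M x m₁ (List.replicate (zeros r) (bit false))).l ≠ some M.queryLabel) :
    opening bit M P time query rewardLen x m₁ r = 1 / 2 /
      2 ^ (zeros r * (protocol bit M P time query rewardLen).randLen.eval x.length) := by
  have key : ∀ t, [(m₁, (protocol bit M P time query rewardLen).answer bit x [] m₁ r)] <+: t →
      ∀ r' ∈ (protocol bit M P time query rewardLen).consistent bit x t,
      (protocol bit M P time query rewardLen).reward bit x t r' = 1 / 2 /
        2 ^ (zeros r * (protocol bit M P time query rewardLen).randLen.eval x.length) := by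
    intro t ht r' hr'
    have hz := zeros_eq_of_mem_consistent ht hr'
    rw [← hz]
    exact reward_of_not_query (head?_of_prefix ht) (by rwa [hz]) (by rwa [hz])
  rw [opening, optValue_eq_optGen]
  exact le_antisymm
    (optGen_le (consistent_singleton_nonempty _ _) fun t ht r' hr' => (key t ht r' hr').le)
    (le_optGen (consistent_singleton_nonempty _ _) fun t ht _ r' hr' => (key t ht r' hr').ge)

end values

end Composition


open Protocol

open RationalProofs.Rep (Reg rep bound)

/-- Polynomial-time functions have outputs of polynomial length, and admissible transcripts have
polynomial length. The bound controls the denominators of the rewards and serves as `rewardLen` in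
the composed protocol. -/
theorem Protocol.exists_length_R_le {A : Type} [Finite A] {k : ℕ} (P : Protocol A k)
    (bit : Bool ↪ A) : ∃ L : Polynomial ℕ, ∀ (x : List A) (t : Transcript A) (r : P.Coins x),
      (∀ p ∈ t, p.1.length ≤ P.msgLen.eval x.length) →
      (P.R (x :: (List.zipWith (fun p s => [p.1, s]) t (P.coinWords bit x r)).flatten)).length ≤
        L.eval x.length := by
  obtain ⟨p, hp⟩ := P.R_polyTime.pt.size
  refine ⟨p.comp (Polynomial.X + 1 + Polynomial.C k * (P.msgLen + 1 + (P.randLen + 1))),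
    fun x t r ht => ?_⟩
  have h := hp (x :: (List.zipWith (fun p s => [p.1, s]) t (P.coinWords bit x r)).flatten)
  simp only [Rep.size_list, Rep.size_tuple] at h
  refine h.trans ?_
  rw [Polynomial.eval_comp]
  refine Polynomial.eval_mono_nat _ ?_
  simp only [Polynomial.eval_add, Polynomial.eval_mul, Polynomial.eval_X, Polynomial.eval_C,
    Polynomial.eval_one]
  have hcs : ∀ s ∈ P.coinWords bit x r, s.length = P.randLen.eval x.length := by
    intro s hs
    obtain ⟨i, rfl⟩ := (List.mem_ofFn' _ _).1 hs
    simp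
  have key : ∀ (t : Transcript A) (cs : List (List A)),
      (∀ p ∈ t, p.1.length ≤ P.msgLen.eval x.length) →
      (∀ s ∈ cs, s.length = P.randLen.eval x.length) →
      (encodeTuple (List.zipWith (fun p s => [p.1, s]) t cs).flatten).length ≤
        cs.length * (P.msgLen.eval x.length + 1 + (P.randLen.eval x.length + 1)) := by
    intro t
    induction t with
    | nil => simp
    | cons p t ih =>
      rintro (_ | ⟨s, cs⟩) ht hcs
      · simp
      · have h₁ := ih cs (fun p hp => ht p (by simp [hp])) fun s hs => hcs s (by simp [hs])
        have h₂ := ht p (by simp)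
        have h₃ := hcs s (by simp)
        rw [List.zipWith_cons_cons, List.flatten_cons, encodeTuple_append, List.length_append,
          List.length_cons, Nat.succ_mul]
        simp only [encodeTuple_cons, encodeTuple_nil, List.length_append, List.length_map,
          List.length_cons, List.length_nil]
        omega
  have h₁ := key t _ ht hcs
  rw [show (P.coinWords bit x r).length = k by simp [coinWords]] at h₁
  rw [encodeTuple_cons, List.length_append, List.length_cons, List.length_map]
  omega

/-! ### The contribution of a single step to Merlin's expected reward -/

namespace Composition

variable {A : Type} {bit : Bool ↪ A} {M : OracleTM A} {n : ℕ} {P : Protocol A (n + 1)}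
  {x m : List A} {O : Language A} {j : ℕ}

/-- The message `m` contains a correct claim for the step `j`. -/
def Correct (bit : Bool ↪ A) (M : OracleTM A) (O : Language A) (x m : List A) (j : ℕ) : Prop :=
  j < (unpack bit m).length ∧ ((M.run O x j).l = some M.queryLabel →
    (claim bit ((unpack bit m).getD j []) = true ↔ M.query (M.run O x j) ∈ O))

theorem sim_claims_take (hj : j ≤ (unpack bit m).length) (h : ∀ i < j, Correct bit M O x m i) :
    M.sim x ((claims bit m).take j) = M.run O x j := by
  refine M.sim_eq_run O x _ j (by simpa [claims] using hj) fun i hi hl => ?_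
  have := (h i hi).2 hl
  rw [List.getD_eq_getElem _ _ (h i hi).1] at this
  simpa [claims] using this

theorem cfg_eq_run (hj : j ≤ (unpack bit m).length) (h : ∀ i < j, Correct bit M O x m i) :
    cfg bit M x m (List.replicate j (bit false)) = M.run O x j := by
  rw [cfg, List.length_replicate, sim_claims_take hj h]

/-- The optimal value for the check of step `j`. -/
noncomputable def checkValue (bit : Bool ↪ A) (M : OracleTM A) (P : Protocol A (n + 1))
    (O : Language A) (x : List A) (j : ℕ) : ℝ :=
  open Classical in
  if (M.run O x j).l = some M.queryLabel then
    P.optGen bit (M.query (M.run O x j)) (P.valueReward bit (M.query (M.run O x j))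
      (charFun bit O (M.query (M.run O x j)))) (n + 1) []
  else 1 / 2

variable [Finite A]

/-- A correct claim with rational play secures at least `1/2`, so a missing claim, which earns
nothing, costs at least that much. -/
theorem half_le_checkValue (hP : P.Computes bit (charFun bit O)) :
    1 / 2 ≤ checkValue bit M P O x j := by
  rw [checkValue]
  split_ifs
  · have ht : (P.consistent bit (M.query (M.run O x j)) []).Nonempty := by
      rw [consistent_nil]
      exact Finset.univ_nonempty
    rw [hP.optGen_valueReward_eq (Nat.zero_add _) ht isRational_nil, optValue_eq_optGen]
    have := le_optGen (c := 0) (n := n + 1) ht fun t _ _ r _ =>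
      reward_nonneg (P := P) (bit := bit) (t := t) r
    linarith
  · exact le_rfl

theorem length_query_run_le {d : ℕ}
    (hd : ∀ (x : List A) (βs : List Bool), (M.query (M.sim x βs)).length ≤ x.length + βs.length * d)
    (x : List A) (j : ℕ) : (M.query (M.run O x j)).length ≤ x.length + j * d := by
  classical
  -- The true oracle answers, used as claims, turn the run with the oracle into a simulation, to
  -- which the bound applies.
  have := hd x (((List.range j).map fun i => decide (M.query (M.run O x i) ∈ O)).take j)
  rw [M.sim_eq_run O x _ j (by simp) fun i hi _ => by simp] at this
  simpa using this

theorem charFun_eq_iff {q : List A} {β : Bool} :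
    [bit β] = charFun bit O q ↔ (β = true ↔ q ∈ O) := by
  classical
  rw [charFun, List.cons.injEq, bit.apply_eq_iff_eq]
  cases β <;> simp

variable {time rewardLen : Polynomial ℕ} {d : ℕ}

/-- The length of random strings in the composed protocol. -/
theorem eval_randLen (query : Polynomial ℕ) (N : ℕ) :
    (protocol bit M P time query rewardLen).randLen.eval N =
      time.eval N + 1 + P.randLen.eval (query.eval N) +
        (rewardLen.eval (query.eval N) + 3 + (n + 1) * P.randLen.eval (query.eval N)) := by
  simp [protocol, Polynomial.eval_comp]

theorem eval_msgLen (query : Polynomial ℕ) (N : ℕ) :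
    (protocol bit M P time query rewardLen).msgLen.eval N =
      time.eval N * (2 * (1 + P.msgLen.eval (query.eval N)) + 1) := by
  simp [protocol, Polynomial.eval_comp]

theorem length_query_le (hd : ∀ (x : List A) (βs : List Bool),
      (M.query (M.sim x βs)).length ≤ x.length + βs.length * d) (hj : j < time.eval x.length) :
    (M.query (M.run O x j)).length ≤ (Polynomial.X + time * Polynomial.C d).eval x.length := by
  refine (length_query_run_le hd x j).trans ?_
  simp only [Polynomial.eval_add, Polynomial.eval_mul, Polynomial.eval_X, Polynomial.eval_C]
  gcongr

/-- If all earlier claims are correct, the query that is checked is the true query of step `j`, and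
the embedded game is `P` on it, opened with the first message that `m` holds for this step. -/
theorem sum_opening_of_query (hd : ∀ (x : List A) (βs : List Bool),
      (M.query (M.sim x βs)).length ≤ x.length + βs.length * d) (hj : j < time.eval x.length)
    (hm : j < (unpack bit m).length)
    (h : ∀ i < j, Correct bit M O x m i) (hl : (M.run O x j).l = some M.queryLabel) :
    ∑ r with zeros r = j, opening bit M P time (Polynomial.X + time * Polynomial.C d) rewardLen x m r =
      (Finset.univ.filter fun r : (protocol bit M P time (Polynomial.X + time * Polynomial.C d)
          rewardLen).Coins x => zeros r = j).card *
        (1 / 2 ^ (j * (protocol bit M P time (Polynomial.X + time * Polynomial.C d)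
          rewardLen).randLen.eval x.length) *
        P.expectNext bit (M.query (M.run O x j)) (P.optGen bit (M.query (M.run O x j))
          (P.valueReward bit (M.query (M.run O x j)) [bit (claim bit ((unpack bit m).getD j []))]) n)
          [] (subMsg bit P (M.query (M.run O x j)) (List.replicate j (bit false)) m)) := by
  have hq := length_query_le (O := O) hd hj
  have hcfg := cfg_eq_run hm.le h
  refine (embeds (x := x) (m₁ := m) (j := j) (q := M.query (M.run O x j)) ?_ ?_ hm ?_ ?_).sum_optValue_eq rfl
  · rw [qry, hcfg]
  · rw [hcfg, hl]
  · rw [eval_randLen]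
    have := Polynomial.eval_mono_nat P.randLen hq
    omega
  · rw [eval_msgLen]
    have := Polynomial.eval_mono_nat P.msgLen hq
    refine le_trans ?_ (Nat.mul_le_mul_right _ hj)
    have h₃ : j ≤ j * (2 * (1 + P.msgLen.eval
        ((Polynomial.X + time * Polynomial.C d).eval x.length)) + 1) :=
      Nat.le_mul_of_pos_right j (Nat.succ_pos _)
    rw [Nat.succ_mul j]
    omega

theorem sum_opening_of_not_query {query : Polynomial ℕ} (hm : j < (unpack bit m).length)
    (h : ∀ i < j, Correct bit M O x m i) (hl : (M.run O x j).l ≠ some M.queryLabel) :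
    ∑ r with zeros r = j, opening bit M P time query rewardLen x m r =
      (Finset.univ.filter fun r : (protocol bit M P time query
          rewardLen).Coins x => zeros r = j).card *
        (1 / 2 ^ (j * (protocol bit M P time query rewardLen).randLen.eval x.length) * (1 / 2)) := by
  rw [← nsmul_eq_mul]
  refine Finset.sum_eq_card_nsmul fun r hr => ?_
  have hz := (Finset.mem_filter.1 hr).2
  rw [opening_of_not_query (by rwa [hz]) (by rw [hz, cfg_eq_run hm.le h]; exact hl), hz]
  ring

theorem sum_opening_le (hd : ∀ (x : List A) (βs : List Bool),
      (M.query (M.sim x βs)).length ≤ x.length + βs.length * d) (hj : j < time.eval x.length)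
    (h : ∀ i ≤ j, Correct bit M O x m i) :
    ∑ r with zeros r = j, opening bit M P time (Polynomial.X + time * Polynomial.C d) rewardLen x m r ≤
      (Finset.univ.filter fun r : (protocol bit M P time (Polynomial.X + time * Polynomial.C d)
          rewardLen).Coins x => zeros r = j).card *
        (1 / 2 ^ (j * (protocol bit M P time (Polynomial.X + time * Polynomial.C d)
          rewardLen).randLen.eval x.length) * checkValue bit M P O x j) := by
  have hm := (h j le_rfl).1
  have h' : ∀ i < j, Correct bit M O x m i := fun i hi => h i hi.le
  by_cases hl : (M.run O x j).l = some M.queryLabel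
  · rw [sum_opening_of_query hd hj hm h' hl, checkValue, if_pos hl,
      ← charFun_eq_iff.2 ((h j le_rfl).2 hl)]
    gcongr
    refine expectNext_le_iSup _ _ ?_
    rw [subMsg, List.length_take]
    exact min_le_left _ _
  · rw [sum_opening_of_not_query hm h' hl, checkValue, if_neg hl]

/-- The length `N` was chosen so that `2^(-N)` is below both possible losses: the price of a wrong
value in `P`, and the `1/2` lost when the claim is missing. -/
theorem sum_opening_le_of_not_correct (hd : ∀ (x : List A) (βs : List Bool),
      (M.query (M.sim x βs)).length ≤ x.length + βs.length * d) (hj : j < time.eval x.length)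
    (hP : P.Computes bit (charFun bit O))
    (hL : ∀ (x : List A) (t : Transcript A) (r : P.Coins x),
      (∀ p ∈ t, p.1.length ≤ P.msgLen.eval x.length) →
      (P.R (x :: (List.zipWith (fun p s => [p.1, s]) t (P.coinWords bit x r)).flatten)).length ≤
        rewardLen.eval x.length)
    (h : ∀ i < j, Correct bit M O x m i) (hn : ¬ Correct bit M O x m j) {N : ℕ}
    (hN : N = (protocol bit M P time (Polynomial.X + time * Polynomial.C d)
      rewardLen).randLen.eval x.length) :
    ∑ r with zeros r = j, opening bit M P time (Polynomial.X + time * Polynomial.C d) rewardLen x m r ≤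
      (Finset.univ.filter fun r : (protocol bit M P time (Polynomial.X + time * Polynomial.C d)
          rewardLen).Coins x => zeros r = j).card *
        (1 / 2 ^ (j * N) * (checkValue bit M P O x j - 1 / 2 ^ N)) := by
  have hN' := eval_randLen (bit := bit) (M := M) (P := P) (time := time) (rewardLen := rewardLen)
    (Polynomial.X + time * Polynomial.C d) x.length
  rw [← hN] at hN'
  by_cases hm : j < (unpack bit m).length
  -- A claim that is present can only be incorrect at a query step.
  · have hl : (M.run O x j).l = some M.queryLabel := by
      by_contra hl
      exact hn ⟨hm, fun hl' => absurd hl' hl⟩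
    have hne : [bit (claim bit ((unpack bit m).getD j []))] ≠
        charFun bit O (M.query (M.run O x j)) := fun he =>
      hn ⟨hm, fun _ => charFun_eq_iff.1 he⟩
    rw [sum_opening_of_query hd hj hm h hl, checkValue, if_pos hl, hN]
    gcongr
    have hgap := hP.optGen_valueReward_add_le hne (L := rewardLen.eval (M.query (M.run O x j)).length)
      fun t r _ ht => hL _ t r ht
    have hle : P.expectNext bit (M.query (M.run O x j)) (P.optGen bit (M.query (M.run O x j))
        (P.valueReward bit (M.query (M.run O x j)) [bit (claim bit ((unpack bit m).getD j []))]) n)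
        [] (subMsg bit P (M.query (M.run O x j)) (List.replicate j (bit false)) m) ≤
        P.optGen bit (M.query (M.run O x j)) (P.valueReward bit (M.query (M.run O x j))
          [bit (claim bit ((unpack bit m).getD j []))]) (n + 1) [] := by
      refine expectNext_le_iSup _ _ ?_
      rw [subMsg, List.length_take]
      exact min_le_left _ _
    have hq := length_query_le (O := O) hd hj
    have h₁ := Polynomial.eval_mono_nat rewardLen hq
    have h₂ := Polynomial.eval_mono_nat P.randLen hq
    have h₃ := Nat.mul_le_mul_left (n + 1) h₂
    have hpow : (1 / 2 : ℝ) ^ N ≤ (1 / 2) ^ (rewardLen.eval (M.query (M.run O x j)).length + 2 +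
        (n + 1) * P.randLen.eval (M.query (M.run O x j)).length) :=
      pow_le_pow_of_le_one (by norm_num) (by norm_num) (by omega)
    rw [one_div_pow, hN] at hpow
    linarith
  -- Without a claim for step `j` the reward vanishes.
  · have h₀ : ∑ r with zeros r = j, opening bit M P time (Polynomial.X + time * Polynomial.C d)
        rewardLen x m r = 0 := by
      refine Finset.sum_eq_zero fun r hr => opening_eq_zero ?_
      rw [(Finset.mem_filter.1 hr).2]
      exact not_lt.1 hm
    rw [h₀]
    have h₁ := half_le_checkValue (M := M) (x := x) (j := j) hP
    have h₂ : (1 / 2 : ℝ) ^ N ≤ (1 / 2) ^ 1 :=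
      pow_le_pow_of_le_one (by norm_num) (by norm_num) (by omega)
    rw [one_div_pow] at h₂
    have h₃ : 0 ≤ checkValue bit M P O x j - 1 / 2 ^ N := by linarith
    positivity

/-- Merlin can answer all queries correctly and play optimally in each of them. -/
theorem exists_honest {T : ℕ} (hd : ∀ (x : List A) (βs : List Bool),
      (M.query (M.sim x βs)).length ≤ x.length + βs.length * d) (hT : T ≤ time.eval x.length)
    (P : Protocol A (n + 1)) :
    ∃ m : List A, m.length ≤ (protocol bit M P time (Polynomial.X + time * Polynomial.C d)
        rewardLen).msgLen.eval x.length ∧ ∀ j < T,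
      ∑ r with zeros r = j, opening bit M P time (Polynomial.X + time * Polynomial.C d) rewardLen x m r =
      (Finset.univ.filter fun r : (protocol bit M P time (Polynomial.X + time * Polynomial.C d)
          rewardLen).Coins x => zeros r = j).card *
        (1 / 2 ^ (j * (protocol bit M P time (Polynomial.X + time * Polynomial.C d)
          rewardLen).randLen.eval x.length) * checkValue bit M P O x j) := by
  classical
  choose best hbest hopt using fun q : List A => exists_expectNext_eq_iSup P bit q
    (P.optGen bit q (P.valueReward bit q (charFun bit O q)) n) []
  -- One component per step before time `T`: the true answer and an optimal opening of `P`. At steps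
  -- that are not queries this is padding.
  set z := (List.range T).map fun j =>
    bit (decide (M.query (M.run O x j) ∈ O)) :: best (M.query (M.run O x j)) with hz
  have hlen : (unpack bit (pack bit z)).length = T := by
    rw [unpack_pack]
    simp [hz]
  have hget : ∀ j < T, (unpack bit (pack bit z)).getD j [] =
      bit (decide (M.query (M.run O x j) ∈ O)) :: best (M.query (M.run O x j)) := by
    intro j hj
    rw [unpack_pack, List.getD_eq_getElem _ _ (by simpa [hz] using hj)]
    simp [hz]
  have hclaim : ∀ j < T, claim bit ((unpack bit (pack bit z)).getD j []) =
      decide (M.query (M.run O x j) ∈ O) := by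
    intro j hj
    rw [hget j hj, claim]
    simp
  have hcorrect : ∀ j < T, Correct bit M O x (pack bit z) j := by
    intro j hj
    refine ⟨by rwa [hlen], fun _ => ?_⟩
    rw [hclaim j hj]
    simp
  refine ⟨pack bit z, ?_, fun j hj => ?_⟩
  · rw [length_pack, eval_msgLen]
    refine le_trans ?_ (Nat.mul_le_mul_right _ hT)
    have := List.sum_le_card_nsmul (z.map fun w => 2 * w.length + 1)
      (2 * (1 + P.msgLen.eval ((Polynomial.X + time * Polynomial.C d).eval x.length)) + 1) (by
        intro l hl
        simp only [hz, List.map_map, List.mem_map, List.mem_range, Function.comp] at hl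
        obtain ⟨j, hj, rfl⟩ := hl
        have h₁ := hbest (M.query (M.run O x j))
        have h₂ := Polynomial.eval_mono_nat P.msgLen (length_query_le (O := O) hd (hj.trans_le hT))
        rw [List.length_cons]
        omega)
    simpa [hz] using this
  · have hm := (hcorrect j hj).1
    have h' : ∀ i < j, Correct bit M O x (pack bit z) i := fun i hi => hcorrect i (hi.trans hj)
    by_cases hl : (M.run O x j).l = some M.queryLabel
    · rw [sum_opening_of_query hd (hj.trans_le hT) hm h' hl, checkValue, if_pos hl,
        charFun_eq_iff.2 ((hcorrect j hj).2 hl), subMsg, List.length_replicate, hget j hj,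
        List.tail_cons, List.take_of_length_le (hbest _), hopt]
      rfl
    · rw [sum_opening_of_not_query hm h' hl, checkValue, if_neg hl]

end Composition


open Protocol

/-! ### Optimality forces correct claims -/

namespace Composition

variable {A : Type} [Finite A] {bit : Bool ↪ A} {M : OracleTM A} {n : ℕ} {P : Protocol A (n + 1)}
  {x m : List A} {O S : Language A} {time rewardLen : Polynomial ℕ} {d : ℕ}

/-- An optimal first message answers all oracle queries correctly. -/
theorem correct_of_optimal {T : ℕ} (hd : ∀ (x : List A) (βs : List Bool),
      (M.query (M.sim x βs)).length ≤ x.length + βs.length * d) (hT : T ≤ time.eval x.length)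
    (hP : P.Computes bit (charFun bit O))
    (hL : ∀ (x : List A) (t : Transcript A) (r : P.Coins x),
      (∀ p ∈ t, p.1.length ≤ P.msgLen.eval x.length) →
      (P.R (x :: (List.zipWith (fun p s => [p.1, s]) t (P.coinWords bit x r)).flatten)).length ≤
        rewardLen.eval x.length)
    (hm : ∀ m' : List A, m'.length ≤ (protocol bit M P time (Polynomial.X + time * Polynomial.C d)
        rewardLen).msgLen.eval x.length →
      ∑ r, opening bit M P time (Polynomial.X + time * Polynomial.C d) rewardLen x m' r ≤
        ∑ r, opening bit M P time (Polynomial.X + time * Polynomial.C d) rewardLen x m r) :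
    ∀ j < T, Correct bit M O x m j := by
  classical
  by_contra hcon
  have hex : ∃ j, j < T ∧ ¬ Correct bit M O x m j := by
    push Not at hcon
    exact hcon
  obtain ⟨hJT, hJ⟩ := Nat.find_spec hex
  -- At the first incorrect claim all earlier ones are correct, so the query checked there is still
  -- the true one.
  have hlt : ∀ i < Nat.find hex, Correct bit M O x m i := fun i hi => by
    by_contra h
    exact Nat.find_min hex hi ⟨hi.trans hJT, h⟩
  generalize Nat.find hex = J at hJT hJ hlt
  obtain ⟨m', hm', hval⟩ := exists_honest (O := O) (rewardLen := rewardLen) (bit := bit) hd hT P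
  have h := hm m' hm'
  have hJ' := hJT.trans_le hT
  have hrand := eval_randLen (bit := bit) (M := M) (P := P) (time := time) (rewardLen := rewardLen)
    (Polynomial.X + time * Polynomial.C d) x.length
  have hgap := sum_opening_le_of_not_correct hd hJ' hP hL hlt hJ rfl
  have hJN : J < (protocol bit M P time (Polynomial.X + time * Polynomial.C d)
      rewardLen).randLen.eval x.length := by omega
  rw [sum_eq_sum_zeros J, sum_eq_sum_zeros J, hval J hJT] at h
  have h₁ : ∑ j ∈ Finset.range J, ∑ r with zeros r = j,
        opening bit M P time (Polynomial.X + time * Polynomial.C d) rewardLen x m r ≤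
      ∑ j ∈ Finset.range J, ∑ r with zeros r = j,
        opening bit M P time (Polynomial.X + time * Polynomial.C d) rewardLen x m' r := by
    refine Finset.sum_le_sum fun j hj => ?_
    have hj := Finset.mem_range.1 hj
    rw [hval j (hj.trans hJT)]
    exact sum_opening_le hd (hj.trans hJ') fun i hi => hlt i (hi.trans_lt hj)
  have h₂ : 0 ≤ ∑ r with J < zeros r,
      opening bit M P time (Polynomial.X + time * Polynomial.C d) rewardLen x m' r :=
    Finset.sum_nonneg fun r _ => opening_nonneg
  -- Every later step is scaled by at least one more factor `2^(-N)`, whatever Merlin does there.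
  have h₃ : ∑ r with J < zeros r,
      opening bit M P time (Polynomial.X + time * Polynomial.C d) rewardLen x m r ≤
      (Finset.univ.filter fun r : (protocol bit M P time (Polynomial.X + time * Polynomial.C d)
          rewardLen).Coins x => J < zeros r).card *
        (3 / 4 / 2 ^ ((J + 1) * (protocol bit M P time (Polynomial.X + time * Polynomial.C d)
          rewardLen).randLen.eval x.length)) := by
    rw [← nsmul_eq_mul]
    refine Finset.sum_le_card_nsmul _ _ _ fun r hr => opening_le.trans ?_
    have := (Finset.mem_filter.1 hr).2
    gcongr
    · exact one_le_two
    · exact this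
  rw [← card_zeros_eq hJN, Nat.succ_mul, pow_add] at h₃
  have hcard : 0 < (Finset.univ.filter fun r : (protocol bit M P time
      (Polynomial.X + time * Polynomial.C d) rewardLen).Coins x => zeros r = J).card := by
    -- A window of length `0` has a single fiber; that it is not empty shows that exactly `J` zeros
    -- do occur.
    obtain ⟨c, hc, hc'⟩ := exists_card_window_eq (k := n) (j := J) (l := 0) (N :=
      (protocol bit M P time (Polynomial.X + time * Polynomial.C d) rewardLen).randLen.eval x.length)
      (by omega)
    rw [← hc' fun _ _ => false] at hc
    exact hc.trans_le (Finset.card_filter_le _ _)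
  generalize (Finset.univ.filter fun r : (protocol bit M P time
      (Polynomial.X + time * Polynomial.C d) rewardLen).Coins x => zeros r = J).card = c at *
  have hc : (0 : ℝ) < c := by exact_mod_cast hcard
  set g : ℝ := 2 ^ (protocol bit M P time (Polynomial.X + time * Polynomial.C d)
    rewardLen).randLen.eval x.length with hg
  have hg0 : 0 < g := by positivity
  set w : ℝ := 2 ^ (J * (protocol bit M P time (Polynomial.X + time * Polynomial.C d)
    rewardLen).randLen.eval x.length) with hw
  have hw0 : 0 < w := by positivity
  -- The loss `1 / g` at step `J` exceeds the possible later gain `3 / 4 / g`; both events have the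
  -- same number `c` of outcomes.
  have h₄ : (c : ℝ) * (1 / w * (checkValue bit M P O x J - 1 / g)) + c * (3 / 4 / (w * g)) <
      c * (1 / w * checkValue bit M P O x J) := by
    have : (c : ℝ) * (1 / w * (checkValue bit M P O x J - 1 / g)) + c * (3 / 4 / (w * g)) =
        c * (1 / w * checkValue bit M P O x J) - c / (4 * (w * g)) := by
      field_simp
      ring
    rw [this]
    have : 0 < c / (4 * (w * g)) := by positivity
    linarith
  linarith

/-- The value is read off the claims in the first message, so only the optimality of that message is
needed. It makes the claims correct up to the halting time, and later claims have no influence. -/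
theorem computes (hd : ∀ (x : List A) (βs : List Bool),
      (M.query (M.sim x βs)).length ≤ x.length + βs.length * d)
    (hM : ∀ x : List A, M.OutputsInTime O x (charFun bit S x) (time.eval x.length))
    (hP : P.Computes bit (charFun bit O))
    (hL : ∀ (x : List A) (t : Transcript A) (r : P.Coins x),
      (∀ p ∈ t, p.1.length ≤ P.msgLen.eval x.length) →
      (P.R (x :: (List.zipWith (fun p s => [p.1, s]) t (P.coinWords bit x r)).flatten)).length ≤
        rewardLen.eval x.length) :
    (protocol bit M P time (Polynomial.X + time * Polynomial.C d) rewardLen).Computes bit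
      (charFun bit S) := by
  intro x t ht hcons hrat
  obtain ⟨T, hT, hhalt, hout, -⟩ := M.exists_halting_time (hM x)
  rcases t with - | ⟨⟨m, a⟩, t⟩
  · simp at ht
  have hopt := (hrat 0 (by simp)).2
  simp only [List.take_zero, List.getElem_cons_zero, Nat.zero_add, Nat.add_sub_cancel] at hopt
  have hcorrect := correct_of_optimal hd hT hP hL (m := m) (x := x) fun m' hm' => by
    have h := hopt ⟨m', hm'⟩
    rw [expectNext, expectNext, consistent_nil] at h
    -- Before the first message no coins are excluded, so multiplying by their number turns the
    -- expectations into sums over all coins.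
    have h' := mul_le_mul_of_nonneg_left h (Nat.cast_nonneg (α := ℝ) (Finset.univ (α :=
      (protocol bit M P time (Polynomial.X + time * Polynomial.C d) rewardLen).Coins x)).card)
    rwa [Finset.card_mul_expect, Finset.card_mul_expect] at h'
  have hlen : T ≤ (unpack bit m).length := by
    rcases T with - | T
    · exact Nat.zero_le _
    · exact (hcorrect T (Nat.lt_succ_self T)).1
  have hsim := sim_claims_take hlen hcorrect
  have hsim' : M.sim x (claims bit m) = M.run O x T := by
    rw [← List.take_append_drop T (claims bit m), M.sim_append_of_halted, hsim]
    rw [hsim]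
    exact hhalt
  have hφ : (x :: (words ((m, a) :: t)).dropLast).getD 1 [] = m := by
    rw [words_cons]
    rfl
  change valueFun bit M _ = _
  rw [valueFun, hφ]
  change M.output (M.sim x (claims bit m)) = _
  rw [hsim', hout]

end Composition

theorem PRel_subset_DRMA_succ {A : Type} [Finite A] (bit : Bool ↪ A) (n : ℕ) :
    PRel bit (DRMA bit (n + 1)) ⊆ DRMA bit (n + 1) := by
  rintro S ⟨O, ⟨P, hP⟩, M, time, hM⟩
  obtain ⟨d, hd⟩ := M.exists_length_query_le
  obtain ⟨L, hL⟩ := P.exists_length_R_le bit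
  exact ⟨_, Composition.computes hd hM hP hL⟩

/-! ### Protocols without communication -/

namespace Protocol

/-- Without rounds the empty transcript is the only one, and it is vacuously rational; only the
value function remains. -/
theorem computes_zero_iff {A : Type} {P : Protocol A 0} {bit : Bool ↪ A} {f : List A → List A} :
    P.Computes bit f ↔ ∀ x, P.φ [x] = f x := by
  constructor
  · intro h x
    refine h x [] rfl ?_ fun i hi => absurd hi (Nat.not_lt_zero i)
    rw [consistent_nil]
    exact Finset.univ_nonempty
  · intro h x t ht _ _
    rw [List.eq_nil_of_length_eq_zero ht]
    exact h x

end Protocol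

/-- The oracle is itself decided in polynomial time, so its answers can be computed during the
simulation. -/
theorem PRel_subset_DRMA_zero {A : Type} [Finite A] (bit : Bool ↪ A) :
    PRel bit (DRMA bit 0) ⊆ DRMA bit 0 := by
  classical
  rintro S ⟨O, ⟨P, hP⟩, M, time, hM⟩
  rw [computes_zero_iff] at hP
  let ask : List A × List Bool → Bool := fun p => decide (P.φ [M.query (M.sim p.1 p.2)] = [bit true])
  have hask : PT ask := PT.eq_singleton (bit true) (P.φ_polyTime.pt.comp
    (.tuple_cons (M.PT_query PT.fst PT.snd) .tuple_nil))
  -- The word on the query stack is decided at every step, whether or not it is asked; answers at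
  -- other steps are ignored. Each pass simulates the machine anew from the answers found so far, so
  -- the state grows by one letter only.
  let step : List A × List Bool → List A × List Bool := fun p => (p.1, p.2 ++ [ask p])
  have hstep : PT step := PT.fst.pair (PT.snd.append (hask.cons .nil))
  have hiter : ∀ x i, step^[i] (x, []) = (x, (List.range i).map fun i =>
      decide (M.query (M.run O x i) ∈ O)) := by
    intro x i
    induction i with
    | zero => rfl
    | succ i ih =>
      rw [Function.iterate_succ_apply', ih, List.range_succ, List.map_append, List.map_singleton]
      have hs := M.sim_eq_run O x ((List.range i).map fun i =>
        decide (M.query (M.run O x i) ∈ O)) i (by simp) fun i' hi' _ => by simp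
      rw [List.take_of_length_le (by simp)] at hs
      simp only [step, ask]
      rw [hs, hP, charFun]
      simp
  have hφ : PT fun z : List (List A) => M.output (M.sim (z.headD [])
      (step^[(List.replicate (time.eval (z.headD []).length) ()).length] (z.headD [], [])).2) := by
    have hx : PT fun z : List (List A) => z.headD [] := PT.id.tuple_headD
    have hu := PT.unary_eval time (PT.unary_length hx)
    refine M.PT_output hx (PT.iterate hu (hx.pair .nil) hstep
      (hx.size.add hu.size) fun z i hi => ?_).psnd
    rw [hiter]
    simp only [Rep.size_prod, Rep.size_list, List.length_map, List.length_range,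
      List.length_replicate] at hi ⊢
    omega
  have : Nonempty A := ⟨bit true⟩
  refine ⟨⟨fun _ => [], fun _ => [], _, PT.nil.polyTimeOnTuples, PT.nil.polyTimeOnTuples,
    hφ.polyTimeOnTuples, fun z => by simp [binaryValue], 0, 0⟩, computes_zero_iff.2 fun x => ?_⟩
  · obtain ⟨T, hT, hhalt, hout, -⟩ := M.exists_halting_time (hM x)
    simp only [List.headD_cons, hiter, List.length_replicate]
    have hs := M.sim_eq_run O x ((List.range (time.eval x.length)).map fun i =>
      decide (M.query (M.run O x i) ∈ O)) (time.eval x.length) (by simp) fun i _ _ => by simp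
    rw [List.take_of_length_le (by simp)] at hs
    rw [hs, M.run_eq_of_halted O x hT hhalt, hout]

end RationalProofs

theorem mainTheorem2 {A : Type} [Finite A] (bit : Bool ↪ A) (k : ℕ) :
    RationalProofs.PRel bit (RationalProofs.DRMA bit k) = RationalProofs.DRMA bit k := by
  refine Set.Subset.antisymm ?_ fun S hS => ⟨S, hS, RationalProofs.polyTimeTuringReducible_refl bit S⟩
  rcases k with - | n
  · exact RationalProofs.PRel_subset_DRMA_zero bit
  · exact RationalProofs.PRel_subset_DRMA_succ bit n
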